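/- **Notation.** Let $m,\nu,k$ be integers with $k\ge 1$, and let $1\le p<\infty$. For $r>0$, $Q^m_r=\{x\in\mathbb R^m: |x_j|<r \text{ for all } j\}$ is the cube of radius $r$ (half the side length). A *cubication* of $\mathbb R^m$ of radius $\eta$ is a family of closed axis-parallel $m$-dimensional cubes of radius $\eta$ whose union is $\mathbb R^m$ and such that any two cubes of the family which are not disjoint intersect in a common face. A *subskeleton* $\mathcal U^\ell$ of $\mathbb R^m$ of dimension $\ell$ and radius $\eta$ is a set of $\ell$-dimensional faces of the cubes of a cubication of $\mathbb R^m$ of radius $\eta$; for $0\le i\le \ell$, $\mathcal U^i$ is the set of all $i$-dimensional faces of elements of $\mathcal U^\ell$, and $U^\ell=\bigcup_{\sigma\in\mathcal U^\ell}\sigma$. The geometric support of $\Phi:\mathbb R^m\to\mathbb R^m$ is $\operatorname{Supp}\Phi=\overline{\{x:\Phi(x)\ne x\}}$. For $u\in W^{k,p}(\Omega;\mathbb R^\nu)$, with $\Omega$ open and $\Phi(\Omega)\subset\Omega$, "$v=u\circ\Phi$ in $W^{k,p}(\Omega;\mathbb R^\nu)$" means that $v\in W^{k,p}(\Omega;\mathbb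 R^\nu)$ and that there is a sequence of smooth maps $u_n\in W^{k,p}(\Omega;\mathbb R^\nu)$ converging to $u$ in $W^{k,p}(\Omega;\mathbb R^\nu)$ such that $u_n\circ\Phi$ converges to $v$ in $W^{k,p}(\Omega;\mathbb R^\nu)$. The essential range of $u$ on $\Omega$ is the set of $y\in\mathbb R^\nu$ such that $\{x\in\Omega:|u(x)-y|<\varepsilon\}$ has positive Lebesgue measure for every $\varepsilon>0$. **Proposition (opening).** Let $0<\rho<\frac12$. There are constants $C,C'>0$ depending only on $m,k,p,\rho$ such that the following holds. Let $\ell\in\{0,\dots,m-1\}$, let $\eta>0$, let $\mathcal U^\ell$ be a subskeleton of $\mathbb R^m$ of dimension $\ell$ and radius $\eta$, let $\Omega=U^\ell+Q^m_{2\rho\eta}$, and let $u\in W^{k,p}(\Omega;\mathbb R^\nu)$. Then there exist a smooth map $\Phi:\mathbb R^m\to\mathbb R^m$ and a map $v=u\circ\Phi$ in $W^{k,p}(\Omega;\mathbb R^\nu)$ (in the above sense) such that 1. for every $i\in\{0,\dots,\ell\}$ and every $\sigma^i\in\mathcal U^i$, $\Phi$ is constant on each closed $(m-i)$-dimensional cube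 of radius $\rho\eta$ which is orthogonal to $\sigma^i$ and centered at a point of $\sigma^i$; 2. $\operatorname{Supp}\Phi\subset\Omega$ and $\Phi(\Omega)\subset\Omega$; 3. for every $j\in\{1,\dots,k\}$, $$\eta^j\|D^j(u\circ\Phi)\|_{L^p(\Omega)}\le C\sum_{i=1}^j\eta^i\|D^iu\|_{L^p(\Omega)};$$ 4. for every $\sigma^\ell\in\mathcal U^\ell$ and every $j\in\{1,\dots,k\}$, $$\eta^j\|D^j(u\circ\Phi)\|_{L^p(\sigma^\ell+Q^m_{2\rho\eta})}\le C'\sum_{i=1}^j\eta^i\|D^iu\|_{L^p(\sigma^\ell+Q^m_{2\rho\eta})};$$ 5. the essential range of $u\circ\Phi$ on $\Omega$ is contained in the essential range of $u$ on $\Omega$. -/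

import Mathlib

open Set Filter Topology MeasureTheory
open scoped ENNReal ContDiff Pointwise

noncomputable section

namespace CubeOpening

/-- The Euclidean space `ℝ^m`. -/
abbrev E (m : ℕ) : Type := EuclideanSpace ℝ (Fin m)

/-! ### Cubes, faces, cubications, skeletons -/

/-- The open cube of radius `r` (half of the side length) centred at the origin of `ℝ^m`. -/
def openCube (m : ℕ) (r : ℝ) : Set (E m) := {x | ∀ j, |x j| < r}

/-- Combinatorial data of an axis-parallel closed cube in `ℝ^m`: its center and the set of
coordinate directions along which it extends. Together with a radius `r` it describes the closed
cube `Cell.carrier r`, whose dimension is the number of directions. -/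
structure Cell (m : ℕ) where
  center : E m
  dirs : Finset (Fin m)

/-- The dimension of a cell. -/
def Cell.dim {m : ℕ} (σ : Cell m) : ℕ := σ.dirs.card

/-- The closed cube of radius `r` described by a cell. -/
def Cell.carrier {m : ℕ} (r : ℝ) (σ : Cell m) : Set (E m) :=
  {x | (∀ j ∈ σ.dirs, |x j - σ.center j| ≤ r) ∧ ∀ j ∉ σ.dirs, x j = σ.center j}

/-- `τ` is a face (of any dimension, `σ` itself included) of the cube `σ` of radius `r`: it is
obtained by fixing some of the free coordinates of `σ` at one of their two extreme values. -/
def Cell.IsFace {m : ℕ} (r : ℝ) (τ σ : Cell m) : Prop :=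
  τ.dirs ⊆ σ.dirs ∧
    (∀ j ∈ σ.dirs \ τ.dirs, |τ.center j - σ.center j| = r) ∧
    ∀ j ∉ σ.dirs \ τ.dirs, τ.center j = σ.center j

/-- The closed cube of radius `s` and dimension `m - dim σ`, centred at the point `x`, which is
orthogonal to the cell `σ`. -/
def Cell.normalCube {m : ℕ} (σ : Cell m) (s : ℝ) (x : E m) : Set (E m) :=
  {y | (∀ j ∈ σ.dirs, y j = x j) ∧ ∀ j ∉ σ.dirs, |y j - x j| ≤ s}

/-- The union of a family of cells of radius `r`. -/
def cellUnion {m : ℕ} (r : ℝ) (U : Set (Cell m)) : Set (E m) := ⋃ σ ∈ U, σ.carrier r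

/-- `S` is a cubication of `A` of radius `r`: a family of closed `m`-dimensional cubes of radius `r`
whose union is `A`, such that any two of them which are not disjoint intersect in a common face. -/
structure IsCubication {m : ℕ} (r : ℝ) (S : Set (Cell m)) (A : Set (E m)) : Prop where
  dim_eq : ∀ σ ∈ S, σ.dim = m
  union_eq : cellUnion r S = A
  inter_face : ∀ σ₁ ∈ S, ∀ σ₂ ∈ S, (σ₁.carrier r ∩ σ₂.carrier r).Nonempty →
    ∃ τ : Cell m, τ.IsFace r σ₁ ∧ τ.IsFace r σ₂ ∧ σ₁.carrier r ∩ σ₂.carrier r = τ.carrier r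

/-- The skeleton of dimension `i` of a family `U` of cells of radius `r`: all `i`-dimensional faces
of all elements of `U`. -/
def skeleton {m : ℕ} (r : ℝ) (i : ℕ) (U : Set (Cell m)) : Set (Cell m) :=
  {τ | τ.dim = i ∧ ∃ σ ∈ U, τ.IsFace r σ}

/-- `U` is a subskeleton of `ℝ^m` of dimension `ℓ` and radius `r`: a set of `ℓ`-dimensional faces
of the cubes of some cubication of `ℝ^m` of radius `r`. -/
def IsSubskeleton {m : ℕ} (r : ℝ) (ℓ : ℕ) (U : Set (Cell m)) : Prop :=
  ∃ S : Set (Cell m), IsCubication r S univ ∧ U ⊆ skeleton r ℓ S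

/-! ### Sobolev spaces -/

section Sobolev

variable {m : ℕ} {F : Type*} [NormedAddCommGroup F] [NormedSpace ℝ F]

/-- `g` is the `j`-th weak derivative `D^j u` of `u` in the open set `Ω`. -/
def IsWeakDeriv (j : ℕ) (Ω : Set (E m)) (u : E m → F)
    (g : E m → ContinuousMultilinearMap ℝ (fun _ : Fin j => E m) F) : Prop :=
  LocallyIntegrableOn u Ω ∧ LocallyIntegrableOn g Ω ∧
    ∀ φ : E m → ℝ, ContDiff ℝ ∞ φ → HasCompactSupport φ → tsupport φ ⊆ Ω →
      ∀ w : Fin j → E m,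
        ∫ x in Ω, iteratedFDeriv ℝ j φ x w • u x = (-1 : ℝ) ^ j • ∫ x in Ω, φ x • g x w

open Classical in
/-- The `j`-th weak derivative of `u` in the open set `Ω` (unique almost everywhere in `Ω`); by
convention it is `0` when `u` has no such weak derivative. -/
def weakDeriv (j : ℕ) (Ω : Set (E m)) (u : E m → F) :
    E m → ContinuousMultilinearMap ℝ (fun _ : Fin j => E m) F :=
  if h : ∃ g, IsWeakDeriv j Ω u g then h.choose else 0

/-- `u` belongs to the Sobolev space `W^{k,p}(Ω; F)`. Functions are defined on the whole space, but
only their restrictions to `Ω` matter. -/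
structure MemSobolev (k : ℕ) (p : ℝ≥0∞) (Ω : Set (E m)) (u : E m → F) : Prop where
  memLp : MemLp u p (volume.restrict Ω)
  hasWeakDeriv : ∀ j ∈ Finset.Icc 1 k, ∃ g, IsWeakDeriv j Ω u g
  memLp_weakDeriv : ∀ j ∈ Finset.Icc 1 k, MemLp (weakDeriv j Ω u) p (volume.restrict Ω)

/-- The norm of `W^{k,p}(Ω; F)`: the sum of the `L^p` norms of `u, Du, …, D^k u`. -/
def sobolevNorm (k : ℕ) (p : ℝ≥0∞) (Ω : Set (E m)) (u : E m → F) : ℝ≥0∞ :=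
  eLpNorm u p (volume.restrict Ω) +
    ∑ j ∈ Finset.Icc 1 k, eLpNorm (weakDeriv j Ω u) p (volume.restrict Ω)

/-- The sequence `un` converges to `u` in `W^{k,p}(Ω; F)`. -/
structure TendstoSobolev (k : ℕ) (p : ℝ≥0∞) (Ω : Set (E m)) (un : ℕ → E m → F) (u : E m → F) :
    Prop where
  mem_seq : ∀ n, MemSobolev k p Ω (un n)
  mem_lim : MemSobolev k p Ω u
  tendsto : Tendsto (fun n => sobolevNorm k p Ω (un n - u)) atTop (𝓝 0)

/-- `v` is a composition `u ∘ Φ` in `W^{k,p}(Ω; F)`: there are smooth maps `u_n` on `Ω` converging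
to `u` in `W^{k,p}(Ω; F)` such that `u_n ∘ Φ` converges to `v` in `W^{k,p}(Ω; F)`. -/
def IsSobolevComp (k : ℕ) (p : ℝ≥0∞) (Ω : Set (E m)) (u : E m → F) (Φ : E m → E m)
    (v : E m → F) : Prop :=
  ∃ un : ℕ → E m → F, (∀ n, ContDiffOn ℝ ∞ (un n) Ω) ∧
    TendstoSobolev k p Ω un u ∧ TendstoSobolev k p Ω (fun n => un n ∘ Φ) v

/-- The essential range of `u` on `Ω`: the set of points all of whose neighbourhoods have a preimage
in `Ω` of positive Lebesgue measure. -/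
def essRange (Ω : Set (E m)) (u : E m → F) : Set F :=
  {y | ∀ ε > 0, 0 < volume {x | x ∈ Ω ∧ dist (u x) y < ε}}

end Sobolev

/-- The geometric support of a map `Φ : ℝ^m → ℝ^m`. -/
def geomSupport {m : ℕ} (Φ : E m → E m) : Set (E m) := closure {x | Φ x ≠ x}

end CubeOpening

end

/-!
The map `Φ` is a composition of `m` stages: in the stage of dimension `d = 0, …, m - 1`, space is
opened along the `d`-dimensional faces of the subskeleton. Near the center of such a face, the stage
map projects a neighbourhood onto the face. Near the boundary of the face, the composition of the
previous stages is already constant in the directions normal to a face of lower dimension, hence in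
particular in the directions normal to the given face. The radius of the opened neighbourhoods
shrinks in each stage, from `2ρ` to `ρ` in total (`isOpenedAt_comp_stageMap`,
`exists_openingMap`).

A projection onto a face destroys all integral estimates, but its conjugates by small translations
do not do so on average: by Fubini's theorem, the mean over the shifts `a` of
`∫ f (φ (x + a) - a) dx` is at most a constant times `∫ f`, for every nonnegative `f`
(`lintegral_lintegral_conj_translate_le`). So for finitely many functions `f`, given in advance, each
face has a good shift (`exists_shift`). The estimates are localized to boxes which form a partition
of the space and are mapped into themselves by all the stage maps; the cubical neighbourhoods of the
cells and their union are unions of such boxes. This yields `∫_N f ∘ Φ ≤ C ∫_N f` for all these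
neighbourhoods `N` with the same constant. That the cubes of a cubication of the whole space are the
cells of a cubic lattice follows from the condition on their intersections
(`IsCubication.exists_origin`), and a homothety reduces the lattice to the integer grid
(`exists_openingMap_of_isSubskeleton`).

For a Sobolev map `u`, smooth maps `f n` which converge rapidly to `u` along with their derivatives
exist by the theorem of Meyers and Serrin (`exists_smooth_eLpNorm_sub_le`). The functions `f` above
are chosen as the `p`-th powers of the weak derivatives of `u`, as weighted sums of the `p`-th powers
of the errors of the approximations, and as the indicator function of the null set where `u` leaves
its essential range (`exists_controlling_functions`). For the resulting `Φ`, the derivatives of `f n`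
composed with `Φ` converge in `L^p`; by the chain rule, the derivatives of `f n ∘ Φ` form Cauchy
sequences, so that `f n ∘ Φ` converges in the Sobolev space to a map `v`, and the pointwise estimate
of the chain rule passes to the limit (`exists_tendsto_iteratedFDeriv_comp`). Since only derivatives
of positive order occur in the chain rule, the same is true of the resulting estimates. Finally, the
values of `v` lie in the essential range of `u` almost everywhere.
-/

namespace CubeOpening

section WeakDerivatives

variable {m : ℕ} {F : Type*} [NormedAddCommGroup F] [NormedSpace ℝ F]

/-! ### Iterated derivatives of smooth functions -/

/-- Directional derivatives commute with evaluation of the iterated derivative. -/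
theorem fderiv_iteratedFDeriv_apply {G : Type*} [NormedAddCommGroup G] [NormedSpace ℝ G]
    {f : E m → G} {x : E m} (hf : ContDiffAt ℝ ∞ f x) {j : ℕ} (w : Fin j → E m) (v : E m) :
    fderiv ℝ (fun y => iteratedFDeriv ℝ j f y w) x v =
      iteratedFDeriv ℝ (j + 1) f x (Fin.cons v w) := by
  have hd : DifferentiableAt ℝ (iteratedFDeriv ℝ j f) x :=
    hf.differentiableAt_iteratedFDeriv (by exact_mod_cast WithTop.coe_lt_top j)
  rw [iteratedFDeriv_succ_apply_left, Fin.cons_zero, Fin.tail_cons,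
    fderiv_continuousMultilinear_apply_const hd]
  rfl

theorem ContDiff.iteratedFDeriv_apply_const {G : Type*} [NormedAddCommGroup G] [NormedSpace ℝ G]
    {f : E m → G} (hf : ContDiff ℝ ∞ f) {j : ℕ} (w : Fin j → E m) :
    ContDiff ℝ ∞ (fun y => iteratedFDeriv ℝ j f y w) :=
  (ContinuousMultilinearMap.apply ℝ (fun _ : Fin j => E m) G w).contDiff.comp
    (hf.iteratedFDeriv_right (m := ∞) (by exact_mod_cast le_top))

/-- The order of differentiation may be exchanged: `D^{j+1} f (v, w) = D^j (D_v f) (w)`. -/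
theorem iteratedFDeriv_cons_eq {G : Type*} [NormedAddCommGroup G] [NormedSpace ℝ G]
    {f : E m → G} (hf : ContDiff ℝ ∞ f) (v : E m) {j : ℕ} (w : Fin j → E m) (x : E m) :
    iteratedFDeriv ℝ (j + 1) f x (Fin.cons v w) =
      iteratedFDeriv ℝ j (fun y => fderiv ℝ f y v) x w := by
  induction j generalizing x with
  | zero =>
    rw [iteratedFDeriv_succ_apply_right, iteratedFDeriv_zero_apply, iteratedFDeriv_zero_apply]
    rfl
  | succ j ih =>
    have hfv : ContDiff ℝ ∞ (fun y => fderiv ℝ f y v) :=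
      (hf.fderiv_right (m := ∞) le_rfl).clm_apply contDiff_const
    have key : ∀ y, iteratedFDeriv ℝ j (fun y => fderiv ℝ f y v) y (Fin.tail w) =
        fderiv ℝ (fun y => iteratedFDeriv ℝ j f y (Fin.tail w)) y v := fun y => by
      rw [fderiv_iteratedFDeriv_apply hf.contDiffAt, ih]
    have h1 : iteratedFDeriv ℝ (j + 1) (fun y => fderiv ℝ f y v) x w =
        fderiv ℝ (fun y => iteratedFDeriv ℝ j (fun y => fderiv ℝ f y v) y (Fin.tail w)) x
          (w 0) := by
      rw [fderiv_iteratedFDeriv_apply hfv.contDiffAt, Fin.cons_self_tail]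
    set h : E m → G := fun y => iteratedFDeriv ℝ j f y (Fin.tail w) with hh
    have hhd : ContDiff ℝ ∞ h := ContDiff.iteratedFDeriv_apply_const hf _
    have hhd' : Differentiable ℝ (fderiv ℝ h) :=
      (hhd.fderiv_right (m := ∞) le_rfl).differentiable (by simp)
    rw [h1, ← fderiv_iteratedFDeriv_apply hf.contDiffAt]
    have h3 : (fun y => iteratedFDeriv ℝ (j + 1) f y w) = fun y => fderiv ℝ h y (w 0) := by
      funext y
      rw [hh, fderiv_iteratedFDeriv_apply hf.contDiffAt, Fin.cons_self_tail]
    rw [h3, funext key, fderiv_clm_apply (hhd' x) (by fun_prop),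
      fderiv_clm_apply (hhd' x) (by fun_prop)]
    have hs : IsSymmSndFDerivAt ℝ h x :=
      hhd.contDiffAt.isSymmSndFDerivAt (by
        simpa using WithTop.coe_le_coe.2 (le_top (a := (2 : ℕ∞))))
    simpa using hs.eq v (w 0)

/-! ### Weak derivatives -/

theorem integrable_smul_of_tsupport_subset {G : Type*} [NormedAddCommGroup G] [NormedSpace ℝ G]
    {Ω : Set (E m)} {f : E m → G} (hf : LocallyIntegrableOn f Ω) {ψ : E m → ℝ}
    (hψ : Continuous ψ) (hc : HasCompactSupport ψ) (hs : tsupport ψ ⊆ Ω) :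
    Integrable (fun x => ψ x • f x) := by
  have h1 : IntegrableOn f (tsupport ψ) := hf.integrableOn_compact_subset hs hc
  have h2 : IntegrableOn (fun x => ψ x • f x) (tsupport ψ) :=
    h1.continuousOn_smul hψ.continuousOn hc
  refine (integrableOn_iff_integrable_of_support_subset ?_).1 h2
  intro x hx
  refine subset_tsupport ψ ?_
  intro h0
  simp [h0] at hx

theorem setIntegral_smul_eq_integral {G : Type*} [NormedAddCommGroup G] [NormedSpace ℝ G]
    {Ω : Set (E m)} {f : E m → G} {ψ : E m → ℝ} (hs : tsupport ψ ⊆ Ω) :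
    ∫ x in Ω, ψ x • f x = ∫ x, ψ x • f x :=
  setIntegral_eq_integral_of_forall_compl_eq_zero fun x hx => by
    rw [image_eq_zero_of_notMem_tsupport fun h => hx (hs h), zero_smul]

theorem tsupport_iteratedFDeriv_apply_subset (φ : E m → ℝ) {j : ℕ} (w : Fin j → E m) :
    tsupport (fun x => iteratedFDeriv ℝ j φ x w) ⊆ tsupport φ :=
  (closure_mono (Function.support_subset_iff'.2 fun x hx => by
    simp [Function.notMem_support.1 hx])).trans (tsupport_iteratedFDeriv_subset (𝕜 := ℝ) j)

theorem tsupport_fderiv_apply_subset (φ : E m → ℝ) (v : E m) :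
    tsupport (fun x => fderiv ℝ φ x v) ⊆ tsupport φ :=
  (closure_mono (Function.support_subset_iff'.2 fun x hx => by
    simp [Function.notMem_support.1 hx])).trans (tsupport_fderiv_subset ℝ)

/-- Iterated integration by parts. No regularity of `f` is needed outside of `Ω`, since the test
function vanishes there. -/
theorem integral_iteratedFDeriv_smul {Ω : Set (E m)} (hΩ : IsOpen Ω) {f : E m → F}
    (hf : ContDiffOn ℝ ∞ f Ω) (j : ℕ) (φ : E m → ℝ) (hφ : ContDiff ℝ ∞ φ)
    (hc : HasCompactSupport φ) (hs : tsupport φ ⊆ Ω) (w : Fin j → E m) :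
    ∫ x, iteratedFDeriv ℝ j φ x w • f x =
      (-1 : ℝ) ^ j • ∫ x, φ x • iteratedFDeriv ℝ j f x w := by
  induction j generalizing φ with
  | zero => simp
  | succ j ih =>
    have hcont : ∀ i : ℕ, ContinuousOn (iteratedFDeriv ℝ i f) Ω := fun i x hx =>
      (((hf.contDiffAt (hΩ.mem_nhds hx)).iteratedFDeriv_right (m := 0) (i := i)
        (by exact_mod_cast le_top)).continuousAt).continuousWithinAt
    have hconta : ∀ (i : ℕ) (v : Fin i → E m),
        LocallyIntegrableOn (fun x => iteratedFDeriv ℝ i f x v) Ω := fun i v =>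
      ContinuousOn.locallyIntegrableOn
        ((ContinuousMultilinearMap.apply ℝ (fun _ : Fin i => E m) F v).continuous.comp_continuousOn
          (hcont i)) hΩ.measurableSet
    obtain ⟨v, w', rfl⟩ : ∃ v w', w = Fin.cons v w' := ⟨_, _, (Fin.cons_self_tail w).symm⟩
    have hφv : ContDiff ℝ ∞ (fun y => fderiv ℝ φ y v) :=
      (hφ.fderiv_right (m := ∞) le_rfl).clm_apply contDiff_const
    have hsv := (tsupport_fderiv_apply_subset φ v).trans hs
    have hcv : HasCompactSupport (fun y => fderiv ℝ φ y v) :=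
      hc.of_isClosed_subset (isClosed_tsupport _) (tsupport_fderiv_apply_subset φ v)
    have hfd : ∀ x ∈ tsupport φ, ContDiffAt ℝ ∞ f x := fun x hx =>
      hf.contDiffAt (hΩ.mem_nhds (hs hx))
    -- One derivative in the direction `v` is split off from the test function, not from `f`.
    simp_rw [iteratedFDeriv_cons_eq hφ]
    rw [ih _ hφv hcv hsv]
    have hibp : ∫ x, φ x • fderiv ℝ (fun y => iteratedFDeriv ℝ j f y w') x v =
        -∫ x, fderiv ℝ φ x v • iteratedFDeriv ℝ j f x w' := by
      refine integral_smul_fderiv_eq_neg_fderiv_smul_of_integrable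
        (integrable_smul_of_tsupport_subset (hconta j w') hφv.continuous hcv hsv) ?_
        (integrable_smul_of_tsupport_subset (hconta j w') hφ.continuous hc hs)
        (fun x _ => hφ.differentiable (by simp) x) ?_
      · refine (integrable_smul_of_tsupport_subset (hconta (j + 1) (Fin.cons v w'))
          hφ.continuous hc hs).congr (ae_of_all _ fun x => ?_)
        by_cases hx : x ∈ tsupport φ
        · simp only [fderiv_iteratedFDeriv_apply (hfd x hx)]
        · simp [image_eq_zero_of_notMem_tsupport hx]
      · intro x hx
        exact (((hfd x hx).differentiableAt_iteratedFDeriv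
          (by exact_mod_cast WithTop.coe_lt_top j))).continuousMultilinear_apply_const w'
    have hcongr : ∫ x, φ x • iteratedFDeriv ℝ (j + 1) f x (Fin.cons v w') =
        ∫ x, φ x • fderiv ℝ (fun y => iteratedFDeriv ℝ j f y w') x v := by
      congr 1
      funext x
      by_cases hx : x ∈ tsupport φ
      · simp only [fderiv_iteratedFDeriv_apply (hfd x hx)]
      · simp [image_eq_zero_of_notMem_tsupport hx]
    rw [hcongr, hibp, pow_succ]
    simp

theorem ContDiffOn.continuousOn_iteratedFDeriv {Ω : Set (E m)} (hΩ : IsOpen Ω) {f : E m → F}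
    (hf : ContDiffOn ℝ ∞ f Ω) (i : ℕ) : ContinuousOn (iteratedFDeriv ℝ i f) Ω := fun x hx =>
  (((hf.contDiffAt (hΩ.mem_nhds hx)).iteratedFDeriv_right (m := 0) (i := i)
    (by exact_mod_cast le_top)).continuousAt).continuousWithinAt

theorem isWeakDeriv_of_contDiffOn {Ω : Set (E m)} (hΩ : IsOpen Ω) {f : E m → F}
    (hf : ContDiffOn ℝ ∞ f Ω) (j : ℕ) : IsWeakDeriv j Ω f (iteratedFDeriv ℝ j f) := by
  refine ⟨hf.continuousOn.locallyIntegrableOn hΩ.measurableSet,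
    (ContDiffOn.continuousOn_iteratedFDeriv hΩ hf j).locallyIntegrableOn hΩ.measurableSet, ?_⟩
  intro φ hφ hc hs w
  rw [setIntegral_smul_eq_integral ((tsupport_iteratedFDeriv_apply_subset φ w).trans hs),
    setIntegral_smul_eq_integral hs]
  exact integral_iteratedFDeriv_smul hΩ hf j φ hφ hc hs w

/-- Weak derivatives are unique almost everywhere. -/
theorem IsWeakDeriv.ae_eq [CompleteSpace F] {Ω : Set (E m)} (hΩ : IsOpen Ω) {j : ℕ}
    {u : E m → F} {g₁ g₂ : E m → ContinuousMultilinearMap ℝ (fun _ : Fin j => E m) F}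
    (h₁ : IsWeakDeriv j Ω u g₁) (h₂ : IsWeakDeriv j Ω u g₂) :
    g₁ =ᵐ[volume.restrict Ω] g₂ := by
  have hint : ∀ φ : E m → ℝ, ContDiff ℝ ∞ φ → HasCompactSupport φ → tsupport φ ⊆ Ω →
      ∫ x, φ x • (g₁ - g₂) x = 0 := by
    intro φ hφ hc hs
    have i₁ := integrable_smul_of_tsupport_subset h₁.2.1 hφ.continuous hc hs
    have i₂ := integrable_smul_of_tsupport_subset h₂.2.1 hφ.continuous hc hs
    simp only [Pi.sub_apply, smul_sub]
    rw [integral_sub i₁ i₂, sub_eq_zero]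
    ext w
    rw [ContinuousMultilinearMap.integral_apply i₁, ContinuousMultilinearMap.integral_apply i₂]
    have e₁ := h₁.2.2 φ hφ hc hs w
    have e₂ := h₂.2.2 φ hφ hc hs w
    rw [e₁, setIntegral_smul_eq_integral hs, setIntegral_smul_eq_integral hs] at e₂
    exact smul_right_injective F (pow_ne_zero j (by norm_num : (-1 : ℝ) ≠ 0)) e₂
  have := hΩ.ae_eq_zero_of_integral_contDiff_smul_eq_zero (h₁.2.1.sub h₂.2.1) hint
  rw [EventuallyEq, ae_restrict_iff' hΩ.measurableSet]
  filter_upwards [this] with x hx hxΩ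
  exact sub_eq_zero.1 (hx hxΩ)

theorem isWeakDeriv_weakDeriv {Ω : Set (E m)} {j : ℕ} {u : E m → F}
    (h : ∃ g, IsWeakDeriv j Ω u g) : IsWeakDeriv j Ω u (weakDeriv j Ω u) := by
  rw [weakDeriv, dif_pos h]
  exact h.choose_spec

theorem IsWeakDeriv.weakDeriv_ae_eq [CompleteSpace F] {Ω : Set (E m)} (hΩ : IsOpen Ω) {j : ℕ}
    {u : E m → F} {g : E m → ContinuousMultilinearMap ℝ (fun _ : Fin j => E m) F}
    (h : IsWeakDeriv j Ω u g) : weakDeriv j Ω u =ᵐ[volume.restrict Ω] g :=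
  (isWeakDeriv_weakDeriv ⟨g, h⟩).ae_eq hΩ h

theorem IsWeakDeriv.sub {Ω : Set (E m)} {j : ℕ} {u₁ u₂ : E m → F}
    {g₁ g₂ : E m → ContinuousMultilinearMap ℝ (fun _ : Fin j => E m) F}
    (h₁ : IsWeakDeriv j Ω u₁ g₁) (h₂ : IsWeakDeriv j Ω u₂ g₂) :
    IsWeakDeriv j Ω (u₁ - u₂) (g₁ - g₂) := by
  refine ⟨h₁.1.sub h₂.1, h₁.2.1.sub h₂.2.1, fun φ hφ hc hs w => ?_⟩
  have hsw := (tsupport_iteratedFDeriv_apply_subset φ w).trans hs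
  have hcw : HasCompactSupport (fun x => iteratedFDeriv ℝ j φ x w) :=
    hc.of_isClosed_subset (isClosed_tsupport _) (tsupport_iteratedFDeriv_apply_subset φ w)
  have hφw := (ContDiff.iteratedFDeriv_apply_const hφ w).continuous
  have i₁ := integrable_smul_of_tsupport_subset h₁.1 hφw hcw hsw
  have i₂ := integrable_smul_of_tsupport_subset h₂.1 hφw hcw hsw
  have A : ∀ {g : E m → ContinuousMultilinearMap ℝ (fun _ : Fin j => E m) F},
      LocallyIntegrableOn g Ω → Integrable (fun x => φ x • g x w) := fun hg =>
    (ContinuousMultilinearMap.apply ℝ (fun _ : Fin j => E m) F w).integrable_comp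
      (integrable_smul_of_tsupport_subset hg hφ.continuous hc hs)
  simp only [Pi.sub_apply, smul_sub, sub_apply]
  rw [integral_sub i₁.integrableOn i₂.integrableOn,
    integral_sub (A h₁.2.1).integrableOn (A h₂.2.1).integrableOn, smul_sub,
    h₁.2.2 φ hφ hc hs w, h₂.2.2 φ hφ hc hs w]

theorem locallyIntegrableOn_of_memLp {G : Type*} [NormedAddCommGroup G] {p : ℝ≥0∞} (hp : 1 ≤ p)
    {Ω : Set (E m)} {f : E m → G} (hf : MemLp f p (volume.restrict Ω)) :
    LocallyIntegrableOn f Ω :=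
  locallyIntegrableOn_of_locallyIntegrable_restrict (hf.locallyIntegrable hp)

/-- The `0`-th weak derivative of a function is the function itself. -/
theorem isWeakDeriv_zero {Ω : Set (E m)} {u : E m → F} (hu : LocallyIntegrableOn u Ω) :
    IsWeakDeriv 0 Ω u (fun x => ContinuousMultilinearMap.uncurry0 ℝ (E m) (u x)) := by
  refine ⟨hu, ?_, fun φ _ _ _ w => by simp⟩
  intro x hx
  obtain ⟨s, hs, hi⟩ := hu x hx
  let L := (continuousMultilinearCurryFin0 ℝ (E m) F).symm.toContinuousLinearEquiv
  exact ⟨s, hs, L.toContinuousLinearMap.integrable_comp hi⟩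

/-- By Hölder's inequality, convergence in `L^p` implies convergence of the integrals against test
functions. -/
theorem tendsto_integral_smul_of_tendsto_eLpNorm {p : ℝ≥0∞} (hp : 1 ≤ p) {Ω : Set (E m)}
    {h : ℕ → E m → F} {v : E m → F} (hh : ∀ n, MemLp (h n) p (volume.restrict Ω))
    (hv : MemLp v p (volume.restrict Ω))
    (ht : Tendsto (fun n => eLpNorm (h n - v) p (volume.restrict Ω)) atTop (𝓝 0))
    {ψ : E m → ℝ} (hψ : Continuous ψ) (hc : HasCompactSupport ψ) :
    Tendsto (fun n => ∫ x in Ω, ψ x • h n x) atTop (𝓝 (∫ x in Ω, ψ x • v x)) := by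
  have hq : (p.conjExponent).HolderConjugate p := (ENNReal.HolderConjugate.conjExponent hp).symm
  have hψq : MemLp ψ p.conjExponent (volume.restrict Ω) :=
    (hψ.memLp_of_hasCompactSupport hc).restrict Ω
  have hm : ∀ {f : E m → F}, MemLp f p (volume.restrict Ω) →
      MemLp (ψ • f) 1 (volume.restrict Ω) := fun hf => hf.smul hψq
  refine tendsto_integral_of_L1' _ (hm hv).1
    (Eventually.of_forall fun n => memLp_one_iff_integrable.1 (hm (hh n))) ?_
  have hle : ∀ n, eLpNorm ((ψ • h n) - (ψ • v)) 1 (volume.restrict Ω) ≤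
      eLpNorm ψ p.conjExponent (volume.restrict Ω) * eLpNorm (h n - v) p (volume.restrict Ω) := by
    intro n
    rw [← smul_sub]
    exact eLpNorm_smul_le_mul_eLpNorm ((hh n).1.sub hv.1) hψq.1
  refine tendsto_of_tendsto_of_tendsto_of_le_of_le tendsto_const_nhds ?_ (fun _ => zero_le) hle
  have := ENNReal.Tendsto.const_mul ht (Or.inr hψq.2.ne)
  simpa using this

/-- Weak derivatives pass to limits in `L^p`. -/
theorem IsWeakDeriv.of_tendsto {p : ℝ≥0∞} (hp : 1 ≤ p) {Ω : Set (E m)} {j : ℕ}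
    {h : ℕ → E m → F} {H : ℕ → E m → ContinuousMultilinearMap ℝ (fun _ : Fin j => E m) F}
    (hw : ∀ n, IsWeakDeriv j Ω (h n) (H n)) {v : E m → F}
    {G : E m → ContinuousMultilinearMap ℝ (fun _ : Fin j => E m) F}
    (hh : ∀ n, MemLp (h n) p (volume.restrict Ω)) (hv : MemLp v p (volume.restrict Ω))
    (ht : Tendsto (fun n => eLpNorm (h n - v) p (volume.restrict Ω)) atTop (𝓝 0))
    (hH : ∀ n, MemLp (H n) p (volume.restrict Ω)) (hG : MemLp G p (volume.restrict Ω))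
    (hT : Tendsto (fun n => eLpNorm (H n - G) p (volume.restrict Ω)) atTop (𝓝 0)) :
    IsWeakDeriv j Ω v G := by
  refine ⟨locallyIntegrableOn_of_memLp hp hv, locallyIntegrableOn_of_memLp hp hG, ?_⟩
  intro φ hφ hc hs w
  have hcw : HasCompactSupport (fun x => iteratedFDeriv ℝ j φ x w) :=
    hc.of_isClosed_subset (isClosed_tsupport _) (tsupport_iteratedFDeriv_apply_subset φ w)
  have h1 := tendsto_integral_smul_of_tendsto_eLpNorm hp hh hv ht
    (ContDiff.iteratedFDeriv_apply_const hφ w).continuous hcw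
  have h2 := tendsto_integral_smul_of_tendsto_eLpNorm hp hH hG hT hφ.continuous hc
  have key : ∀ {g : E m → ContinuousMultilinearMap ℝ (fun _ : Fin j => E m) F},
      LocallyIntegrableOn g Ω → ∫ x in Ω, φ x • g x w = (∫ x in Ω, φ x • g x) w := by
    intro g hg
    rw [ContinuousMultilinearMap.integral_apply
      (integrable_smul_of_tsupport_subset hg hφ.continuous hc hs).integrableOn]
    rfl
  have h3 := (((ContinuousMultilinearMap.apply ℝ (fun _ : Fin j => E m) F w).continuous.tendsto
    _).comp h2).const_smul ((-1 : ℝ) ^ j)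
  rw [key (locallyIntegrableOn_of_memLp hp hG)]
  refine tendsto_nhds_unique h1 (h3.congr fun n => ?_)
  rw [(hw n).2.2 φ hφ hc hs w, key (hw n).2.1]
  rfl

theorem memSobolev_of_isWeakDeriv [CompleteSpace F] {k : ℕ} {p : ℝ≥0∞} {Ω : Set (E m)}
    (hΩ : IsOpen Ω) {u : E m → F}
    {g : ∀ j, E m → ContinuousMultilinearMap ℝ (fun _ : Fin j => E m) F}
    (hu : MemLp u p (volume.restrict Ω)) (hw : ∀ j ∈ Finset.Icc 1 k, IsWeakDeriv j Ω u (g j))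
    (hg : ∀ j ∈ Finset.Icc 1 k, MemLp (g j) p (volume.restrict Ω)) : MemSobolev k p Ω u :=
  ⟨hu, fun j hj => ⟨g j, hw j hj⟩, fun j hj =>
    (memLp_congr_ae ((hw j hj).weakDeriv_ae_eq hΩ)).2 (hg j hj)⟩

/-- Convergence in `W^{k,p}`, expressed through weak derivatives of the sequence and its limit. -/
theorem tendstoSobolev_of_isWeakDeriv [CompleteSpace F] {k : ℕ} {p : ℝ≥0∞} {Ω : Set (E m)}
    (hΩ : IsOpen Ω) {un : ℕ → E m → F} {u : E m → F}
    {gn : ℕ → ∀ j, E m → ContinuousMultilinearMap ℝ (fun _ : Fin j => E m) F}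
    {g : ∀ j, E m → ContinuousMultilinearMap ℝ (fun _ : Fin j => E m) F}
    (hun : ∀ n, MemLp (un n) p (volume.restrict Ω)) (hu : MemLp u p (volume.restrict Ω))
    (hwn : ∀ n, ∀ j ∈ Finset.Icc 1 k, IsWeakDeriv j Ω (un n) (gn n j))
    (hw : ∀ j ∈ Finset.Icc 1 k, IsWeakDeriv j Ω u (g j))
    (hgn : ∀ n, ∀ j ∈ Finset.Icc 1 k, MemLp (gn n j) p (volume.restrict Ω))
    (hg : ∀ j ∈ Finset.Icc 1 k, MemLp (g j) p (volume.restrict Ω))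
    (ht : Tendsto (fun n => eLpNorm (un n - u) p (volume.restrict Ω)) atTop (𝓝 0))
    (htg : ∀ j ∈ Finset.Icc 1 k,
      Tendsto (fun n => eLpNorm (gn n j - g j) p (volume.restrict Ω)) atTop (𝓝 0)) :
    TendstoSobolev k p Ω un u := by
  refine ⟨fun n => memSobolev_of_isWeakDeriv hΩ (hun n) (hwn n) (hgn n),
    memSobolev_of_isWeakDeriv hΩ hu hw hg, ?_⟩
  have h := ht.add (tendsto_finsetSum (Finset.Icc 1 k) htg)
  simp only [Finset.sum_const_zero, add_zero] at h
  refine h.congr fun n => ?_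
  rw [sobolevNorm]
  congr 1
  refine Finset.sum_congr rfl fun j hj => ?_
  exact (eLpNorm_congr_ae (((hwn n j hj).sub (hw j hj)).weakDeriv_ae_eq hΩ)).symm

end WeakDerivatives

end CubeOpening

namespace CubeOpening

section Mollification

variable {m : ℕ} {F : Type*} [NormedAddCommGroup F] [NormedSpace ℝ F]

/-! ### Mollification -/

open scoped Convolution

/-- All derivatives of a convolution may be put on the smooth kernel. -/
theorem iteratedFDeriv_convolution_apply {κ : E m → ℝ} (hκ : ContDiff ℝ ∞ κ)
    (hc : HasCompactSupport κ) {h : E m → F} (hh : LocallyIntegrable h) {j : ℕ}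
    (w : Fin j → E m) (x : E m) :
    iteratedFDeriv ℝ j (κ ⋆[ContinuousLinearMap.lsmul ℝ ℝ] h) x w =
      ((fun y => iteratedFDeriv ℝ j κ y w) ⋆[ContinuousLinearMap.lsmul ℝ ℝ] h) x := by
  have hsm : ContDiff ℝ ∞ (κ ⋆[ContinuousLinearMap.lsmul ℝ ℝ] h) :=
    hc.contDiff_convolution_left _ hκ hh
  induction j generalizing x with
  | zero => simp
  | succ j ih =>
    obtain ⟨v, w', rfl⟩ : ∃ v w', w = Fin.cons v w' := ⟨_, _, (Fin.cons_self_tail w).symm⟩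
    have hκw : ContDiff ℝ ∞ (fun y => iteratedFDeriv ℝ j κ y w') :=
      ContDiff.iteratedFDeriv_apply_const hκ w'
    have hcw : HasCompactSupport (fun y => iteratedFDeriv ℝ j κ y w') :=
      hc.of_isClosed_subset (isClosed_tsupport _) (tsupport_iteratedFDeriv_apply_subset κ w')
    rw [← fderiv_iteratedFDeriv_apply hsm.contDiffAt, funext (ih w'),
      (hcw.hasFDerivAt_convolution_left _ (hκw.of_le (by exact_mod_cast le_top)) hh x).fderiv]
    have hex : ConvolutionExistsAt (fderiv ℝ fun y => iteratedFDeriv ℝ j κ y w') h x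
        (ContinuousLinearMap.precompL (E m) (ContinuousLinearMap.lsmul ℝ ℝ)) volume :=
      (hcw.fderiv ℝ).convolutionExists_left _ (hκw.continuous_fderiv (by simp)) hh x
    rw [convolution, ContinuousLinearMap.integral_apply hex, convolution]
    simp only [ContinuousLinearMap.precompL_apply, fderiv_iteratedFDeriv_apply hκ.contDiffAt]

theorem iteratedFDeriv_comp_const_sub_apply {κ : E m → ℝ} (hκ : ContDiff ℝ ∞ κ) {j : ℕ}
    (w : Fin j → E m) (x t : E m) :
    iteratedFDeriv ℝ j (fun s => κ (x - s)) t w =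
      (-1 : ℝ) ^ j * iteratedFDeriv ℝ j κ (x - t) w := by
  have h1 : (fun s => κ (x - s)) = fun s => (κ ∘ (-ContinuousLinearMap.id ℝ (E m))) (s - x) := by
    funext s; simp
  rw [h1, iteratedFDeriv_comp_sub,
    ContinuousLinearMap.iteratedFDeriv_comp_right _ hκ _ (i := j) (by exact_mod_cast le_top)]
  have h2 := (iteratedFDeriv ℝ j κ (x - t)).map_smul_univ (fun _ => (-1 : ℝ)) w
  simp only [Finset.prod_const, Finset.card_univ, Fintype.card_fin, smul_eq_mul] at h2
  rw [← h2]
  simp only [ContinuousMultilinearMap.compContinuousLinearMap_apply,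
    neg_apply, ContinuousLinearMap.id_apply, neg_sub, neg_smul, one_smul]

/-- At a point whose distance to the complement of `Ω` exceeds the radius of the kernel, derivatives
of the mollification of `u` are mollifications of its weak derivatives. -/
theorem IsWeakDeriv.iteratedFDeriv_convolution {Ω : Set (E m)} (hΩ : IsOpen Ω) {j : ℕ}
    {u : E m → F} {g : E m → ContinuousMultilinearMap ℝ (fun _ : Fin j => E m) F}
    (h : IsWeakDeriv j Ω u g) (hu : LocallyIntegrable (Ω.indicator u))
    (hg : LocallyIntegrable (Ω.indicator g)) (φ : ContDiffBump (0 : E m)) {x : E m}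
    (hx : Metric.closedBall x φ.rOut ⊆ Ω) :
    iteratedFDeriv ℝ j (φ.normed volume ⋆[ContinuousLinearMap.lsmul ℝ ℝ] Ω.indicator u) x =
      (φ.normed volume ⋆[ContinuousLinearMap.lsmul ℝ ℝ] Ω.indicator g) x := by
  have hκ : ContDiff ℝ ∞ (φ.normed (volume : Measure (E m))) := φ.contDiff_normed
  have hκc : HasCompactSupport (φ.normed (volume : Measure (E m))) := φ.hasCompactSupport_normed
  set κ := φ.normed (volume : Measure (E m)) with hκdef
  ext w
  rw [iteratedFDeriv_convolution_apply hκ hκc hu]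
  -- The reflected kernel centred at `x` is an admissible test function.
  set ψ : E m → ℝ := fun s => κ (x - s) with hψ
  have hψs : ContDiff ℝ ∞ ψ := hκ.comp (contDiff_const.sub contDiff_id)
  have hts : tsupport ψ ⊆ Metric.closedBall x φ.rOut := by
    refine closure_minimal (fun s hs => ?_) Metric.isClosed_closedBall
    have : x - s ∈ Function.support κ := hs
    rw [hκdef, φ.support_normed_eq, mem_ball_zero_iff] at this
    rw [mem_closedBall_iff_norm, ← norm_neg, neg_sub]
    exact this.le
  have hψc : HasCompactSupport ψ :=
    (isCompact_closedBall x φ.rOut).of_isClosed_subset (isClosed_tsupport _) hts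
  have hi : Integrable (fun t => κ t • Ω.indicator g (x - t)) := by
    have := hκc.convolutionExists_left (ContinuousLinearMap.lsmul ℝ ℝ) hκ.continuous hg x
    simpa [ConvolutionExistsAt] using this
  have e1 : ∫ t, (κ t • Ω.indicator g (x - t)) w = ∫ t, ψ t • Ω.indicator (fun y => g y w) t := by
    rw [← integral_sub_left_eq_self _ volume x]
    congr 1
    funext t
    by_cases ht : t ∈ Ω <;> simp [hψ, ht]
  have e2 : ∫ t, ψ t • Ω.indicator (fun y => g y w) t = ∫ t in Ω, ψ t • g t w := by
    rw [← integral_indicator hΩ.measurableSet]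
    congr 1
    funext t
    by_cases ht : t ∈ Ω <;> simp [ht]
  have e3 : ∫ t, iteratedFDeriv ℝ j κ (x - t) w • Ω.indicator u t =
      (-1 : ℝ) ^ j • ∫ t in Ω, iteratedFDeriv ℝ j ψ t w • u t := by
    rw [← integral_smul, ← integral_indicator hΩ.measurableSet]
    congr 1
    funext t
    have hs : ((-1 : ℝ) ^ j) * (-1) ^ j = 1 := by rw [← mul_pow]; simp
    by_cases ht : t ∈ Ω
    · simp only [ht, indicator_of_mem]
      rw [hψ, iteratedFDeriv_comp_const_sub_apply hκ, smul_smul, ← mul_assoc, hs, one_mul]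
    · simp [ht]
  rw [convolution_lsmul_swap, convolution_lsmul, ContinuousMultilinearMap.integral_apply hi, e1,
    e2, e3, h.2.2 ψ hψs hψc (hts.trans hx) w, smul_smul,
    ← mul_pow]
  simp

/-- Translations act continuously on `L^p`. -/
theorem exists_eLpNorm_translate_sub_le {G : Type*} [NormedAddCommGroup G] {p : ℝ≥0∞}
    (hp : 1 ≤ p) (hp_top : p ≠ ⊤) {h : E m → G} (hh : MemLp h p) {ε : ℝ≥0∞} (hε : 0 < ε) :
    ∃ δ > 0, ∀ t : E m, ‖t‖ < δ → eLpNorm (fun x => h (x - t) - h x) p ≤ ε := by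
  have : Fact (1 ≤ p) := ⟨hp⟩
  let g : C(E m, C(E m, E m)) :=
    (ContinuousMap.mk (fun a : E m × E m => a.2 - a.1) (by fun_prop)).curry
  have hg : ∀ t : E m, MeasurePreserving (g t) (volume : Measure (E m)) volume := fun t =>
    measurePreserving_sub_right volume t
  have hcont := Continuous.compMeasurePreservingLp (p := p) (Z := E m)
    (f := fun _ => hh.toLp h) (g := g) continuous_const g.continuous hg hp_top
  have h0 := EMetric.tendsto_nhds.1 (hcont.tendsto 0) ε hε
  obtain ⟨δ, hδ, hball⟩ := Metric.eventually_nhds_iff.1 h0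
  refine ⟨δ, hδ, fun t ht => ?_⟩
  have h1 := hball (y := t) (by simpa using ht)
  rw [Lp.toLp_compMeasurePreserving, Lp.toLp_compMeasurePreserving, Lp.edist_toLp_toLp] at h1
  refine le_of_eq_of_le ?_ h1.le
  congr 1
  funext x
  simp [g]

/-- Jensen's inequality for mollifications. -/
theorem enorm_convolution_sub_rpow_le {G : Type*} [NormedAddCommGroup G] [NormedSpace ℝ G]
    {p : ℝ≥0∞} (hp : 1 ≤ p) (hp_top : p ≠ ⊤) {h : E m → G} (hsm : StronglyMeasurable h)
    (hh : LocallyIntegrable h) (φ : ContDiffBump (0 : E m)) [CompleteSpace G] (x : E m) :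
    ‖(φ.normed volume ⋆[ContinuousLinearMap.lsmul ℝ ℝ] h) x - h x‖ₑ ^ p.toReal ≤
      ∫⁻ t, ENNReal.ofReal (φ.normed volume t) * ‖h (x - t) - h x‖ₑ ^ p.toReal := by
  have hκ : ContDiff ℝ ∞ (φ.normed (volume : Measure (E m))) := φ.contDiff_normed
  have hκc : HasCompactSupport (φ.normed (volume : Measure (E m))) := φ.hasCompactSupport_normed
  set κ := φ.normed (volume : Measure (E m))
  have hκ0 : ∀ t, 0 ≤ κ t := fun t => φ.nonneg_normed t
  have hκi : Integrable κ := hκ.continuous.integrable_of_hasCompactSupport hκc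
  have hi : Integrable (fun t => κ t • h (x - t)) := by
    have := hκc.convolutionExists_left (ContinuousLinearMap.lsmul ℝ ℝ) hκ.continuous hh x
    simpa [ConvolutionExistsAt] using this
  have hmκ : Measurable fun t => ENNReal.ofReal (κ t) :=
    hκ.continuous.measurable.ennreal_ofReal
  -- The kernel is the density of a probability measure `ν`, and `L^p(ν)` norms increase with `p`.
  set ν := (volume : Measure (E m)).withDensity fun t => ENNReal.ofReal (κ t) with hν
  have : IsProbabilityMeasure ν := ⟨by
    rw [hν, withDensity_apply _ MeasurableSet.univ, Measure.restrict_univ,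
      ← ofReal_integral_eq_lintegral_ofReal hκi (ae_of_all _ hκ0), φ.integral_normed,
      ENNReal.ofReal_one]⟩
  have hsm' : StronglyMeasurable fun t => h (x - t) - h x :=
    (hsm.comp_measurable (measurable_const.sub measurable_id)).sub stronglyMeasurable_const
  have e : (κ ⋆[ContinuousLinearMap.lsmul ℝ ℝ] h) x - h x = ∫ t, κ t • (h (x - t) - h x) := by
    simp_rw [smul_sub]
    rw [integral_sub hi (hκi.smul_const _), integral_smul_const, φ.integral_normed, one_smul,
      convolution_lsmul]
  have hp0 : p ≠ 0 := (zero_lt_one.trans_le hp).ne'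
  have hp0' : 0 < p.toReal := ENNReal.toReal_pos hp0 hp_top
  have h1 : ‖(κ ⋆[ContinuousLinearMap.lsmul ℝ ℝ] h) x - h x‖ₑ ≤
      eLpNorm (fun t => h (x - t) - h x) 1 ν := by
    rw [e, eLpNorm_one_eq_lintegral_enorm, hν,
      lintegral_withDensity_eq_lintegral_mul _ hmκ hsm'.enorm]
    refine (enorm_integral_le_lintegral_enorm _).trans_eq ?_
    congr 1
    funext t
    rw [enorm_smul, Pi.mul_apply, Real.enorm_of_nonneg (hκ0 t)]
  have h2 := h1.trans (eLpNorm_le_eLpNorm_of_exponent_le hp hsm'.aestronglyMeasurable)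
  rw [eLpNorm_eq_lintegral_rpow_enorm_toReal hp0 hp_top, one_div] at h2
  have h3 := (ENNReal.le_rpow_inv_iff hp0').1 h2
  rwa [hν, lintegral_withDensity_eq_lintegral_mul _ hmκ (hsm'.enorm.pow_const _)] at h3

/-- Mollifications converge in `L^p`. -/
theorem exists_eLpNorm_convolution_sub_le {G : Type*} [NormedAddCommGroup G] [NormedSpace ℝ G]
    [CompleteSpace G] {p : ℝ≥0∞} (hp : 1 ≤ p) (hp_top : p ≠ ⊤) {h : E m → G} (hh : MemLp h p)
    {ε : ℝ≥0∞} (hε : 0 < ε) :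
    ∃ δ > 0, ∀ φ : ContDiffBump (0 : E m), φ.rOut < δ →
      eLpNorm ((φ.normed volume ⋆[ContinuousLinearMap.lsmul ℝ ℝ] h) - h) p ≤ ε := by
  have hae := hh.1.ae_eq_mk
  set h' := hh.1.mk h
  have hm' : StronglyMeasurable h' := hh.1.stronglyMeasurable_mk
  have hL' : MemLp h' p := (memLp_congr_ae hae).1 hh
  obtain ⟨δ, hδ, ht⟩ := exists_eLpNorm_translate_sub_le hp hp_top hL' hε
  refine ⟨δ, hδ, fun φ hφ => ?_⟩
  have hp0 : p ≠ 0 := (zero_lt_one.trans_le hp).ne'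
  have hp0' : 0 < p.toReal := ENNReal.toReal_pos hp0 hp_top
  have hκ : ContDiff ℝ ∞ (φ.normed (volume : Measure (E m))) := φ.contDiff_normed
  have hκc : HasCompactSupport (φ.normed (volume : Measure (E m))) := φ.hasCompactSupport_normed
  have hκi : Integrable (φ.normed (volume : Measure (E m))) :=
    hκ.continuous.integrable_of_hasCompactSupport hκc
  have e : (φ.normed volume ⋆[ContinuousLinearMap.lsmul ℝ ℝ] h) =
      (φ.normed volume ⋆[ContinuousLinearMap.lsmul ℝ ℝ] h') :=
    convolution_congr _ (ae_eq_refl _) hae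
  rw [e, eLpNorm_congr_ae ((ae_eq_refl _).sub hae),
    eLpNorm_eq_lintegral_rpow_enorm_toReal hp0 hp_top, one_div, ENNReal.rpow_inv_le_iff hp0']
  have hmeas : Measurable fun z : E m × E m =>
      ENNReal.ofReal (φ.normed volume z.2) * ‖h' (z.1 - z.2) - h' z.1‖ₑ ^ p.toReal := by
    refine Measurable.mul
      ((hκ.continuous.measurable.comp measurable_snd).ennreal_ofReal) ?_
    refine Measurable.pow_const (StronglyMeasurable.enorm ?_) _
    exact (hm'.comp_measurable (measurable_fst.sub measurable_snd)).sub
      (hm'.comp_measurable measurable_fst)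
  calc ∫⁻ x, ‖((φ.normed volume ⋆[ContinuousLinearMap.lsmul ℝ ℝ] h') - h') x‖ₑ ^ p.toReal
      ≤ ∫⁻ x, ∫⁻ t, ENNReal.ofReal (φ.normed volume t) * ‖h' (x - t) - h' x‖ₑ ^ p.toReal :=
        lintegral_mono fun x =>
          enorm_convolution_sub_rpow_le hp hp_top hm' (hL'.locallyIntegrable hp) φ x
    _ = ∫⁻ t, ∫⁻ x, ENNReal.ofReal (φ.normed volume t) * ‖h' (x - t) - h' x‖ₑ ^ p.toReal :=
        lintegral_lintegral_swap hmeas.aemeasurable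
    _ ≤ ∫⁻ t, ENNReal.ofReal (φ.normed volume t) * ε ^ p.toReal := by
        refine lintegral_mono fun t => ?_
        have hmt : Measurable fun x => ‖h' (x - t) - h' x‖ₑ ^ p.toReal := by
          refine Measurable.pow_const (StronglyMeasurable.enorm ?_) _
          exact (hm'.comp_measurable (measurable_id.sub_const t)).sub hm'
        rw [lintegral_const_mul _ hmt]
        by_cases h0 : φ.normed (volume : Measure (E m)) t = 0
        · simp [h0]
        · have : t ∈ Function.support (φ.normed (volume : Measure (E m))) := h0
          rw [φ.support_normed_eq, mem_ball_zero_iff] at this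
          have h4 := ht t (this.trans hφ)
          rw [eLpNorm_eq_lintegral_rpow_enorm_toReal hp0 hp_top, one_div,
            ENNReal.rpow_inv_le_iff hp0'] at h4
          gcongr
    _ = ε ^ p.toReal := by
        rw [lintegral_mul_const _ hκ.continuous.measurable.ennreal_ofReal,
          ← ofReal_integral_eq_lintegral_ofReal hκi (ae_of_all _ fun t => φ.nonneg_normed t),
          φ.integral_normed, ENNReal.ofReal_one, one_mul]

end Mollification

end CubeOpening

namespace CubeOpening

section SmoothDensity

variable {m : ℕ} {F : Type*} [NormedAddCommGroup F] [NormedSpace ℝ F]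

/-! ### Density of smooth functions -/

open scoped Convolution

/-- An exhaustion of an open set by smooth compactly supported cutoff functions. -/
theorem exists_cutoff_exhaustion {Ω : Set (E m)} (hΩ : IsOpen Ω) :
    ∃ χ : ℕ → E m → ℝ, (∀ n, ContDiff ℝ ∞ (χ n)) ∧ (∀ n, HasCompactSupport (χ n)) ∧
      (∀ n, tsupport (χ n) ⊆ Ω) ∧
      ∀ x ∈ Ω, ∃ N, ∀ᶠ y in 𝓝 x, ∀ n, N ≤ n → χ n y = 1 := by
  obtain ⟨f, hfs, hfd, hfr⟩ := hΩ.exists_contDiff_support_eq (n := ⊤)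
  -- `f` is smooth, and positive exactly on `Ω`; the factor `b n` provides the compact support.
  let b : ℕ → ContDiffBump (0 : E m) := fun n =>
    ⟨n + 1, n + 2, by positivity, by linarith⟩
  refine ⟨fun n x => Real.smoothTransition (n * f x - 1) * b n x, fun n => ?_, fun n => ?_,
    fun n => ?_, ?_⟩
  · exact (Real.smoothTransition.contDiff.comp ((contDiff_const.mul hfd).sub contDiff_const)).mul
      (b n).contDiff
  · exact (b n).hasCompactSupport.mul_left
  · have hcl : IsClosed {x | 1 ≤ (n : ℝ) * f x} :=
      isClosed_le continuous_const (continuous_const.mul hfd.continuous)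
    refine (closure_minimal (t := {x | 1 ≤ (n : ℝ) * f x}) (fun x hx => ?_) hcl).trans ?_
    · by_contra hlt
      simp only [mem_ofPred_eq, not_le] at hlt
      exact hx (by
        simp only [Real.smoothTransition.zero_of_nonpos (by linarith : (n : ℝ) * f x - 1 ≤ 0),
          zero_mul])
    · intro x hx
      rw [← hfs, Function.mem_support]
      intro h0
      simp only [mem_ofPred_eq, h0, mul_zero] at hx
      linarith
  · intro x hx
    have hfx : 0 < f x := lt_of_le_of_ne (hfr ⟨x, rfl⟩).1 (by
      rw [← hfs] at hx; exact (Function.mem_support.1 hx).symm)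
    obtain ⟨N, hN⟩ := exists_nat_gt (max (4 / f x) ‖x‖)
    refine ⟨N, ?_⟩
    have e1 : ∀ᶠ y in 𝓝 x, f x / 2 < f y :=
      hfd.continuous.continuousAt.eventually (lt_mem_nhds (by linarith))
    have e2 : ∀ᶠ y in 𝓝 x, ‖y‖ < N :=
      continuous_norm.continuousAt.eventually (gt_mem_nhds ((le_max_right _ _).trans_lt hN))
    filter_upwards [e1, e2] with y h1 h2 n hn
    have hn' : (N : ℝ) ≤ n := by exact_mod_cast hn
    have h3 : 4 < n * f x := by
      have := (le_max_left (4 / f x) ‖x‖).trans_lt (hN.trans_le hn')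
      rwa [div_lt_iff₀ hfx] at this
    have hn0 : (0 : ℝ) ≤ n := Nat.cast_nonneg n
    rw [Real.smoothTransition.one_of_one_le (by nlinarith), one_mul]
    refine (b n).one_of_mem_closedBall ?_
    rw [mem_closedBall_zero_iff]
    show ‖y‖ ≤ n + 1
    linarith

/-- A locally finite smooth partition of unity on an open set. -/
theorem exists_smooth_partition {Ω : Set (E m)} (hΩ : IsOpen Ω) :
    ∃ ζ : ℕ → E m → ℝ, (∀ n, ContDiff ℝ ∞ (ζ n)) ∧ (∀ n, HasCompactSupport (ζ n)) ∧
      (∀ n, tsupport (ζ n) ⊆ Ω) ∧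
      ∀ x ∈ Ω, ∃ N, ∀ᶠ y in 𝓝 x, (∀ n, N ≤ n → ζ n y = 0) ∧ ∑ n ∈ Finset.range N, ζ n y = 1 := by
  obtain ⟨χ, hs, hc, ht, hone⟩ := exists_cutoff_exhaustion hΩ
  -- the successive differences of the cutoff functions
  let ζ : ℕ → E m → ℝ := fun n => match n with
    | 0 => χ 0
    | n + 1 => χ (n + 1) - χ n
  have hsum : ∀ N y, ∑ n ∈ Finset.range (N + 1), ζ n y = χ N y := by
    intro N y
    induction N with
    | zero => simp [ζ]
    | succ N ih => rw [Finset.sum_range_succ, ih]; simp [ζ]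
  refine ⟨ζ, fun n => ?_, fun n => ?_, fun n => ?_, fun x hx => ?_⟩
  · cases n with
    | zero => exact hs 0
    | succ n => exact (hs (n + 1)).sub (hs n)
  · cases n with
    | zero => exact hc 0
    | succ n => exact (hc (n + 1)).sub (hc n)
  · cases n with
    | zero => exact ht 0
    | succ n =>
      refine (closure_minimal (t := tsupport (χ (n + 1)) ∪ tsupport (χ n)) (fun x hx => ?_)
        ((isClosed_tsupport _).union (isClosed_tsupport _))).trans (union_subset (ht _) (ht _))
      by_contra hno
      simp only [mem_union, not_or] at hno
      exact hx (by simp [ζ, image_eq_zero_of_notMem_tsupport hno.1,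
        image_eq_zero_of_notMem_tsupport hno.2])
  · obtain ⟨N, hN⟩ := hone x hx
    refine ⟨N + 1, hN.mono fun y hy => ⟨fun n hn => ?_, ?_⟩⟩
    · obtain ⟨n, rfl⟩ : ∃ l, n = l + 1 := ⟨n - 1, by omega⟩
      simp [ζ, hy n (by omega), hy (n + 1) (by omega)]
    · rw [hsum, hy N le_rfl]

theorem memLp_indicator {G : Type*} [NormedAddCommGroup G] {p : ℝ≥0∞} {Ω : Set (E m)}
    (hΩ : IsOpen Ω) {f : E m → G} (hf : MemLp f p (volume.restrict Ω)) :
    MemLp (Ω.indicator f) p :=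
  (memLp_indicator_iff_restrict hΩ.measurableSet).2 hf

/-- A mollification of `u` with a small radius is close to `u` on a compact subset of `Ω`, together
with its derivatives. -/
theorem exists_smooth_approx_on_compact [CompleteSpace F] {p : ℝ≥0∞} (hp : 1 ≤ p)
    (hp_top : p ≠ ⊤) {Ω : Set (E m)} (hΩ : IsOpen Ω) {k : ℕ} {u : E m → F}
    {g : ∀ j, E m → ContinuousMultilinearMap ℝ (fun _ : Fin j => E m) F}
    (hu : MemLp u p (volume.restrict Ω)) (hw : ∀ j ≤ k, IsWeakDeriv j Ω u (g j))
    (hg : ∀ j ≤ k, MemLp (g j) p (volume.restrict Ω)) {K : Set (E m)} (hK : IsCompact K)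
    (hKΩ : K ⊆ Ω) {ε : ℝ≥0∞} (hε : 0 < ε) :
    ∃ v : E m → F, ContDiff ℝ ∞ v ∧
      ∀ j ≤ k, eLpNorm (iteratedFDeriv ℝ j v - g j) p (volume.restrict K) ≤ ε := by
  have hu' := memLp_indicator hΩ hu
  have hex : ∀ j, ∃ δ > 0, j ≤ k → ∀ φ : ContDiffBump (0 : E m), φ.rOut < δ →
      eLpNorm ((φ.normed volume ⋆[ContinuousLinearMap.lsmul ℝ ℝ] Ω.indicator (g j)) -
        Ω.indicator (g j)) p ≤ ε := by
    intro j
    by_cases hj : j ≤ k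
    · obtain ⟨δ, hδ, h⟩ := exists_eLpNorm_convolution_sub_le hp hp_top
        (memLp_indicator hΩ (hg j hj)) hε
      exact ⟨δ, hδ, fun _ => h⟩
    · exact ⟨1, one_pos, fun h => absurd h hj⟩
  choose δ hδ hδε using hex
  obtain ⟨δ₀, hδ₀, hthick⟩ := hK.exists_cthickening_subset_open hΩ hKΩ
  obtain ⟨r, hr, hrδ⟩ : ∃ r > 0, r < δ₀ ∧ ∀ j ∈ Finset.range (k + 1), r < δ j := by
    have h1 : ∀ᶠ r in 𝓝[>] (0 : ℝ), r < δ₀ := nhdsWithin_le_nhds (gt_mem_nhds hδ₀)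
    have h2 : ∀ᶠ r in 𝓝[>] (0 : ℝ), ∀ j ∈ Finset.range (k + 1), r < δ j :=
      (Filter.eventually_all_finset _).2 fun j _ => nhdsWithin_le_nhds (gt_mem_nhds (hδ j))
    obtain ⟨r, hr⟩ := ((h1.and h2).and self_mem_nhdsWithin).exists
    exact ⟨r, hr.2, hr.1⟩
  let φ : ContDiffBump (0 : E m) := ⟨r / 2, r, by linarith, by linarith⟩
  refine ⟨φ.normed volume ⋆[ContinuousLinearMap.lsmul ℝ ℝ] Ω.indicator u, ?_, fun j hj => ?_⟩
  · exact φ.hasCompactSupport_normed.contDiff_convolution_left _ φ.contDiff_normed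
      (hu'.locallyIntegrable hp)
  · refine le_trans (le_of_eq (eLpNorm_congr_ae ?_)) ((eLpNorm_mono_measure _
      Measure.restrict_le_self).trans (hδε j hj φ (hrδ.2 j (Finset.mem_range.2 (by omega)))))
    rw [EventuallyEq, ae_restrict_iff' hK.measurableSet]
    refine ae_of_all _ fun x hx => ?_
    have hball : Metric.closedBall x φ.rOut ⊆ Ω :=
      (Metric.closedBall_subset_cthickening hx r).trans
        ((Metric.cthickening_mono hrδ.1.le K).trans hthick)
    rw [Pi.sub_apply, Pi.sub_apply, (hw j hj).iteratedFDeriv_convolution hΩ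
      (hu'.locallyIntegrable hp) ((memLp_indicator hΩ (hg j hj)).locallyIntegrable hp) φ hball,
      indicator_of_mem (hKΩ hx)]

/-- Smooth functions whose derivatives converge almost everywhere to the weak derivatives. -/
theorem exists_smooth_tendsto_ae [CompleteSpace F] {p : ℝ≥0∞} (hp : 1 ≤ p)
    {Ω : Set (E m)} (hΩ : IsOpen Ω) {k : ℕ} {u : E m → F}
    {g : ∀ j, E m → ContinuousMultilinearMap ℝ (fun _ : Fin j => E m) F}
    (hu : MemLp u p (volume.restrict Ω)) (hw : ∀ j ≤ k, IsWeakDeriv j Ω u (g j))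
    (hg : ∀ j ≤ k, MemLp (g j) p (volume.restrict Ω)) :
    ∃ V : ℕ → E m → F, (∀ q, ContDiff ℝ ∞ (V q)) ∧
      ∀ᵐ x ∂(volume.restrict Ω), ∀ j ≤ k,
        Tendsto (fun q => iteratedFDeriv ℝ j (V q) x) atTop (𝓝 (g j x)) := by
  have hu' := memLp_indicator hΩ hu
  let φ : ℕ → ContDiffBump (0 : E m) := fun q =>
    ⟨(1 / ((q : ℝ) + 1)) / 2, 1 / ((q : ℝ) + 1), by positivity, by
      have : 0 < 1 / ((q : ℝ) + 1) := by positivity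
      linarith⟩
  have hφ : Tendsto (fun q => (φ q).rOut) atTop (𝓝 0) := tendsto_one_div_add_atTop_nhds_zero_nat
  refine ⟨fun q => (φ q).normed volume ⋆[ContinuousLinearMap.lsmul ℝ ℝ] Ω.indicator u,
    fun q => ?_, ?_⟩
  · exact (φ q).hasCompactSupport_normed.contDiff_convolution_left _ (φ q).contDiff_normed
      (hu'.locallyIntegrable hp)
  · rw [ae_restrict_iff' hΩ.measurableSet]
    have hae : ∀ j, ∀ᵐ x : E m, j ≤ k → Tendsto (fun q =>
        ((φ q).normed volume ⋆[ContinuousLinearMap.lsmul ℝ ℝ] Ω.indicator (g j)) x) atTop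
        (𝓝 (Ω.indicator (g j) x)) := by
      intro j
      by_cases hj : j ≤ k
      · filter_upwards [ContDiffBump.ae_convolution_tendsto_right_of_locallyIntegrable
          (K := 2) hφ (Eventually.of_forall fun q => by simp only [φ]; linarith)
          ((memLp_indicator hΩ (hg j hj)).locallyIntegrable hp)] with x hx _ using hx
      · exact ae_of_all _ fun x h => absurd h hj
    filter_upwards [ae_all_iff.2 hae] with x hx hxΩ j hj
    have h1 := hx j hj
    rw [indicator_of_mem hxΩ] at h1
    refine h1.congr' ?_
    obtain ⟨δ, hδ, hball⟩ := Metric.nhds_basis_closedBall.mem_iff.1 (hΩ.mem_nhds hxΩ)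
    filter_upwards [hφ.eventually (gt_mem_nhds hδ)] with q hq
    exact ((hw j hj).iteratedFDeriv_convolution hΩ (hu'.locallyIntegrable hp)
      ((memLp_indicator hΩ (hg j hj)).locallyIntegrable hp) (φ q)
      ((Metric.closedBall_subset_closedBall hq.le).trans hball)).symm

theorem exists_bound_iteratedFDeriv {G : Type*} [NormedAddCommGroup G] [NormedSpace ℝ G]
    {ζ : E m → G} (hζ : ContDiff ℝ ∞ ζ) (hc : HasCompactSupport ζ) (k : ℕ) :
    ∃ M : ℝ, 0 ≤ M ∧ ∀ l ≤ k, ∀ x, ‖iteratedFDeriv ℝ l ζ x‖ ≤ M := by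
  have h : ∀ l : ℕ, ∃ C, ∀ x, ‖iteratedFDeriv ℝ l ζ x‖ ≤ C := fun l =>
    (hζ.continuous_iteratedFDeriv (m := l) (by exact_mod_cast le_top))
      |>.bounded_above_of_compact_support (hc.iteratedFDeriv l)
  choose C hC using h
  have hC0 : ∀ l, 0 ≤ C l := fun l => (norm_nonneg _).trans (hC l 0)
  refine ⟨∑ l ∈ Finset.range (k + 1), C l, Finset.sum_nonneg fun l _ => hC0 l,
    fun l hl x => (hC l x).trans ?_⟩
  exact Finset.single_le_sum (f := C) (fun i _ => hC0 i) (Finset.mem_range.2 (by omega))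

/-- **Density of smooth functions** (Meyers–Serrin). On an arbitrary open set, a function with weak
derivatives in `L^p` is approximated by smooth functions together with its derivatives.

The approximation is `∑ ζ n • v n` for a partition of unity `ζ` and mollifications `v n`. The
Leibniz rule is only used for smooth functions: `u` is replaced by a smooth `V q` in
`∑ ζ n • v n - u = ∑ ζ n • (v n - u)`, and then `q` tends to infinity. -/
theorem exists_smooth_eLpNorm_sub_le [CompleteSpace F] {p : ℝ≥0∞} (hp : 1 ≤ p)
    (hp_top : p ≠ ⊤) {Ω : Set (E m)} (hΩ : IsOpen Ω) {k : ℕ} {u : E m → F}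
    {g : ∀ j, E m → ContinuousMultilinearMap ℝ (fun _ : Fin j => E m) F}
    (hu : MemLp u p (volume.restrict Ω)) (hw : ∀ j ≤ k, IsWeakDeriv j Ω u (g j))
    (hg : ∀ j ≤ k, MemLp (g j) p (volume.restrict Ω)) {ε : ℝ≥0∞} (hε : ε ≠ 0) :
    ∃ f : E m → F, ContDiffOn ℝ ∞ f Ω ∧
      ∀ j ≤ k, eLpNorm (iteratedFDeriv ℝ j f - g j) p (volume.restrict Ω) ≤ ε := by
  obtain ⟨ζ, hζ, hζc, hζΩ, hζone⟩ := exists_smooth_partition hΩ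
  obtain ⟨ε', hε'pos, hε'⟩ := ENNReal.exists_pos_sum_of_countable hε ℕ
  choose M hM0 hM using fun n => exists_bound_iteratedFDeriv (hζ n) (hζc n) k
  -- The factor which the Leibniz rule for `ζ n` costs.
  let c : ℕ → ℝ≥0∞ := fun n => ENNReal.ofReal (2 ^ k * M n + 1)
  have happ : ∀ n, ∃ v : E m → F, ContDiff ℝ ∞ v ∧ ∀ j ≤ k,
      eLpNorm (iteratedFDeriv ℝ j v - g j) p (volume.restrict (tsupport (ζ n))) ≤
        ε' n / c n := fun n =>
    exists_smooth_approx_on_compact hp hp_top hΩ hu hw hg (hζc n) (hζΩ n)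
      (ENNReal.div_pos (by exact_mod_cast (hε'pos n).ne') ENNReal.ofReal_ne_top)
  choose v hv hvε using happ
  obtain ⟨V, hV, hVae⟩ := exists_smooth_tendsto_ae hp hΩ hu hw hg
  let f : E m → F := fun x => ∑' n, ζ n x • v n x
  have hfloc : ∀ {N : ℕ} {x : E m}, (∀ᶠ y in 𝓝 x, (∀ n, N ≤ n → ζ n y = 0) ∧
      ∑ n ∈ Finset.range N, ζ n y = 1) →
      f =ᶠ[𝓝 x] fun y => ∑ n ∈ Finset.range N, ζ n y • v n y := by
    intro N x h
    filter_upwards [h] with y hy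
    refine tsum_eq_sum fun n hn => ?_
    rw [hy.1 n (by simpa using hn), zero_smul]
  have hfsm : ContDiffOn ℝ ∞ f Ω := by
    intro x hx
    obtain ⟨N, hN⟩ := hζone x hx
    refine ContDiffAt.contDiffWithinAt (ContDiffAt.congr_of_eventuallyEq ?_ (hfloc hN))
    exact (ContDiff.sum fun n _ => (hζ n).smul (hv n)).contDiffAt
  refine ⟨f, hfsm, fun j hj => ?_⟩
  -- `H n` is the bound which the Leibniz rule gives for the `n`-th summand of `f - u`.
  let H : ℕ → E m → ℝ := fun n x => ∑ l ∈ Finset.range (j + 1),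
    (j.choose l : ℝ) * ‖iteratedFDeriv ℝ l (ζ n) x‖ *
      ‖iteratedFDeriv ℝ (j - l) (v n) x - g (j - l) x‖
  have hcζ : ∀ n (l : ℕ), Continuous (iteratedFDeriv ℝ l (ζ n)) := fun n l =>
    (hζ n).continuous_iteratedFDeriv (m := l) (by exact_mod_cast le_top)
  have hcv : ∀ n (l : ℕ), Continuous (iteratedFDeriv ℝ l (v n)) := fun n l =>
    (hv n).continuous_iteratedFDeriv (m := l) (by exact_mod_cast le_top)
  have hHm : ∀ n, ∀ l ∈ Finset.range (j + 1), AEStronglyMeasurable (fun x => (j.choose l : ℝ) *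
      ‖iteratedFDeriv ℝ l (ζ n) x‖ * ‖iteratedFDeriv ℝ (j - l) (v n) x - g (j - l) x‖)
      (volume.restrict Ω) := fun n l _ =>
    ((continuous_const.mul (hcζ n l).norm).aestronglyMeasurable).mul
      ((hcv n (j - l)).aestronglyMeasurable.sub (hg (j - l) (by omega)).1).norm
  have hterm : ∀ n, ∀ l ∈ Finset.range (j + 1), eLpNorm (fun x => (j.choose l : ℝ) *
      ‖iteratedFDeriv ℝ l (ζ n) x‖ * ‖iteratedFDeriv ℝ (j - l) (v n) x - g (j - l) x‖) p
      (volume.restrict Ω) ≤ ENNReal.ofReal (j.choose l * M n) * (ε' n / c n) := by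
    intro n l hl
    have hlj : l ≤ j := Nat.lt_succ_iff.1 (Finset.mem_range.1 hl)
    have hsupp : Function.support (fun x => (j.choose l : ℝ) *
        ‖iteratedFDeriv ℝ l (ζ n) x‖ * ‖iteratedFDeriv ℝ (j - l) (v n) x - g (j - l) x‖) ⊆
        tsupport (ζ n) := by
      refine Function.support_subset_iff'.2 fun x hx => ?_
      have : iteratedFDeriv ℝ l (ζ n) x = 0 :=
        image_eq_zero_of_notMem_tsupport fun h => hx (tsupport_iteratedFDeriv_subset (𝕜 := ℝ) l h)
      simp [this]
    refine (eLpNorm_mono_measure _ Measure.restrict_le_self).trans ?_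
    rw [← eLpNorm_restrict_eq_of_support_subset hsupp]
    refine (eLpNorm_le_mul_eLpNorm_of_ae_le_mul (g := iteratedFDeriv ℝ (j - l) (v n) - g (j - l))
      (c := j.choose l * M n) (ae_of_all _ fun x => ?_) p).trans ?_
    · rw [Real.norm_of_nonneg (by positivity), Pi.sub_apply]
      gcongr
      exact hM n l (hlj.trans hj) x
    · gcongr
      exact hvε n (j - l) (by omega)
  have hHn : ∀ n, eLpNorm (H n) p (volume.restrict Ω) ≤ ε' n := by
    intro n
    have h1 : H n = ∑ l ∈ Finset.range (j + 1), fun x => (j.choose l : ℝ) *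
        ‖iteratedFDeriv ℝ l (ζ n) x‖ * ‖iteratedFDeriv ℝ (j - l) (v n) x - g (j - l) x‖ := by
      funext x; simp [H]
    rw [h1]
    refine (eLpNorm_sum_le (hHm n) hp).trans ((Finset.sum_le_sum (hterm n)).trans ?_)
    rw [← Finset.sum_mul, ← ENNReal.ofReal_sum_of_nonneg fun l _ => by
      have := hM0 n; positivity]
    refine (mul_le_mul_left ?_ _).trans (ENNReal.mul_div_le (a := c n))
    refine ENNReal.ofReal_le_ofReal ?_
    rw [← Finset.sum_mul]
    have h2 : ∑ l ∈ Finset.range (j + 1), (j.choose l : ℝ) = 2 ^ j := by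
      exact_mod_cast Nat.sum_range_choose j
    rw [h2]
    have h3 : (2 : ℝ) ^ j ≤ 2 ^ k := pow_le_pow_right₀ (by norm_num) hj
    nlinarith [hM0 n]
  have hpt : ∀ᵐ x ∂(volume.restrict Ω), ∀ N, (∀ᶠ y in 𝓝 x, (∀ n, N ≤ n → ζ n y = 0) ∧
      ∑ n ∈ Finset.range N, ζ n y = 1) →
      ‖iteratedFDeriv ℝ j f x - g j x‖ ≤ ∑ n ∈ Finset.range N, H n x := by
    filter_upwards [hVae] with x hx N hN
    have hq : ∀ q, ‖iteratedFDeriv ℝ j f x - iteratedFDeriv ℝ j (V q) x‖ ≤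
        ∑ n ∈ Finset.range N, ∑ l ∈ Finset.range (j + 1),
          (j.choose l : ℝ) * ‖iteratedFDeriv ℝ l (ζ n) x‖ *
          ‖iteratedFDeriv ℝ (j - l) (v n) x - iteratedFDeriv ℝ (j - l) (V q) x‖ := by
      intro q
      have hfx : ContDiffAt ℝ ∞ f x := ContDiffAt.congr_of_eventuallyEq
        (ContDiff.sum fun n _ => (hζ n).smul (hv n)).contDiffAt (hfloc hN)
      have hsm : ∀ n, ContDiff ℝ j (fun y => ζ n y • (v n - V q) y) := fun n =>
        ((hζ n).smul ((hv n).sub (hV q))).of_le (by exact_mod_cast le_top)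
      have e1 : f - V q =ᶠ[𝓝 x] fun y => ∑ n ∈ Finset.range N, ζ n y • (v n - V q) y := by
        filter_upwards [hfloc hN, hN] with y h1 h2
        rw [Pi.sub_apply, h1]
        simp only [Pi.sub_apply, smul_sub, Finset.sum_sub_distrib]
        rw [← Finset.sum_smul, h2.2, one_smul]
      rw [← iteratedFDeriv_sub_apply (hfx.of_le (by exact_mod_cast le_top))
        ((hV q).contDiffAt.of_le (by exact_mod_cast le_top)), (e1.iteratedFDeriv ℝ j).eq_of_nhds,
        iteratedFDeriv_sum (f := fun n y => ζ n y • (v n - V q) y) fun n _ => hsm n,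
        Finset.sum_apply]
      refine (norm_sum_le _ _).trans (Finset.sum_le_sum fun n _ => ?_)
      refine (norm_iteratedFDeriv_smul_le (hζ n) ((hv n).sub (hV q)) x
        (by exact_mod_cast le_top)).trans_eq (Finset.sum_congr rfl fun l _ => ?_)
      have hsub : iteratedFDeriv ℝ (j - l) (fun x => v n x - V q x) x =
          iteratedFDeriv ℝ (j - l) (v n) x - iteratedFDeriv ℝ (j - l) (V q) x :=
        iteratedFDeriv_sub_apply (contDiff_infty.1 (hv n) _).contDiffAt
          (contDiff_infty.1 (hV q) _).contDiffAt
      rw [hsub]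
    refine le_of_tendsto_of_tendsto' ((tendsto_const_nhds.sub (hx j hj)).norm)
      (tendsto_finsetSum _ fun n _ => tendsto_finsetSum _ fun l hl => ?_) hq
    exact (tendsto_const_nhds.sub (hx (j - l) (by omega))).norm.const_mul _
  -- The sets `S N` exhaust `Ω`; on `S N` only the first `N` summands matter, and the estimate on
  -- `Ω` follows with Fatou's lemma.
  let S : ℕ → Set (E m) := fun N => interior {y | (∀ n, N ≤ n → ζ n y = 0) ∧
      ∑ n ∈ Finset.range N, ζ n y = 1}
  have hSm : Monotone S := by
    intro N N' hNN'
    refine interior_mono fun y hy => ⟨fun n hn => hy.1 n (hNN'.trans hn), ?_⟩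
    rw [← hy.2]
    refine (Finset.sum_subset (Finset.range_subset_range.2 hNN') fun n _ hn => ?_).symm
    exact hy.1 n (by simpa using hn)
  have hmeas : AEStronglyMeasurable (iteratedFDeriv ℝ j f - g j) (volume.restrict Ω) :=
    ((ContDiffOn.continuousOn_iteratedFDeriv hΩ hfsm j).aestronglyMeasurable
      hΩ.measurableSet).sub (hg j hj).1
  refine (Lp.eLpNorm_lim_le_liminf_eLpNorm
    (f := fun N => (S N).indicator (iteratedFDeriv ℝ j f - g j))
    (fun N => hmeas.indicator isOpen_interior.measurableSet) _ ?_).trans ?_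
  · rw [ae_restrict_iff' hΩ.measurableSet]
    refine ae_of_all _ fun x hx => ?_
    obtain ⟨N, hN⟩ := hζone x hx
    refine tendsto_const_nhds.congr' ?_
    filter_upwards [eventually_ge_atTop N] with N' hN'
    rw [indicator_of_mem (hSm hN' (mem_interior_iff_mem_nhds.2 hN))]
  · refine liminf_le_of_frequently_le' (Frequently.of_forall fun N => ?_)
    calc eLpNorm ((S N).indicator (iteratedFDeriv ℝ j f - g j)) p (volume.restrict Ω)
        ≤ eLpNorm (∑ n ∈ Finset.range N, H n) p (volume.restrict Ω) := by
          refine eLpNorm_mono_ae_real ?_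
          filter_upwards [hpt] with x hx
          by_cases hxS : x ∈ S N
          · rw [indicator_of_mem hxS, Finset.sum_apply]
            exact hx N (mem_interior_iff_mem_nhds.1 hxS)
          · rw [indicator_of_notMem hxS, norm_zero, Finset.sum_apply]
            exact Finset.sum_nonneg fun n _ => Finset.sum_nonneg fun l _ => by positivity
      _ ≤ ∑ n ∈ Finset.range N, eLpNorm (H n) p (volume.restrict Ω) :=
          eLpNorm_sum_le (fun n _ => by
            have h1 : H n = ∑ l ∈ Finset.range (j + 1), fun x => (j.choose l : ℝ) *
              ‖iteratedFDeriv ℝ l (ζ n) x‖ *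
              ‖iteratedFDeriv ℝ (j - l) (v n) x - g (j - l) x‖ := by
              funext x; simp [H]
            rw [h1]
            exact Finset.aestronglyMeasurable_sum _ (hHm n)) hp
      _ ≤ ∑ n ∈ Finset.range N, (ε' n : ℝ≥0∞) := Finset.sum_le_sum fun n _ => hHn n
      _ ≤ ∑' n, (ε' n : ℝ≥0∞) := ENNReal.sum_le_tsum _
      _ ≤ ε := hε'.le

end SmoothDensity

end CubeOpening

namespace CubeOpening

section Chain

variable {m : ℕ}

/-! ### Derivatives of compositions -/

/-- A form of the Faà di Bruno estimate in which only the derivatives of `f` of positive order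
enter, and not `f` itself: the constant `f (Φ x)` may be subtracted from `f`. -/
theorem norm_iteratedFDeriv_comp_le_sum {G : Type*} [NormedAddCommGroup G] [NormedSpace ℝ G]
    {f : E m → G} {Φ : E m → E m} {Ω : Set (E m)} (hΩ : IsOpen Ω) (hf : ContDiffOn ℝ ∞ f Ω)
    (hΦ : ContDiff ℝ ∞ Φ) {x : E m} (hx : Φ x ∈ Ω) {j : ℕ} (hj : 1 ≤ j) {D : ℝ}
    (hD : ∀ i, 1 ≤ i → i ≤ j → ‖iteratedFDeriv ℝ i Φ x‖ ≤ D ^ i) :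
    ‖iteratedFDeriv ℝ j (f ∘ Φ) x‖ ≤
      j.factorial * (∑ i ∈ Finset.Icc 1 j, ‖iteratedFDeriv ℝ i f (Φ x)‖) * D ^ j := by
  set s : Set (E m) := Φ ⁻¹' Ω
  have hso : IsOpen s := hΩ.preimage hΦ.continuous
  set c := f (Φ x) with hc
  have hsub : ∀ {H : E m → G} {y : E m}, ContDiffAt ℝ ∞ H y → ∀ i, 1 ≤ i →
      iteratedFDeriv ℝ i (fun z => H z - c) y = iteratedFDeriv ℝ i H y := by
    intro H y hH i hi
    have h1 : iteratedFDeriv ℝ i (fun z => H z - c) y =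
        iteratedFDeriv ℝ i H y - iteratedFDeriv ℝ i (fun _ : E m => c) y :=
      iteratedFDeriv_sub_apply (hH.of_le (by exact_mod_cast le_top))
        contDiff_const.contDiffAt
    rw [h1, iteratedFDeriv_const_of_ne (by omega)]
    simp
  have hmain := norm_iteratedFDerivWithin_comp_le (g := fun z => f z - c) (f := Φ) (n := j)
    (s := s) (t := Ω) (x := x) (N := ∞) (hf.sub contDiffOn_const) hΦ.contDiffOn
    (by exact_mod_cast le_top) hΩ.uniqueDiffOn hso.uniqueDiffOn (fun y hy => hy) hx
    (C := ∑ i ∈ Finset.Icc 1 j, ‖iteratedFDeriv ℝ i f (Φ x)‖) (D := D) ?_ ?_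
  · have h2 : iteratedFDerivWithin ℝ j ((fun z => f z - c) ∘ Φ) s x =
        iteratedFDeriv ℝ j (f ∘ Φ) x := by
      rw [iteratedFDerivWithin_of_isOpen j hso hx]
      exact hsub (H := f ∘ Φ)
        ((hf.contDiffAt (hΩ.mem_nhds hx)).comp x hΦ.contDiffAt) j hj
    rwa [h2] at hmain
  · intro i hi
    rw [iteratedFDerivWithin_of_isOpen i hΩ hx]
    rcases Nat.eq_zero_or_pos i with rfl | hi0
    · rw [norm_iteratedFDeriv_zero]
      simp only [hc, sub_self, norm_zero]
      exact Finset.sum_nonneg fun _ _ => norm_nonneg _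
    · rw [hsub (hf.contDiffAt (hΩ.mem_nhds hx)) i hi0]
      exact Finset.single_le_sum (f := fun i => ‖iteratedFDeriv ℝ i f (Φ x)‖)
        (fun _ _ => norm_nonneg _) (Finset.mem_Icc.2 ⟨hi0, hi⟩)
  · intro i h1 h2
    rw [iteratedFDerivWithin_of_isOpen i hso hx]
    exact hD i h1 h2

theorem le_self_pow_of_one_le {D : ℝ} (hD : 1 ≤ D) {i : ℕ} (hi : 1 ≤ i) : D ≤ D ^ i :=
  le_self_pow₀ hD (by omega)

theorem norm_iteratedFDeriv_comp_le_of_bound {Φ Ψ : E m → E m} (hΦ : ContDiff ℝ ∞ Φ)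
    (hΨ : ContDiff ℝ ∞ Ψ) {k : ℕ} {D₁ D₂ : ℝ} (h1 : 1 ≤ D₁) (h2 : 1 ≤ D₂)
    (hb₁ : ∀ i, 1 ≤ i → i ≤ k → ∀ x, ‖iteratedFDeriv ℝ i Φ x‖ ≤ D₁)
    (hb₂ : ∀ i, 1 ≤ i → i ≤ k → ∀ x, ‖iteratedFDeriv ℝ i Ψ x‖ ≤ D₂) {j : ℕ} (hj : 1 ≤ j)
    (hjk : j ≤ k) (x : E m) :
    ‖iteratedFDeriv ℝ j (Φ ∘ Ψ) x‖ ≤ k.factorial * (k * D₁) * D₂ ^ k := by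
  refine (norm_iteratedFDeriv_comp_le_sum isOpen_univ hΦ.contDiffOn hΨ (mem_univ _) hj
    (D := D₂) fun i hi hij => (hb₂ i hi (hij.trans hjk) x).trans
      (le_self_pow_of_one_le h2 hi)).trans ?_
  have hsum : ∑ i ∈ Finset.Icc 1 j, ‖iteratedFDeriv ℝ i Φ (Ψ x)‖ ≤ k * D₁ := by
    refine (Finset.sum_le_card_nsmul _ _ D₁ fun i hi => ?_).trans ?_
    · rw [Finset.mem_Icc] at hi
      exact hb₁ i hi.1 (hi.2.trans hjk) _
    · rw [Nat.card_Icc, nsmul_eq_mul]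
      have : ((j + 1 - 1 : ℕ) : ℝ) ≤ k := by exact_mod_cast (by omega : j + 1 - 1 ≤ k)
      gcongr
  have hsum0 : 0 ≤ ∑ i ∈ Finset.Icc 1 j, ‖iteratedFDeriv ℝ i Φ (Ψ x)‖ :=
    Finset.sum_nonneg fun _ _ => norm_nonneg _
  gcongr

end Chain

section Grid

variable {m : ℕ}

/-! ### The integer grid -/

/-- The directions of the cell of the unit grid with index `z`. The grid consists of the cubes of
radius `1` centred at the points with even coordinates; an integer vector `z` stands for the cell
centred at `z` which extends in the directions of the even coordinates of `z`. -/
def evenDirs (z : Fin m → ℤ) : Finset (Fin m) := Finset.univ.filter fun j => Even (z j)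

/-- The dimension of a grid cell. -/
def gridDim (z : Fin m → ℤ) : ℕ := (evenDirs z).card

theorem mem_evenDirs {z : Fin m → ℤ} {j : Fin m} : j ∈ evenDirs z ↔ Even (z j) := by
  simp [evenDirs]

/-- `w` is a face of the grid cell `z`. -/
def IsGridFace (w z : Fin m → ℤ) : Prop := ∀ j, w j = z j ∨ Even (z j) ∧ |w j - z j| = 1

/-- The box of points which are closer than `2ρ` to the integer `z j` if `z j` is odd, and within
`1 - 2ρ` of it if `z j` is even. These boxes form a partition of the space. The opening map
preserves each of them, so that they localize all the estimates. -/
def gridBox (ρ : ℝ) (z : Fin m → ℤ) : Set (E m) :=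
  {x | ∀ j, (Odd (z j) → |x j - z j| < 2 * ρ) ∧ (Even (z j) → |x j - z j| ≤ 1 - 2 * ρ)}

/-- The open cubical neighbourhood of radius `r` of the grid cell `z`. -/
def gridNhd (r : ℝ) (z : Fin m → ℤ) : Set (E m) :=
  {x | ∀ j, (Odd (z j) → |x j - z j| < r) ∧ (Even (z j) → |x j - z j| < 1 + r)}

/-- `Φ` is constant on the cubes of radius `r` which are orthogonal to the grid cell `z`. -/
def IsOpenedAt (r : ℝ) (z : Fin m → ℤ) (Φ : E m → E m) : Prop :=
  ∀ y y' : E m, (∀ j, Even (z j) → y j = y' j ∧ |y j - z j| ≤ 1) →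
    (∀ j, Odd (z j) → |y j - z j| ≤ r ∧ |y' j - z j| ≤ r) → Φ y = Φ y'

/-- `Φ` changes a coordinate only if it is close to an odd integer, and keeps it close to that
integer. -/
def IsNearPreserving (r : ℝ) (Φ : E m → E m) : Prop :=
  ∀ x j, Φ x j = x j ∨ ∃ n : ℤ, Odd n ∧ |x j - n| < r ∧ |Φ x j - n| < r

theorem int_eq_of_abs_sub_lt_two {n l : ℤ} (hn : Odd n) (hl : Odd l)
    (h : |(n : ℝ) - l| < 2) : n = l := by
  have h' : |n - l| < 2 := by exact_mod_cast h
  rw [abs_lt] at h'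
  obtain ⟨a, rfl⟩ := hn
  obtain ⟨b, rfl⟩ := hl
  omega

theorem not_abs_sub_lt_one {n l : ℤ} (hn : Odd n) (hl : Even l) : ¬ |(n : ℝ) - l| < 1 := by
  intro h
  have h' : |n - l| < 1 := by exact_mod_cast h
  rw [abs_lt] at h'
  obtain ⟨a, rfl⟩ := hn
  obtain ⟨b, rfl⟩ := hl
  omega

theorem IsNearPreserving.mono {r r' : ℝ} (h : r ≤ r') {Φ : E m → E m}
    (hΦ : IsNearPreserving r Φ) : IsNearPreserving r' Φ := fun x j =>
  (hΦ x j).imp_right fun ⟨n, hn, h1, h2⟩ => ⟨n, hn, h1.trans_le h, h2.trans_le h⟩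

theorem IsNearPreserving.comp {r : ℝ} (hr : r ≤ 1) {Φ Ψ : E m → E m}
    (hΦ : IsNearPreserving r Φ) (hΨ : IsNearPreserving r Ψ) : IsNearPreserving r (Φ ∘ Ψ) := by
  intro x j
  rcases hΨ x j with h1 | ⟨n, hn, h1, h2⟩
  · rcases hΦ (Ψ x) j with h3 | ⟨n, hn, h3, h4⟩
    · exact Or.inl (h3.trans h1)
    · exact Or.inr ⟨n, hn, h1 ▸ h3, h4⟩
  · rcases hΦ (Ψ x) j with h3 | ⟨l, hl, h3, h4⟩
    · exact Or.inr ⟨n, hn, h1, by rw [Function.comp_apply, h3]; exact h2⟩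
    · have : n = l := int_eq_of_abs_sub_lt_two hn hl (by
        rw [abs_lt] at *
        constructor <;> linarith)
      subst this
      exact Or.inr ⟨n, hn, h1, h4⟩

theorem IsNearPreserving.mem_gridBox {r ρ : ℝ} (hr : r ≤ 2 * ρ) (hρ : ρ < 1 / 2)
    {Φ : E m → E m} (hΦ : IsNearPreserving r Φ) {z : Fin m → ℤ} {x : E m}
    (hx : x ∈ gridBox ρ z) : Φ x ∈ gridBox ρ z := by
  intro j
  rcases hΦ x j with h | ⟨n, hn, h1, h2⟩
  · rw [h]; exact hx j
  · refine ⟨fun ho => ?_, fun he => ?_⟩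
    · have h3 := (hx j).1 ho
      have : n = z j := int_eq_of_abs_sub_lt_two hn ho (by
        rw [abs_lt] at *
        constructor <;> linarith)
      rw [← this]
      exact h2.trans_le hr
    · have h3 := (hx j).2 he
      refine absurd ?_ (not_abs_sub_lt_one hn he)
      rw [abs_lt] at *
      rw [abs_le] at h3
      constructor <;> linarith

theorem measurableSet_gridBox (ρ : ℝ) (z : Fin m → ℤ) : MeasurableSet (gridBox ρ z) := by
  have : gridBox ρ z = ⋂ j, {x : E m | (Odd (z j) → |x j - z j| < 2 * ρ) ∧
      (Even (z j) → |x j - z j| ≤ 1 - 2 * ρ)} := by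
    ext x; simp [gridBox]
  rw [this]
  refine MeasurableSet.iInter fun j => ?_
  have hm : Measurable fun x : E m => |x j - z j| := by fun_prop
  rcases Int.even_or_odd (z j) with h | h
  · have h' : ¬ Odd (z j) := by simpa using h
    simp only [h, h', false_imp_iff, true_imp_iff, true_and]
    exact measurableSet_le hm measurable_const
  · have h' : ¬ Even (z j) := by simpa using h
    simp only [h, h', false_imp_iff, true_imp_iff, and_true]
    exact measurableSet_lt hm measurable_const

theorem exists_mem_gridBox {ρ : ℝ} (x : E m) : ∃ z, x ∈ gridBox ρ z := by
  have h1 : ∀ t : ℝ, ∃ n : ℤ, (Odd n → |t - n| < 2 * ρ) ∧ (Even n → |t - n| ≤ 1 - 2 * ρ) := by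
    intro t
    set q := ⌊t / 2⌋
    have ha : (q : ℝ) ≤ t / 2 := Int.floor_le _
    have hb : t / 2 < q + 1 := Int.lt_floor_add_one _
    by_cases h : |t - ((2 * q + 1 : ℤ) : ℝ)| < 2 * ρ
    · exact ⟨2 * q + 1, fun _ => h, fun ⟨a, ha⟩ => by omega⟩
    · rw [not_lt, le_abs] at h
      push_cast at h
      rcases h with h | h
      · refine ⟨2 * q + 2, fun ho => ?_, fun _ => ?_⟩
        · exact absurd ho (by simp [parity_simps])
        · push_cast
          rw [abs_le]
          constructor <;> linarith
      · refine ⟨2 * q, fun ho => ?_, fun _ => ?_⟩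
        · exact absurd ho (by simp)
        · push_cast
          rw [abs_le]
          constructor <;> linarith
  choose n hn using fun j => h1 (x j)
  exact ⟨n, hn⟩

theorem gridBox_unique {ρ : ℝ} (h0 : 0 < ρ) (hρ : ρ < 1 / 2) {x : E m} {z z' : Fin m → ℤ}
    (hz : x ∈ gridBox ρ z) (hz' : x ∈ gridBox ρ z') : z = z' := by
  have aux : ∀ {w w' : Fin m → ℤ}, x ∈ gridBox ρ w → x ∈ gridBox ρ w' → ∀ j, Odd (w j) →
      w j = w' j := by
    intro w w' hw hw' j ho
    have h1 := (hw j).1 ho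
    rcases Int.even_or_odd (w' j) with he | ho'
    · have h2 := (hw' j).2 he
      refine absurd ?_ (not_abs_sub_lt_one ho he)
      rw [abs_lt] at *
      rw [abs_le] at h2
      constructor <;> linarith
    · have h2 := (hw' j).1 ho'
      refine int_eq_of_abs_sub_lt_two ho ho' ?_
      rw [abs_lt] at *
      constructor <;> linarith
  funext j
  rcases Int.even_or_odd (z j) with he | ho
  · rcases Int.even_or_odd (z' j) with he' | ho'
    · have h1 := (hz j).2 he
      have h2 := (hz' j).2 he'
      have h3 : |(z j : ℝ) - z' j| < 2 := by
        rw [abs_le] at h1 h2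
        rw [abs_lt]
        constructor <;> linarith
      have h4 : |z j - z' j| < 2 := by exact_mod_cast h3
      rw [abs_lt] at h4
      obtain ⟨a, ha⟩ := he
      obtain ⟨b, hb⟩ := he'
      omega
    · exact (aux hz' hz j ho').symm
  · exact aux hz hz' j ho

theorem pairwise_disjoint_gridBox {ρ : ℝ} (h0 : 0 < ρ) (hρ : ρ < 1 / 2) :
    Pairwise (Function.onFun Disjoint (gridBox (m := m) ρ)) := fun _ _ hne =>
  Set.disjoint_left.2 fun _ hx hx' => hne (gridBox_unique h0 hρ hx hx')

/-- An estimate on all boxes extends to unions of boxes. -/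
theorem lintegral_le_of_gridBox {ρ : ℝ} (h0 : 0 < ρ) (hρ : ρ < 1 / 2) {C : ℝ≥0∞}
    {f g : E m → ℝ≥0∞}
    (h : ∀ z, ∫⁻ x in gridBox ρ z, f x ≤ C * ∫⁻ x in gridBox ρ z, g x) {N : Set (E m)}
    (hN : ∀ z, (gridBox ρ z ∩ N).Nonempty → gridBox ρ z ⊆ N) :
    ∫⁻ x in N, f x ≤ C * ∫⁻ x in N, g x := by
  have hNeq : N = ⋃ z : {z // gridBox ρ z ⊆ N}, gridBox ρ z.1 := by
    ext x
    simp only [mem_iUnion]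
    constructor
    · intro hx
      obtain ⟨z, hz⟩ := exists_mem_gridBox (ρ := ρ) x
      exact ⟨⟨z, hN z ⟨x, hz, hx⟩⟩, hz⟩
    · rintro ⟨z, hz⟩
      exact z.2 hz
  have hd : Pairwise (Function.onFun Disjoint fun z : {z // gridBox ρ z ⊆ N} => gridBox ρ z.1) :=
    fun z z' hne => pairwise_disjoint_gridBox h0 hρ fun h => hne (Subtype.ext h)
  rw [hNeq, lintegral_iUnion (fun z => measurableSet_gridBox ρ _) hd,
    lintegral_iUnion (fun z => measurableSet_gridBox ρ _) hd, ← ENNReal.tsum_mul_left]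
  exact ENNReal.tsum_le_tsum fun z => h z.1

end Grid

end CubeOpening

namespace CubeOpening

section OpeningMap

variable {m : ℕ}

/-! ### The opening map at one cell -/

/-- `b` is a smooth cutoff function on the line, equal to `1` on `[-A, A]` and to `0` outside
`(-B, B)`. -/
structure IsCutoff (A B : ℝ) (b : ℝ → ℝ) : Prop where
  contDiff : ContDiff ℝ ∞ b
  nonneg : ∀ t, 0 ≤ b t
  le_one : ∀ t, b t ≤ 1
  eq_one : ∀ t, |t| ≤ A → b t = 1
  eq_zero : ∀ t, B ≤ |t| → b t = 0

theorem exists_isCutoff {A B : ℝ} (hA : 0 < A) (hAB : A < B) : ∃ b, IsCutoff A B b := by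
  let b : ContDiffBump (0 : ℝ) := ⟨A, B, hA, hAB⟩
  refine ⟨b, b.contDiff, fun _ => b.nonneg, fun _ => b.le_one, fun t ht => ?_, fun t ht => ?_⟩
  · exact b.one_of_mem_closedBall (by simpa using ht)
  · exact b.zero_of_le_dist (by simpa using ht)

/-- The cutoff function around a cell with directions `P`: the product of the cutoff functions `bE`
in the directions of the cell and `bO` in the normal directions. -/
def cellCutoff (bE bO : ℝ → ℝ) (P : Finset (Fin m)) (y : E m) : ℝ :=
  ∏ j, if j ∈ P then bE (y j) else bO (y j)

/-- The displacement which moves a point towards a cell with directions `P` centred at the origin,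
in the normal directions. It reaches the cell where the cutoff function equals `1`. -/
def cellDisp (bE bO : ℝ → ℝ) (P : Finset (Fin m)) (y : E m) : E m :=
  WithLp.toLp 2 fun j => if j ∈ P then 0 else -(cellCutoff bE bO P y * y j)

/-- An integer vector as a point of the Euclidean space. -/
def intPoint (z : Fin m → ℤ) : E m := WithLp.toLp 2 fun j => (z j : ℝ)

/-- The opening map at the grid cell `z` with shift `a`: the conjugate by the translation by `a` of
the map which collapses a neighbourhood of the cell onto the cell. -/
def cellMap (bE bO : ℝ → ℝ) (z : Fin m → ℤ) (a x : E m) : E m :=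
  x + cellDisp bE bO (evenDirs z) (x + a - intPoint z)

/-- The neighbourhood of the cell `z` outside which the opening maps with small shifts are the
identity. It exceeds the support of the cutoff function, which is given by `r + 2 * g` and
`1 - r - 5 * g`, by the bound `g` for the shifts. -/
def cellZone (r g : ℝ) (z : Fin m → ℤ) : Set (E m) :=
  {x | ∀ j, (Odd (z j) → |x j - z j| < r + 3 * g) ∧
    (Even (z j) → |x j - z j| < 1 - r - 4 * g)}

variable {r g : ℝ} {bE bO : ℝ → ℝ}

theorem cellCutoff_nonneg (hE : IsCutoff (1 - r - 6 * g) (1 - r - 5 * g) bE)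
    (hO : IsCutoff (r + g) (r + 2 * g) bO) (P : Finset (Fin m)) (y : E m) :
    0 ≤ cellCutoff bE bO P y :=
  Finset.prod_nonneg fun j _ => by
    split_ifs
    · exact hE.nonneg _
    · exact hO.nonneg _

theorem cellCutoff_le_one (hE : IsCutoff (1 - r - 6 * g) (1 - r - 5 * g) bE)
    (hO : IsCutoff (r + g) (r + 2 * g) bO) (P : Finset (Fin m)) (y : E m) :
    cellCutoff bE bO P y ≤ 1 :=
  Finset.prod_le_one (fun j _ => by
    split_ifs
    · exact hE.nonneg _
    · exact hO.nonneg _) fun j _ => by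
    split_ifs
    · exact hE.le_one _
    · exact hO.le_one _

theorem cellCutoff_eq_one (hE : IsCutoff (1 - r - 6 * g) (1 - r - 5 * g) bE)
    (hO : IsCutoff (r + g) (r + 2 * g) bO) {P : Finset (Fin m)} {y : E m}
    (h1 : ∀ j ∈ P, |y j| ≤ 1 - r - 6 * g) (h2 : ∀ j ∉ P, |y j| ≤ r + g) :
    cellCutoff bE bO P y = 1 :=
  Finset.prod_eq_one fun j _ => by
    split_ifs with h
    · exact hE.eq_one _ (h1 j h)
    · exact hO.eq_one _ (h2 j h)

theorem abs_lt_of_cellCutoff_ne_zero (hE : IsCutoff (1 - r - 6 * g) (1 - r - 5 * g) bE)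
    (hO : IsCutoff (r + g) (r + 2 * g) bO) {P : Finset (Fin m)} {y : E m}
    (h : cellCutoff bE bO P y ≠ 0) (j : Fin m) :
    (j ∈ P → |y j| < 1 - r - 5 * g) ∧ (j ∉ P → |y j| < r + 2 * g) := by
  have hj := Finset.prod_ne_zero_iff.1 h j (Finset.mem_univ j)
  refine ⟨fun hP => ?_, fun hP => ?_⟩
  · rw [if_pos hP] at hj
    by_contra hlt
    exact hj (hE.eq_zero _ (not_lt.1 hlt))
  · rw [if_neg hP] at hj
    by_contra hlt
    exact hj (hO.eq_zero _ (not_lt.1 hlt))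

theorem cellMap_apply_even (bE bO : ℝ → ℝ) {z : Fin m → ℤ} (a x : E m) {j : Fin m}
    (hj : Even (z j)) : cellMap bE bO z a x j = x j := by
  simp [cellMap, cellDisp, mem_evenDirs, hj]

theorem cellMap_apply_odd (bE bO : ℝ → ℝ) {z : Fin m → ℤ} (a x : E m) {j : Fin m}
    (hj : ¬ Even (z j)) : cellMap bE bO z a x j =
      x j - cellCutoff bE bO (evenDirs z) (x + a - intPoint z) * (x j + a j - z j) := by
  simp [cellMap, cellDisp, mem_evenDirs, hj, intPoint, sub_eq_add_neg]

theorem cellMap_eq_self_of_cutoff_eq_zero {z : Fin m → ℤ} {a x : E m}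
    (h : cellCutoff bE bO (evenDirs z) (x + a - intPoint z) = 0) : cellMap bE bO z a x = x := by
  ext j
  by_cases hj : Even (z j)
  · exact cellMap_apply_even bE bO a x hj
  · rw [cellMap_apply_odd bE bO a x hj, h]; simp

theorem mem_cellZone_of_cutoff_ne_zero (hE : IsCutoff (1 - r - 6 * g) (1 - r - 5 * g) bE)
    (hO : IsCutoff (r + g) (r + 2 * g) bO) {z : Fin m → ℤ} {a x : E m} (ha : ∀ j, |a j| < g)
    (h : cellCutoff bE bO (evenDirs z) (x + a - intPoint z) ≠ 0) : x ∈ cellZone r g z := by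
  intro j
  have hj := abs_lt_of_cellCutoff_ne_zero hE hO h j
  have haj := ha j
  simp only [mem_evenDirs, intPoint, PiLp.sub_apply, PiLp.add_apply] at hj
  refine ⟨fun ho => ?_, fun he => ?_⟩
  · have := hj.2 (by simpa using ho)
    rw [abs_lt] at *
    constructor <;> linarith
  · have := hj.1 he
    rw [abs_lt] at *
    constructor <;> linarith

theorem cellMap_eq_self (hE : IsCutoff (1 - r - 6 * g) (1 - r - 5 * g) bE)
    (hO : IsCutoff (r + g) (r + 2 * g) bO) {z : Fin m → ℤ} {a x : E m} (ha : ∀ j, |a j| < g)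
    (hx : x ∉ cellZone r g z) : cellMap bE bO z a x = x :=
  cellMap_eq_self_of_cutoff_eq_zero (by
    by_contra h
    exact hx (mem_cellZone_of_cutoff_ne_zero hE hO ha h))

theorem cellMap_apply_odd_abs_lt (hE : IsCutoff (1 - r - 6 * g) (1 - r - 5 * g) bE)
    (hO : IsCutoff (r + g) (r + 2 * g) bO) {z : Fin m → ℤ} {a x : E m}
    (ha : ∀ j, |a j| < g) (hx : x ∈ cellZone r g z) {j : Fin m} (hj : Odd (z j)) :
    |cellMap bE bO z a x j - z j| < r + 3 * g := by
  have hj' : ¬ Even (z j) := by simpa using hj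
  by_cases h : cellCutoff bE bO (evenDirs z) (x + a - intPoint z) = 0
  · rw [cellMap_eq_self_of_cutoff_eq_zero h]
    exact (hx j).1 hj
  · have h1 := (abs_lt_of_cellCutoff_ne_zero hE hO h j).2 (by simpa [mem_evenDirs] using hj)
    simp only [intPoint, PiLp.sub_apply, PiLp.add_apply] at h1
    have h2 := cellCutoff_nonneg hE hO (evenDirs z) (x + a - intPoint z)
    have h3 := cellCutoff_le_one hE hO (evenDirs z) (x + a - intPoint z)
    rw [cellMap_apply_odd bE bO a x hj']
    set θ := cellCutoff bE bO (evenDirs z) (x + a - intPoint z)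
    have e : x j - θ * (x j + a j - z j) - z j = (1 - θ) * (x j + a j - z j) - a j := by ring
    have h4 : |(1 - θ) * (x j + a j - z j)| ≤ |x j + a j - z j| := by
      rw [abs_mul, abs_of_nonneg (by linarith : 0 ≤ 1 - θ)]
      exact mul_le_of_le_one_left (abs_nonneg _) (by linarith)
    rw [e]
    have := abs_sub ((1 - θ) * (x j + a j - z j)) (a j)
    linarith [ha j]

theorem cellMap_mem_cellZone (hE : IsCutoff (1 - r - 6 * g) (1 - r - 5 * g) bE)
    (hO : IsCutoff (r + g) (r + 2 * g) bO) {z : Fin m → ℤ} {a x : E m}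
    (ha : ∀ j, |a j| < g) (hx : x ∈ cellZone r g z) : cellMap bE bO z a x ∈ cellZone r g z := by
  refine fun j => ⟨fun ho => cellMap_apply_odd_abs_lt hE hO ha hx ho, fun he => ?_⟩
  rw [cellMap_apply_even bE bO a x he]
  exact (hx j).2 he

theorem cellMap_isNearPreserving (hE : IsCutoff (1 - r - 6 * g) (1 - r - 5 * g) bE)
    (hO : IsCutoff (r + g) (r + 2 * g) bO) {z : Fin m → ℤ} {a : E m}
    (ha : ∀ j, |a j| < g) : IsNearPreserving (r + 3 * g) (cellMap bE bO z a) := by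
  intro x j
  by_cases hx : x ∈ cellZone r g z
  · rcases Int.even_or_odd (z j) with he | ho
    · exact Or.inl (cellMap_apply_even bE bO a x he)
    · exact Or.inr ⟨z j, ho, (hx j).1 ho, cellMap_apply_odd_abs_lt hE hO ha hx ho⟩
  · exact Or.inl (by rw [cellMap_eq_self hE hO ha hx])

theorem contDiff_cellCutoff (hE : IsCutoff (1 - r - 6 * g) (1 - r - 5 * g) bE)
    (hO : IsCutoff (r + g) (r + 2 * g) bO) (P : Finset (Fin m)) :
    ContDiff ℝ ∞ (cellCutoff bE bO P) := by
  refine contDiff_prod fun j _ => ?_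
  have hj : ContDiff ℝ ∞ fun y : E m => y j := contDiff_euclidean.1 contDiff_id j
  split_ifs
  · exact hE.contDiff.comp hj
  · exact hO.contDiff.comp hj

theorem contDiff_cellDisp (hE : IsCutoff (1 - r - 6 * g) (1 - r - 5 * g) bE)
    (hO : IsCutoff (r + g) (r + 2 * g) bO) (P : Finset (Fin m)) :
    ContDiff ℝ ∞ (cellDisp bE bO P) := by
  refine contDiff_euclidean.2 fun j => ?_
  have hj : ContDiff ℝ ∞ fun y : E m => y j := contDiff_euclidean.1 contDiff_id j
  by_cases h : j ∈ P
  · simpa [cellDisp, h] using contDiff_const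
  · simpa [cellDisp, h] using ((contDiff_cellCutoff hE hO P).mul hj).neg

theorem isCompact_closedCube (m : ℕ) (R : ℝ) : IsCompact {y : E m | ∀ j, |y j| ≤ R} := by
  have h : {y : E m | ∀ j, |y j| ≤ R} =
      (EuclideanSpace.equiv (Fin m) ℝ).toHomeomorph ⁻¹' (Set.univ.pi fun _ => Set.Icc (-R) R) := by
    ext y
    simp only [Set.mem_preimage, Set.mem_univ_pi, Set.mem_Icc, abs_le]
    rfl
  rw [h, Homeomorph.isCompact_preimage]
  exact isCompact_univ_pi fun _ => isCompact_Icc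

theorem hasCompactSupport_cellDisp (hE : IsCutoff (1 - r - 6 * g) (1 - r - 5 * g) bE)
    (hO : IsCutoff (r + g) (r + 2 * g) bO) (P : Finset (Fin m)) :
    HasCompactSupport (cellDisp bE bO P) := by
  refine HasCompactSupport.of_support_subset_isCompact
    (isCompact_closedCube m (max (1 - r - 5 * g) (r + 2 * g))) fun y hy j => ?_
  have h : cellCutoff bE bO P y ≠ 0 := by
    intro h0
    refine hy ?_
    ext i
    by_cases hi : i ∈ P <;> simp [cellDisp, h0]
  have hj := abs_lt_of_cellCutoff_ne_zero hE hO h j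
  by_cases hP : j ∈ P
  · exact (hj.1 hP).le.trans (le_max_left _ _)
  · exact (hj.2 hP).le.trans (le_max_right _ _)

theorem contDiff_cellMap (hE : IsCutoff (1 - r - 6 * g) (1 - r - 5 * g) bE)
    (hO : IsCutoff (r + g) (r + 2 * g) bO) (z : Fin m → ℤ) (a : E m) :
    ContDiff ℝ ∞ (cellMap bE bO z a) :=
  contDiff_id.add ((contDiff_cellDisp hE hO _).comp
    ((contDiff_id.add contDiff_const).sub contDiff_const))

theorem norm_iteratedFDeriv_id_le_one {i : ℕ} (hi : 1 ≤ i) (x : E m) :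
    ‖iteratedFDeriv ℝ i (fun y : E m => y) x‖ ≤ 1 := by
  obtain ⟨i, rfl⟩ : ∃ l, i = l + 1 := ⟨i - 1, by omega⟩
  rw [← norm_iteratedFDeriv_fderiv]
  have : fderiv ℝ (fun y : E m => y) = fun _ => ContinuousLinearMap.id ℝ (E m) := by
    funext y; exact fderiv_fun_id
  rw [this]
  rcases Nat.eq_zero_or_pos i with rfl | hi0
  · rw [norm_iteratedFDeriv_zero]
    exact ContinuousLinearMap.norm_id_le
  · rw [iteratedFDeriv_const_of_ne (by omega)]
    simp

/-- The derivatives of the opening maps are bounded uniformly in the cell and the shift. -/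
theorem exists_bound_cellMap (hE : IsCutoff (1 - r - 6 * g) (1 - r - 5 * g) bE)
    (hO : IsCutoff (r + g) (r + 2 * g) bO) (k : ℕ) :
    ∃ D : ℝ, 1 ≤ D ∧ ∀ (z : Fin m → ℤ) (a x : E m) (i : ℕ), 1 ≤ i → i ≤ k →
      ‖iteratedFDeriv ℝ i (cellMap bE bO z a) x‖ ≤ D := by
  choose M hM0 hM using fun P : Finset (Fin m) =>
    exists_bound_iteratedFDeriv (contDiff_cellDisp hE hO P) (hasCompactSupport_cellDisp hE hO P) k
  refine ⟨1 + ∑ P, M P, by linarith [Finset.sum_nonneg fun P (_ : P ∈ Finset.univ) => hM0 P],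
    fun z a x i hi hik => ?_⟩
  have hfun : cellMap bE bO z a = (fun y : E m => y) +
      fun y => cellDisp bE bO (evenDirs z) (y + (a - intPoint z)) := by
    funext y
    simp [cellMap, add_sub_assoc]
  have hc : ContDiff ℝ i fun y => cellDisp bE bO (evenDirs z) (y + (a - intPoint z)) :=
    contDiff_infty.1 ((contDiff_cellDisp hE hO _).comp (contDiff_id.add contDiff_const)) i
  rw [hfun, iteratedFDeriv_add_apply contDiff_fun_id.contDiffAt hc.contDiffAt,
    iteratedFDeriv_comp_add_right]
  refine (norm_add_le _ _).trans (add_le_add (norm_iteratedFDeriv_id_le_one hi x) ?_)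
  exact (hM _ i hik _).trans
    (Finset.single_le_sum (f := M) (fun P _ => hM0 P) (Finset.mem_univ (evenDirs z)))

/-! ### Opening along all cells of one dimension -/

/-- The zones of different cells of the same dimension are disjoint, with some room left. -/
theorem eq_of_mem_enlarged_cellZone (hg : 0 < g) (hr : 0 < r) (hrg : r + 8 * g ≤ 1)
    {z z' : Fin m → ℤ} (hd : gridDim z = gridDim z') {x : E m}
    (h : ∀ j, (Odd (z j) → |x j - z j| < r + 3 * g + g / 2) ∧
      (Even (z j) → |x j - z j| < 1 - r - 4 * g + g / 2))
    (h' : ∀ j, (Odd (z' j) → |x j - z' j| < r + 3 * g + g / 2) ∧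
      (Even (z' j) → |x j - z' j| < 1 - r - 4 * g + g / 2)) : z = z' := by
  have hsub : evenDirs z ⊆ evenDirs z' := by
    intro j hj
    rw [mem_evenDirs] at *
    by_contra ho
    rw [Int.not_even_iff_odd] at ho
    refine not_abs_sub_lt_one ho hj ?_
    have h1 := (h j).2 hj
    have h2 := (h' j).1 ho
    rw [abs_lt] at *
    constructor <;> linarith
  have heq : evenDirs z = evenDirs z' := Finset.eq_of_subset_of_card_le hsub hd.ge
  funext j
  have hiff : Even (z j) ↔ Even (z' j) := by
    rw [← mem_evenDirs, ← mem_evenDirs, heq]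
  rcases Int.even_or_odd (z j) with he | ho
  · have h1 := (h j).2 he
    have h2 := (h' j).2 (hiff.1 he)
    have h3 : |(z j : ℝ) - z' j| < 2 := by
      rw [abs_lt] at *
      constructor <;> linarith
    have h4 : |z j - z' j| < 2 := by exact_mod_cast h3
    rw [abs_lt] at h4
    obtain ⟨b, hb⟩ := he
    obtain ⟨c, hc⟩ := hiff.1 ⟨b, hb⟩
    omega
  · have ho' : Odd (z' j) := by
      rw [← Int.not_even_iff_odd] at *
      rwa [← hiff]
    have h1 := (h j).1 ho
    have h2 := (h' j).1 ho'
    refine int_eq_of_abs_sub_lt_two ho ho' ?_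
    rw [abs_lt] at *
    constructor <;> linarith

theorem eq_of_mem_cellZone (hg : 0 < g) (hr : 0 < r) (hrg : r + 8 * g ≤ 1)
    {z z' : Fin m → ℤ} (hd : gridDim z = gridDim z') {x : E m} (h : x ∈ cellZone r g z)
    (h' : x ∈ cellZone r g z') : z = z' :=
  eq_of_mem_enlarged_cellZone hg hr hrg hd
    (fun j => ⟨fun ho => ((h j).1 ho).trans (by linarith),
      fun he => ((h j).2 he).trans (by linarith)⟩)
    (fun j => ⟨fun ho => ((h' j).1 ho).trans (by linarith),
      fun he => ((h' j).2 he).trans (by linarith)⟩)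

open Classical in
/-- The map which opens along all the cells of `W`, with shifts `a`. -/
noncomputable def stageMap (r g : ℝ) (bE bO : ℝ → ℝ) (W : Set (Fin m → ℤ)) (a : (Fin m → ℤ) → E m)
    (x : E m) : E m :=
  if h : ∃ z ∈ W, x ∈ cellZone r g z then cellMap bE bO h.choose (a h.choose) x else x

variable {W : Set (Fin m → ℤ)} {d : ℕ} {a : (Fin m → ℤ) → E m}

theorem stageMap_eq_cellMap (hg : 0 < g) (hr : 0 < r) (hrg : r + 8 * g ≤ 1)
    (hW : ∀ z ∈ W, gridDim z = d) {z : Fin m → ℤ} (hz : z ∈ W) {x : E m}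
    (hx : x ∈ cellZone r g z) : stageMap r g bE bO W a x = cellMap bE bO z (a z) x := by
  have h : ∃ z ∈ W, x ∈ cellZone r g z := ⟨z, hz, hx⟩
  have hc : h.choose = z := eq_of_mem_cellZone hg hr hrg
    ((hW _ h.choose_spec.1).trans (hW z hz).symm) h.choose_spec.2 hx
  rw [stageMap, dif_pos h, hc]

theorem stageMap_eq_self {x : E m} (hx : ∀ z ∈ W, x ∉ cellZone r g z) :
    stageMap r g bE bO W a x = x := by
  rw [stageMap, dif_neg]
  rintro ⟨z, hz, h⟩
  exact hx z hz h

/-- Locally, the stage map is the opening map of a single cell, or the identity. -/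
theorem stageMap_eventuallyEq (hE : IsCutoff (1 - r - 6 * g) (1 - r - 5 * g) bE)
    (hO : IsCutoff (r + g) (r + 2 * g) bO) (hg : 0 < g) (hr : 0 < r) (hrg : r + 8 * g ≤ 1)
    (hW : ∀ z ∈ W, gridDim z = d) (ha : ∀ z j, |a z j| < g) (x : E m) :
    (∃ z ∈ W, stageMap r g bE bO W a =ᶠ[𝓝 x] cellMap bE bO z (a z)) ∨
      stageMap r g bE bO W a =ᶠ[𝓝 x] fun y => y := by
  have hnear : ∀ᶠ y in 𝓝 x, ∀ j, |y j - x j| < g / 2 := by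
    rw [eventually_all]
    intro j
    have hcont : Continuous fun y : E m => |y j - x j| := by fun_prop
    exact hcont.continuousAt.eventually (gt_mem_nhds (by simpa using hg))
  by_cases hex : ∃ z ∈ W, ∃ y, (∀ j, |y j - x j| < g / 2) ∧ y ∈ cellZone r g z
  · obtain ⟨z, hz, y, hy, hyz⟩ := hex
    refine Or.inl ⟨z, hz, ?_⟩
    have henl : ∀ {w : Fin m → ℤ} {y : E m}, (∀ j, |y j - x j| < g / 2) → y ∈ cellZone r g w →
        ∀ j, (Odd (w j) → |x j - w j| < r + 3 * g + g / 2) ∧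
          (Even (w j) → |x j - w j| < 1 - r - 4 * g + g / 2) := by
      intro w y hy hyw j
      have h1 := hy j
      refine ⟨fun ho => ?_, fun he => ?_⟩
      · have h2 := (hyw j).1 ho
        rw [abs_lt] at *
        constructor <;> linarith
      · have h2 := (hyw j).2 he
        rw [abs_lt] at *
        constructor <;> linarith
    filter_upwards [hnear] with y' hy'
    by_cases hz' : y' ∈ cellZone r g z
    · exact stageMap_eq_cellMap hg hr hrg hW hz hz'
    · rw [cellMap_eq_self hE hO (ha z) hz']
      refine stageMap_eq_self fun w hw hyw => hz' ?_
      rwa [eq_of_mem_enlarged_cellZone hg hr hrg ((hW z hz).trans (hW w hw).symm)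
        (henl hy hyz) (henl hy' hyw)]
  · push Not at hex
    refine Or.inr ?_
    filter_upwards [hnear] with y hy
    exact stageMap_eq_self fun z hz => hex z hz y hy

theorem contDiff_stageMap (hE : IsCutoff (1 - r - 6 * g) (1 - r - 5 * g) bE)
    (hO : IsCutoff (r + g) (r + 2 * g) bO) (hg : 0 < g) (hr : 0 < r) (hrg : r + 8 * g ≤ 1)
    (hW : ∀ z ∈ W, gridDim z = d) (ha : ∀ z j, |a z j| < g) :
    ContDiff ℝ ∞ (stageMap r g bE bO W a) := by
  rw [contDiff_iff_contDiffAt]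
  intro x
  rcases stageMap_eventuallyEq hE hO hg hr hrg hW ha x with ⟨z, _, h⟩ | h
  · exact (contDiff_cellMap hE hO z (a z)).contDiffAt.congr_of_eventuallyEq h
  · exact contDiff_id.contDiffAt.congr_of_eventuallyEq h

theorem norm_iteratedFDeriv_stageMap_le (hE : IsCutoff (1 - r - 6 * g) (1 - r - 5 * g) bE)
    (hO : IsCutoff (r + g) (r + 2 * g) bO) (hg : 0 < g) (hr : 0 < r) (hrg : r + 8 * g ≤ 1)
    (hW : ∀ z ∈ W, gridDim z = d) (ha : ∀ z j, |a z j| < g) {k : ℕ} {D : ℝ} (hD1 : 1 ≤ D)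
    (hD : ∀ (z : Fin m → ℤ) (a x : E m) (i : ℕ), 1 ≤ i → i ≤ k →
      ‖iteratedFDeriv ℝ i (cellMap bE bO z a) x‖ ≤ D) {i : ℕ} (hi : 1 ≤ i) (hik : i ≤ k)
    (x : E m) : ‖iteratedFDeriv ℝ i (stageMap r g bE bO W a) x‖ ≤ D := by
  rcases stageMap_eventuallyEq hE hO hg hr hrg hW ha x with ⟨z, _, h⟩ | h
  · rw [(h.iteratedFDeriv ℝ i).eq_of_nhds]
    exact hD z _ x i hi hik
  · rw [(h.iteratedFDeriv ℝ i).eq_of_nhds]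
    exact (norm_iteratedFDeriv_id_le_one hi x).trans hD1

theorem isNearPreserving_stageMap (hE : IsCutoff (1 - r - 6 * g) (1 - r - 5 * g) bE)
    (hO : IsCutoff (r + g) (r + 2 * g) bO) (hg : 0 < g) (hr : 0 < r) (hrg : r + 8 * g ≤ 1)
    (hW : ∀ z ∈ W, gridDim z = d) (ha : ∀ z j, |a z j| < g) :
    IsNearPreserving (r + 3 * g) (stageMap r g bE bO W a) := by
  intro x j
  by_cases h : ∃ z ∈ W, x ∈ cellZone r g z
  · obtain ⟨z, hz, hx⟩ := h
    rw [stageMap_eq_cellMap hg hr hrg hW hz hx]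
    exact cellMap_isNearPreserving hE hO (ha z) x j
  · push Not at h
    exact Or.inl (by rw [stageMap_eq_self h])

/-- Composition with the stage map opens along the cells of dimension `d`. A point near the
boundary of such a cell is near a face of smaller dimension, where the previous map is already
constant in the normal directions. -/
theorem isOpenedAt_comp_stageMap (hE : IsCutoff (1 - r - 6 * g) (1 - r - 5 * g) bE)
    (hO : IsCutoff (r + g) (r + 2 * g) bO) (hg : 0 < g) (hr : 0 < r) (hrg : r + 8 * g ≤ 1)
    (ha : ∀ z j, |a z j| < g) {V : Set (Fin m → ℤ)}
    (hV : ∀ z ∈ V, ∀ w, IsGridFace w z → w ∈ V) {Φ : E m → E m}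
    (hΦ : ∀ z ∈ V, gridDim z < d → IsOpenedAt (r + 8 * g) z Φ) {z : Fin m → ℤ} (hz : z ∈ V)
    (hzd : gridDim z < d + 1) :
    IsOpenedAt r z (Φ ∘ stageMap r g bE bO {z | z ∈ V ∧ gridDim z = d} a) := by
  have hW : ∀ z ∈ {z | z ∈ V ∧ gridDim z = d}, gridDim z = d := fun z hz => hz.2
  set Ψ := stageMap r g bE bO {z | z ∈ V ∧ gridDim z = d} a with hΨ
  intro y y' hev hod
  by_cases hcase : gridDim z = d ∧ ∀ j, Even (z j) → |y j - z j| ≤ 1 - r - 7 * g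
  · -- both points are in the region where the opening map collapses the normal directions
    obtain ⟨hzd', hcore⟩ := hcase
    have key : ∀ v : E m, (∀ j, Even (z j) → |v j - z j| ≤ 1 - r - 7 * g) →
        (∀ j, Odd (z j) → |v j - z j| ≤ r) → Ψ v = cellMap bE bO z (a z) v ∧
        ∀ j, Odd (z j) → cellMap bE bO z (a z) v j = z j - a z j := by
      intro v hv1 hv2
      have hmem : v ∈ cellZone r g z := fun j =>
        ⟨fun ho => (hv2 j ho).trans_lt (by linarith),
          fun he => (hv1 j he).trans_lt (by linarith)⟩
      refine ⟨stageMap_eq_cellMap hg hr hrg hW ⟨hz, hzd'⟩ hmem, fun j hj => ?_⟩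
      rw [cellMap_apply_odd bE bO _ _ (by simpa using hj), cellCutoff_eq_one hE hO]
      · ring
      · intro i hi
        rw [mem_evenDirs] at hi
        have h1 := hv1 i hi
        have h2 := ha z i
        simp only [intPoint, PiLp.sub_apply, PiLp.add_apply]
        rw [abs_lt] at h2
        rw [abs_le] at *
        constructor <;> linarith
      · intro i hi
        rw [mem_evenDirs, Int.not_even_iff_odd] at hi
        have h1 := hv2 i hi
        have h2 := ha z i
        simp only [intPoint, PiLp.sub_apply, PiLp.add_apply]
        rw [abs_lt] at h2
        rw [abs_le] at *
        constructor <;> linarith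
    have k1 := key y hcore fun j hj => (hod j hj).1
    have k2 := key y' (fun j hj => (hev j hj).1 ▸ hcore j hj) fun j hj => (hod j hj).2
    have : Ψ y = Ψ y' := by
      rw [k1.1, k2.1]
      ext j
      rcases Int.even_or_odd (z j) with he | ho
      · rw [cellMap_apply_even _ _ _ _ he, cellMap_apply_even _ _ _ _ he, (hev j he).1]
      · rw [k1.2 j ho, k2.2 j ho]
    simp only [Function.comp_apply, this]
  · -- the points are close to the face `w`, of dimension less than `d`
    classical
    let w : Fin m → ℤ := fun j =>
      if Even (z j) ∧ 1 - r - 7 * g < |y j - z j| then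
        (if (z j : ℝ) ≤ y j then z j + 1 else z j - 1) else z j
    have hface : IsGridFace w z := by
      intro j
      by_cases h : Even (z j) ∧ 1 - r - 7 * g < |y j - z j|
      · refine Or.inr ⟨h.1, ?_⟩
        simp only [w, if_pos h]
        split_ifs <;> simp
      · exact Or.inl (by simp only [w, if_neg h])
    have hsub : evenDirs w ⊆ evenDirs z := by
      intro j hj
      rw [mem_evenDirs] at *
      by_cases h : Even (z j) ∧ 1 - r - 7 * g < |y j - z j|
      · exact h.1
      · simpa only [w, if_neg h] using hj
    have hdim : gridDim w < d := by
      by_cases hzd' : gridDim z = d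
      · have hno : ¬ ∀ j, Even (z j) → |y j - z j| ≤ 1 - r - 7 * g := fun h => hcase ⟨hzd', h⟩
        push Not at hno
        obtain ⟨j, he, hj⟩ := hno
        rw [← hzd']
        refine Finset.card_lt_card ⟨hsub, fun hsub' => ?_⟩
        have hjw := hsub' (mem_evenDirs.2 he)
        rw [mem_evenDirs] at hjw
        simp only [w, if_pos (And.intro he hj)] at hjw
        obtain ⟨b, hb⟩ := he
        obtain ⟨c, hc⟩ := hjw
        split_ifs at hc <;> omega
      · exact (Finset.card_le_card hsub).trans_lt (by unfold gridDim at *; omega)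
    have hnp : IsNearPreserving (r + 3 * g) Ψ := isNearPreserving_stageMap hE hO hg hr hrg hW ha
    have heven : ∀ v : E m, (∀ j, Even (z j) → v j = y j) → ∀ j, Even (w j) →
        Ψ v j = v j ∧ |v j - w j| ≤ 1 - r - 7 * g ∧ Even (z j) := by
      intro v hv j hj
      have hze : Even (z j) := mem_evenDirs.1 (hsub (mem_evenDirs.2 hj))
      have hno : ¬ (Even (z j) ∧ 1 - r - 7 * g < |y j - z j|) := by
        intro h
        simp only [w, if_pos h] at hj
        obtain ⟨b, hb⟩ := hze
        obtain ⟨c, hc⟩ := hj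
        split_ifs at hc <;> omega
      have hwz : w j = z j := by simp only [w, if_neg hno]
      have hle : |v j - w j| ≤ 1 - r - 7 * g := by
        rw [hwz, hv j hze]
        by_contra h
        exact hno ⟨hze, not_le.1 h⟩
      refine ⟨?_, hle, hze⟩
      rcases hnp v j with h | ⟨n, hn, h1, _⟩
      · exact h
      · refine absurd ?_ (not_abs_sub_lt_one hn hj)
        rw [abs_lt] at *
        rw [abs_le] at hle
        constructor <;> linarith
    have hodd : ∀ v : E m, (∀ j, Even (z j) → v j = y j) → (∀ j, Odd (z j) → |v j - z j| ≤ r) →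
        ∀ j, Odd (w j) → |Ψ v j - w j| ≤ r + 8 * g := by
      intro v hv1 hv2 j hj
      have hvj : |v j - w j| ≤ r + 7 * g := by
        by_cases h : Even (z j) ∧ 1 - r - 7 * g < |y j - z j|
        · have h1 := (hev j h.1).2
          have h2 := h.2
          rw [hv1 j h.1]
          simp only [w, if_pos h]
          split_ifs with hle
          · rw [abs_of_nonneg (by linarith)] at h1 h2
            push_cast
            rw [abs_le]
            constructor <;> linarith
          · rw [abs_of_neg (by linarith)] at h1 h2
            push_cast
            rw [abs_le]
            constructor <;> linarith
        · have hwz : w j = z j := by simp only [w, if_neg h]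
          rw [hwz] at hj ⊢
          exact (hv2 j hj).trans (by linarith)
      rcases hnp v j with h | ⟨n, hn, h1, h2⟩
      · rw [h]; linarith
      · have : n = w j := int_eq_of_abs_sub_lt_two hn hj (by
          rw [abs_lt] at *
          rw [abs_le] at hvj
          constructor <;> linarith)
        rw [← this]
        linarith
    refine hΦ w (hV z hz w hface) hdim (Ψ y) (Ψ y') (fun j hj => ?_) fun j hj => ?_
    · have e1 := heven y (fun _ _ => rfl) j hj
      have e2 := heven y' (fun j h => (hev j h).1.symm) j hj
      rw [e1.1, e2.1]
      exact ⟨(hev j e1.2.2).1, e1.2.1.trans (by linarith)⟩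
    · exact ⟨hodd y (fun _ _ => rfl) (fun j h => (hod j h).1) j hj,
        hodd y' (fun j h => (hev j h).1.symm) (fun j h => (hod j h).2) j hj⟩

end OpeningMap

end CubeOpening

namespace CubeOpening

section Averaging

variable {m : ℕ}

/-! ### Choice of the shifts -/

/-- The average over the shifts `b` of the integral of `w` along `x ↦ φ (x + b) - b` is controlled
by the integral of `w`, whatever the map `φ` is: this only uses the invariance of the Lebesgue
measure under translations. -/
theorem lintegral_lintegral_conj_translate_le {φ : E m → E m} (hφ : Measurable φ)
    {w : E m → ℝ≥0∞} (hw : Measurable w) {A T S : Set (E m)} (hS : MeasurableSet S)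
    (hT : MeasurableSet T) (hTS : ∀ b ∈ A, ∀ x ∈ T, x + b ∈ S) (hA : MeasurableSet A) :
    ∫⁻ b in A, ∫⁻ x in T, w (φ (x + b) - b) ≤ volume S * ∫⁻ x, w x := by
  have h1 : ∀ b ∈ A, ∫⁻ x in T, w (φ (x + b) - b) ≤ ∫⁻ y in S, w (φ y - b) := by
    intro b hb
    rw [← lintegral_indicator hT, ← lintegral_indicator hS,
      ← lintegral_add_right_eq_self (fun y => S.indicator (fun y => w (φ y - b)) y) b]
    refine lintegral_mono fun x => ?_
    by_cases hx : x ∈ T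
    · rw [indicator_of_mem hx, indicator_of_mem (hTS b hb x hx)]
    · rw [indicator_of_notMem hx]
      exact zero_le
  calc ∫⁻ b in A, ∫⁻ x in T, w (φ (x + b) - b)
      ≤ ∫⁻ b in A, ∫⁻ y in S, w (φ y - b) := setLIntegral_mono' hA h1
    _ = ∫⁻ y in S, ∫⁻ b in A, w (φ y - b) := by
        refine lintegral_lintegral_swap (Measurable.aemeasurable ?_)
        exact hw.comp ((hφ.comp measurable_snd).sub measurable_fst)
    _ ≤ ∫⁻ _ in S, ∫⁻ x, w x := by
        refine lintegral_mono fun y => (setLIntegral_le_lintegral _ _).trans_eq ?_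
        exact lintegral_sub_left_eq_self w (φ y)
    _ = volume S * ∫⁻ x, w x := by
        rw [lintegral_const, Measure.restrict_apply_univ, mul_comm]

theorem openCube_eq_iInter (m : ℕ) (r : ℝ) : openCube m r = ⋂ j, {x : E m | |x j| < r} := by
  ext x; simp [openCube]

theorem isOpen_openCube (m : ℕ) (r : ℝ) : IsOpen (openCube m r) := by
  rw [openCube_eq_iInter]
  exact isOpen_iInter_of_finite fun j =>
    isOpen_lt (by fun_prop) continuous_const

theorem volume_openCube_ne_top (m : ℕ) (r : ℝ) : volume (openCube m r) ≠ ⊤ :=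
  ((measure_mono fun _ hx j => (hx j).le).trans_lt (isCompact_closedCube m r).measure_lt_top).ne

theorem volume_openCube_ne_zero (m : ℕ) {r : ℝ} (hr : 0 < r) : volume (openCube m r) ≠ 0 :=
  ((isOpen_openCube m r).measure_pos volume ⟨0, fun j => by simpa using hr⟩).ne'

theorem isOpen_cellZone (r g : ℝ) (z : Fin m → ℤ) : IsOpen (cellZone r g z) := by
  have h : cellZone r g z = ⋂ j, {x : E m | (Odd (z j) → |x j - z j| < r + 3 * g) ∧
      (Even (z j) → |x j - z j| < 1 - r - 4 * g)} := by
    ext x; simp [cellZone]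
  rw [h]
  refine isOpen_iInter_of_finite fun j => ?_
  rcases Int.even_or_odd (z j) with h | h
  · have h' : ¬ Odd (z j) := by simpa using h
    simp only [h, h', false_imp_iff, true_imp_iff, true_and]
    exact isOpen_lt (by fun_prop) continuous_const
  · have h' : ¬ Even (z j) := by simpa using h
    simp only [h, h', false_imp_iff, true_imp_iff, and_true]
    exact isOpen_lt (by fun_prop) continuous_const

/-- A shift for which the opening map at a cell satisfies a finite family of integral estimates. -/
theorem exists_shift {r g : ℝ} {bE bO : ℝ → ℝ}
    (hE : IsCutoff (1 - r - 6 * g) (1 - r - 5 * g) bE) (hO : IsCutoff (r + g) (r + 2 * g) bO)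
    (hg : 0 < g) (hr : 0 < r) (hrg : r + 8 * g ≤ 1) {ι : Type*} [Fintype ι]
    (f : ι → E m → ℝ≥0∞) (hf : ∀ s, Measurable (f s)) (z : Fin m → ℤ) :
    ∃ b ∈ openCube m g, ∀ s, ∫⁻ x in cellZone r g z, f s (cellMap bE bO z b x) ≤
      (volume (openCube m g))⁻¹ * (Fintype.card ι * volume (openCube m 1)) * ∫⁻ x, f s x := by
  let φ : E m → E m := fun y => y + cellDisp bE bO (evenDirs z) (y - intPoint z)
  have hφ : Continuous φ :=
    continuous_id.add ((contDiff_cellDisp hE hO _).continuous.comp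
      (continuous_id.sub continuous_const))
  have hφe : ∀ b x, cellMap bE bO z b x = φ (x + b) - b := fun b x => by
    simp only [cellMap, φ]; abel
  let S : Set (E m) := (fun x => x - intPoint z) ⁻¹' openCube m 1
  have hSm : MeasurableSet S :=
    ((isOpen_openCube m 1).preimage (continuous_id.sub continuous_const)).measurableSet
  have hSv : volume S = volume (openCube m 1) :=
    (measurePreserving_sub_right volume (intPoint z)).measure_preimage
      (isOpen_openCube m 1).measurableSet.nullMeasurableSet
  have hA := (isOpen_openCube m g).measurableSet
  have hTS : ∀ b ∈ openCube m g, ∀ x ∈ cellZone r g z, x + b ∈ S := by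
    intro b hb x hx j
    have h1 := hb j
    have h2 := hx j
    simp only [intPoint, PiLp.sub_apply, PiLp.add_apply]
    rcases Int.even_or_odd (z j) with h | h
    · have h3 := h2.2 h
      rw [abs_lt] at *
      constructor <;> linarith
    · have h3 := h2.1 h
      rw [abs_lt] at *
      constructor <;> linarith
  let I : ι → E m → ℝ≥0∞ := fun s b => ∫⁻ x in cellZone r g z, f s (φ (x + b) - b)
  have hI : ∀ s, Measurable (I s) := fun s =>
    Measurable.lintegral_prod_right' (f := fun q : E m × E m => f s (φ (q.2 + q.1) - q.1))
      ((hf s).comp ((hφ.measurable.comp (measurable_snd.add measurable_fst)).sub measurable_fst))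
  -- dividing by the right-hand sides, all estimates follow from one for the sum of the quotients
  have htot : ∫⁻ b in openCube m g, ∑ s, (∫⁻ x, f s x)⁻¹ * I s b ≤
      Fintype.card ι * volume (openCube m 1) := by
    rw [lintegral_finsetSum _ fun s _ => (hI s).const_mul _]
    have hs : ∀ s ∈ Finset.univ, ∫⁻ b in openCube m g, (∫⁻ x, f s x)⁻¹ * I s b ≤
        volume (openCube m 1) := by
      intro s _
      rw [lintegral_const_mul _ (hI s)]
      refine (mul_le_mul_right (lintegral_lintegral_conj_translate_le hφ.measurable (hf s) hSm
        (isOpen_cellZone r g z).measurableSet hTS hA) _).trans ?_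
      rw [hSv, mul_left_comm]
      exact (mul_le_mul_right (ENNReal.inv_mul_le_one _) _).trans_eq (mul_one _)
    refine (Finset.sum_le_card_nsmul _ _ _ hs).trans_eq ?_
    rw [nsmul_eq_mul, Finset.card_univ]
  obtain ⟨b, hb, hle⟩ := exists_le_setLAverage (μ := volume)
    (f := fun b => ∑ s, (∫⁻ x, f s x)⁻¹ * I s b)
    (volume_openCube_ne_zero m hg) (volume_openCube_ne_top m g)
    (Finset.measurable_fun_sum _ fun s _ => (hI s).const_mul _).aemeasurable
  refine ⟨b, hb, fun s => ?_⟩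
  rw [setLAverage_eq, ENNReal.div_eq_inv_mul] at hle
  have h1 : (∫⁻ x, f s x)⁻¹ * I s b ≤
      (volume (openCube m g))⁻¹ * (Fintype.card ι * volume (openCube m 1)) :=
    (Finset.single_le_sum (f := fun s => (∫⁻ x, f s x)⁻¹ * I s b) (fun _ _ => zero_le)
      (Finset.mem_univ s)).trans (hle.trans (mul_le_mul_right htot _))
  have hfin : (volume (openCube m g))⁻¹ * (Fintype.card ι * volume (openCube m 1)) ≠ ⊤ :=
    ENNReal.mul_ne_top (ENNReal.inv_ne_top.2 (volume_openCube_ne_zero m hg))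
      (ENNReal.mul_ne_top (ENNReal.natCast_ne_top _) (volume_openCube_ne_top m 1))
  have hpos : Fintype.card ι ≠ 0 := (Fintype.card_pos_iff.2 ⟨s⟩).ne'
  have hne : (volume (openCube m g))⁻¹ * (Fintype.card ι * volume (openCube m 1)) ≠ 0 :=
    mul_ne_zero (ENNReal.inv_ne_zero.2 (volume_openCube_ne_top m g))
      (mul_ne_zero (by exact_mod_cast hpos) (volume_openCube_ne_zero m one_pos))
  rw [← ENNReal.div_eq_inv_mul, ENNReal.div_le_iff_le_mul (Or.inr hfin) (Or.inr hne)] at h1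
  simpa only [hφe] using h1

/-- The constant in the integral estimate for one stage of the construction, with `n` functions. -/
noncomputable def stageConst (m : ℕ) (g : ℝ) (n : ℕ) : ℝ≥0∞ :=
  1 + (volume (openCube m g))⁻¹ * ((n * 3 ^ m : ℕ) * volume (openCube m 1))

theorem stageConst_ne_top (m : ℕ) {g : ℝ} (hg : 0 < g) (n : ℕ) : stageConst m g n ≠ ⊤ :=
  ENNReal.add_ne_top.2 ⟨ENNReal.one_ne_top,
    ENNReal.mul_ne_top (ENNReal.inv_ne_top.2 (volume_openCube_ne_zero m hg))
      (ENNReal.mul_ne_top (ENNReal.natCast_ne_top _) (volume_openCube_ne_top m 1))⟩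

/-- The shifts of a stage can be chosen such that composition with the stage map increases the
integral over each box at most by a constant factor. The shift of a cell has to be good for the
finitely many boxes which meet the zone of that cell. -/
theorem exists_shifts_stageMap {r g ρ : ℝ} {bE bO : ℝ → ℝ}
    (hE : IsCutoff (1 - r - 6 * g) (1 - r - 5 * g) bE) (hO : IsCutoff (r + g) (r + 2 * g) bO)
    (hg : 0 < g) (hr : 0 < r) (hrg : r + 8 * g ≤ 2 * ρ) (hρ : ρ < 1 / 2) {ι : Type*} [Fintype ι]
    (f : ι → E m → ℝ≥0∞) (hf : ∀ s, Measurable (f s)) {W : Set (Fin m → ℤ)} {d : ℕ}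
    (hW : ∀ z ∈ W, gridDim z = d) :
    ∃ a : (Fin m → ℤ) → E m, (∀ z j, |a z j| < g) ∧ ∀ s β,
      ∫⁻ x in gridBox ρ β, f s (stageMap r g bE bO W a x) ≤
        stageConst m g (Fintype.card ι) * ∫⁻ x in gridBox ρ β, f s x := by
  have hrg1 : r + 8 * g ≤ 1 := by linarith
  -- The zone of the cell `z` meets at most the `3 ^ m` boxes next to `z`. Each cell contributes the
  -- functions `f s` restricted to these boxes to the family for which its shift is chosen.
  let nbr : (Fin m → ℤ) → (Fin m → Fin 3) → Fin m → ℤ := fun z e j => z j + (e j : ℤ) - 1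
  have hsm : ∀ z β : Fin m → ℤ, MeasurableSet (cellZone r g z ∩ gridBox ρ β) := fun z β =>
    (isOpen_cellZone r g z).measurableSet.inter (measurableSet_gridBox ρ β)
  choose a haA ha using fun z : Fin m → ℤ => exists_shift hE hO hg hr hrg1
    (ι := ι × (Fin m → Fin 3))
    (fun q => (cellZone r g z ∩ gridBox ρ (nbr z q.2)).indicator (f q.1))
    (fun q => (hf q.1).indicator (hsm _ _)) z
  have ha' : ∀ z j, |a z j| < g := fun z j => haA z j
  refine ⟨a, ha', fun s β => ?_⟩
  set Ψ := stageMap r g bE bO W a with hΨ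
  set C₁ : ℝ≥0∞ := (volume (openCube m g))⁻¹ *
    ((Fintype.card ι * 3 ^ m : ℕ) * volume (openCube m 1))
  have hcell : ∀ z ∈ W, ∫⁻ x in gridBox ρ β ∩ cellZone r g z, f s (Ψ x) ≤
      C₁ * ∫⁻ x in gridBox ρ β ∩ cellZone r g z, f s x := by
    intro z hz
    rcases (gridBox ρ β ∩ cellZone r g z).eq_empty_or_nonempty with hemp | ⟨x₀, hx₀β, hx₀z⟩
    · simp [hemp]
    obtain ⟨e, rfl⟩ : ∃ e, nbr z e = β := by
      have hnear : ∀ j, |β j - z j| ≤ 1 := by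
        intro j
        have h1 : |x₀ j - β j| ≤ 1 := by
          rcases Int.even_or_odd (β j) with h | h
          · exact ((hx₀β j).2 h).trans (by linarith)
          · exact ((hx₀β j).1 h).le.trans (by linarith)
        have h2 : |x₀ j - z j| < 1 := by
          rcases Int.even_or_odd (z j) with h | h
          · exact ((hx₀z j).2 h).trans (by linarith)
          · exact ((hx₀z j).1 h).trans (by linarith)
        have h3 : |(β j : ℝ) - z j| < 2 := by
          rw [abs_le] at h1
          rw [abs_lt] at *
          constructor <;> linarith
        have h4 : |β j - z j| < 2 := by exact_mod_cast h3
        omega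
      refine ⟨fun j => ⟨(β j - z j + 1).toNat, ?_⟩, ?_⟩
      · have := abs_le.1 (hnear j)
        omega
      · funext j
        have := abs_le.1 (hnear j)
        simp only [nbr]
        omega
    have h1 := ha z (s, e)
    simp only [Fintype.card_prod, Fintype.card_fun, Fintype.card_fin] at h1
    rw [lintegral_indicator (hsm _ _)] at h1
    rw [inter_comm]
    refine le_trans ?_ h1
    rw [← lintegral_indicator (hsm _ _),
      ← lintegral_indicator (isOpen_cellZone r g z).measurableSet]
    refine lintegral_mono fun x => ?_
    by_cases hx : x ∈ cellZone r g z ∩ gridBox ρ (nbr z e)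
    · have hmem : cellMap bE bO z (a z) x ∈ cellZone r g z ∩ gridBox ρ (nbr z e) :=
        ⟨cellMap_mem_cellZone hE hO (ha' z) hx.1,
          (cellMap_isNearPreserving hE hO (ha' z)).mem_gridBox (by linarith) hρ hx.2⟩
      rw [indicator_of_mem hx, indicator_of_mem hx.1, indicator_of_mem hmem, hΨ,
        stageMap_eq_cellMap hg hr hrg1 hW hz hx.1]
    · rw [indicator_of_notMem hx]
      exact zero_le
  set Z : Set (E m) := ⋃ z : W, cellZone r g z.1 with hZ
  have hZm : MeasurableSet Z :=
    MeasurableSet.iUnion fun z => (isOpen_cellZone r g z.1).measurableSet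
  have hsplit : ∀ h : E m → ℝ≥0∞, ∫⁻ x in gridBox ρ β ∩ Z, h x =
      ∑' z : W, ∫⁻ x in gridBox ρ β ∩ cellZone r g z.1, h x := by
    intro h
    rw [hZ, inter_iUnion, lintegral_iUnion
      (fun z : W => (measurableSet_gridBox ρ β).inter (isOpen_cellZone r g z.1).measurableSet)]
    intro z z' hne
    refine Set.disjoint_left.2 fun x hx hx' => hne (Subtype.ext ?_)
    exact eq_of_mem_cellZone hg hr hrg1 ((hW _ z.2).trans (hW _ z'.2).symm) hx.2 hx'.2
  have hin : ∫⁻ x in gridBox ρ β ∩ Z, f s (Ψ x) ≤ C₁ * ∫⁻ x in gridBox ρ β, f s x := by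
    rw [hsplit]
    calc ∑' z : W, ∫⁻ x in gridBox ρ β ∩ cellZone r g z.1, f s (Ψ x)
        ≤ ∑' z : W, C₁ * ∫⁻ x in gridBox ρ β ∩ cellZone r g z.1, f s x :=
          ENNReal.tsum_le_tsum fun z => hcell z.1 z.2
      _ = C₁ * ∫⁻ x in gridBox ρ β ∩ Z, f s x := by rw [ENNReal.tsum_mul_left, hsplit]
      _ ≤ C₁ * ∫⁻ x in gridBox ρ β, f s x :=
          mul_le_mul_right (lintegral_mono_set inter_subset_left) _
  have hout : ∫⁻ x in gridBox ρ β \ Z, f s (Ψ x) ≤ ∫⁻ x in gridBox ρ β, f s x := by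
    have : ∫⁻ x in gridBox ρ β \ Z, f s (Ψ x) = ∫⁻ x in gridBox ρ β \ Z, f s x := by
      refine setLIntegral_congr_fun ((measurableSet_gridBox ρ β).diff hZm) fun x hx => ?_
      have : Ψ x = x := stageMap_eq_self fun z hz hxz => hx.2 (mem_iUnion.2 ⟨⟨z, hz⟩, hxz⟩)
      simp only [this]
    rw [this]
    exact lintegral_mono_set sdiff_subset
  rw [← lintegral_inter_add_sdiff _ (gridBox ρ β) hZm, add_comm, stageConst, add_mul, one_mul]
  exact add_le_add hout hin

/-! ### Opening along all cells -/

/-- The opening map in the unit grid, after the stages of dimension less than `d`. The radii of the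
opened neighbourhoods decrease by `8 * g` in each stage. -/
theorem exists_openingMap_aux {ρ g : ℝ} (hg : 0 < g) (hρ : ρ < 1 / 2) (k d : ℕ)
    (hd : 0 < 2 * ρ - d * (8 * g)) {ι : Type*} [Fintype ι] :
    ∃ (C : ℝ≥0∞) (D : ℝ), C ≠ ⊤ ∧ 1 ≤ D ∧ ∀ V : Set (Fin m → ℤ),
      (∀ z ∈ V, ∀ w, IsGridFace w z → w ∈ V) → ∀ f : ι → E m → ℝ≥0∞, (∀ s, Measurable (f s)) →
      ∃ Φ : E m → E m, ContDiff ℝ ∞ Φ ∧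
        (∀ i, 1 ≤ i → i ≤ k → ∀ x, ‖iteratedFDeriv ℝ i Φ x‖ ≤ D) ∧
        IsNearPreserving (2 * ρ - 5 * g) Φ ∧
        (∀ x, Φ x ≠ x → ∃ z ∈ V, x ∈ gridNhd (2 * ρ - 5 * g) z) ∧
        (∀ z ∈ V, gridDim z < d → IsOpenedAt (2 * ρ - d * (8 * g)) z Φ) ∧
        ∀ s β, ∫⁻ x in gridBox ρ β, f s (Φ x) ≤ C * ∫⁻ x in gridBox ρ β, f s x := by
  induction d with
  | zero =>
    refine ⟨1, 1, ENNReal.one_ne_top, le_rfl, fun V _ f _ => ⟨fun x => x, contDiff_id,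
      fun i hi _ x => norm_iteratedFDeriv_id_le_one hi x, fun x j => Or.inl rfl,
      fun x hx => absurd rfl hx, fun z _ hz => absurd hz (by omega), fun s β => by simp⟩⟩
  | succ d ih =>
    push_cast at hd
    have hd0 : (0 : ℝ) ≤ d * (8 * g) := by positivity
    obtain ⟨C, D, hC, hD, hV⟩ := ih (by linarith)
    set r := 2 * ρ - (d + 1 : ℕ) * (8 * g) with hr
    push_cast at hr
    have hr0 : 0 < r := by rw [hr]; linarith
    have hrd : r + 8 * g = 2 * ρ - d * (8 * g) := by rw [hr]; ring
    have hrg : r + 8 * g ≤ 2 * ρ := by linarith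
    obtain ⟨bE, hE⟩ := exists_isCutoff (A := 1 - r - 6 * g) (B := 1 - r - 5 * g)
      (by linarith) (by linarith)
    obtain ⟨bO, hO⟩ := exists_isCutoff (A := r + g) (B := r + 2 * g) (by linarith) (by linarith)
    obtain ⟨D', hD', hcell⟩ := exists_bound_cellMap (m := m) hE hO k
    have hpow : (1 : ℝ) ≤ D' ^ k := one_le_pow₀ hD'
    have hfac : (1 : ℝ) ≤ k.factorial := by
      exact_mod_cast Nat.one_le_iff_ne_zero.2 k.factorial_ne_zero
    refine ⟨stageConst m g (Fintype.card ι) * C, max 1 (k.factorial * (k * D) * D' ^ k),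
      ENNReal.mul_ne_top (stageConst_ne_top m hg _) hC, le_max_left _ _, fun V hVf f hf => ?_⟩
    obtain ⟨Φ, hΦs, hΦD, hΦn, hΦsupp, hΦo, hΦi⟩ := hV V hVf f hf
    have hW : ∀ z ∈ {z | z ∈ V ∧ gridDim z = d}, gridDim z = d := fun z hz => hz.2
    obtain ⟨a, ha, hai⟩ := exists_shifts_stageMap hE hO hg hr0 hrg hρ
      (fun s x => f s (Φ x)) (fun s => (hf s).comp hΦs.continuous.measurable) hW
    have hrg1 : r + 8 * g ≤ 1 := by linarith
    have hΨs := contDiff_stageMap hE hO hg hr0 hrg1 hW ha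
    have hΨn := isNearPreserving_stageMap hE hO hg hr0 hrg1 hW ha
    refine ⟨Φ ∘ stageMap r g bE bO {z | z ∈ V ∧ gridDim z = d} a, hΦs.comp hΨs, ?_, ?_, ?_, ?_, ?_⟩
    · intro i hi hik x
      exact (norm_iteratedFDeriv_comp_le_of_bound hΦs hΨs hD hD' hΦD
        (fun i hi hik x =>
          norm_iteratedFDeriv_stageMap_le hE hO hg hr0 hrg1 hW ha hD' hcell hi hik x)
        hi hik x).trans (le_max_right _ _)
    · exact hΦn.comp (by linarith) (hΨn.mono (by linarith))
    · intro x hx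
      by_cases h : ∃ z ∈ {z | z ∈ V ∧ gridDim z = d}, x ∈ cellZone r g z
      · obtain ⟨z, hz, hxz⟩ := h
        exact ⟨z, hz.1, fun j => ⟨fun ho => ((hxz j).1 ho).trans_le (by linarith),
          fun he => ((hxz j).2 he).trans_le (by linarith)⟩⟩
      · push Not at h
        refine hΦsupp x fun h' => hx ?_
        rw [Function.comp_apply, stageMap_eq_self h, h']
    · intro z hz hzd
      exact isOpenedAt_comp_stageMap hE hO hg hr0 hrg1 ha hVf
        (fun z hz hzd => by rw [hrd]; exact hΦo z hz hzd) hz hzd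
    · intro s β
      refine (hai s β).trans ?_
      rw [mul_assoc]
      exact mul_le_mul_right (hΦi s β) _

/-- The opening map in the unit grid. -/
theorem exists_openingMap (hm : 0 < m) {ρ : ℝ} (hρ0 : 0 < ρ) (hρ : ρ < 1 / 2) (k : ℕ)
    {ι : Type*} [Fintype ι] :
    ∃ (C : ℝ≥0∞) (D r : ℝ), C ≠ ⊤ ∧ 1 ≤ D ∧ r < 2 * ρ ∧ ∀ V : Set (Fin m → ℤ),
      (∀ z ∈ V, ∀ w, IsGridFace w z → w ∈ V) → ∀ f : ι → E m → ℝ≥0∞, (∀ s, Measurable (f s)) →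
      ∃ Φ : E m → E m, ContDiff ℝ ∞ Φ ∧
        (∀ i, 1 ≤ i → i ≤ k → ∀ x, ‖iteratedFDeriv ℝ i Φ x‖ ≤ D) ∧
        IsNearPreserving (2 * ρ) Φ ∧
        (∀ x, Φ x ≠ x → ∃ z ∈ V, x ∈ gridNhd r z) ∧
        (∀ z ∈ V, gridDim z < m → IsOpenedAt ρ z Φ) ∧
        ∀ s β, ∫⁻ x in gridBox ρ β, f s (Φ x) ≤ C * ∫⁻ x in gridBox ρ β, f s x := by
  have hm' : (0 : ℝ) < m := by exact_mod_cast hm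
  -- Each of the `m` stages costs `8 * g`, and the radius may decrease from `2 * ρ` to `ρ`.
  set g : ℝ := ρ / (8 * m) with hgdef
  have hg : 0 < g := by positivity
  have he : 2 * ρ - m * (8 * g) = ρ := by
    rw [hgdef]; field_simp; ring
  obtain ⟨C, D, hC, hD, h⟩ :=
    exists_openingMap_aux (m := m) (ι := ι) hg hρ k m (by rw [he]; exact hρ0)
  refine ⟨C, D, 2 * ρ - 5 * g, hC, hD, by linarith, fun V hV f hf => ?_⟩
  obtain ⟨Φ, h1, h2, h3, h4, h5, h6⟩ := h V hV f hf
  rw [he] at h5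
  exact ⟨Φ, h1, h2, h3.mono (by linarith), h4, h5, h6⟩

end Averaging

end CubeOpening

namespace CubeOpening

section Cubication

variable {m : ℕ} {η : ℝ} {S : Set (Cell m)}

/-! ### Cubications are grids -/

theorem IsCubication.dirs_eq {A : Set (E m)} (hS : IsCubication η S A) {σ : Cell m} (hσ : σ ∈ S) :
    σ.dirs = Finset.univ := by
  have h := hS.dim_eq σ hσ
  exact (Finset.card_eq_iff_eq_univ _).1 (by simpa [Cell.dim] using h)

/-- The centers of two cubes of a cubication which meet differ by multiples of the side length. -/
theorem IsCubication.center_sub {A : Set (E m)} (hη : 0 < η) (hS : IsCubication η S A)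
    {σ τ : Cell m} (hσ : σ ∈ S) (hτ : τ ∈ S)
    (h : ∀ j, |σ.center j - τ.center j| ≤ 2 * η) (j : Fin m) :
    σ.center j - τ.center j = 0 ∨ σ.center j - τ.center j = 2 * η ∨
      σ.center j - τ.center j = -(2 * η) := by
  have hne : (σ.carrier η ∩ τ.carrier η).Nonempty := by
    refine ⟨WithLp.toLp 2 fun i => (σ.center i + τ.center i) / 2, ⟨fun i _ => ?_, fun i hi => ?_⟩,
      fun i _ => ?_, fun i hi => ?_⟩
    · have := abs_le.1 (h i)
      rw [abs_le]
      constructor <;> simp only <;> linarith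
    · exact absurd (Finset.mem_univ i) (hS.dirs_eq hσ ▸ hi)
    · have := abs_le.1 (h i)
      rw [abs_le]
      constructor <;> simp only <;> linarith
    · exact absurd (Finset.mem_univ i) (hS.dirs_eq hτ ▸ hi)
  obtain ⟨ξ, ⟨-, h1, h1'⟩, ⟨-, h2, h2'⟩, -⟩ := hS.inter_face σ hσ τ hτ hne
  by_cases hj : j ∈ ξ.dirs
  · left
    rw [← h1' j (by simp [hj]), ← h2' j (by simp [hj])]
    simp
  · have e1 := h1 j (by simp [hj, hS.dirs_eq hσ])
    have e2 := h2 j (by simp [hj, hS.dirs_eq hτ])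
    rw [abs_eq hη.le] at e1 e2
    rcases e1 with e1 | e1 <;> rcases e2 with e2 | e2
    · left; linarith
    · right; right; linarith
    · right; left; linarith
    · left; linarith

/-- A cubication of the space contains the neighbours of each of its cubes. Otherwise, the points
just beyond the common facet would be covered by cubes which do not meet the given cube, and two of
these would be shifted against each other by less than the side length. -/
theorem IsCubication.exists_neighbour (hη : 0 < η) (hS : IsCubication η S univ) {σ : Cell m}
    (hσ : σ ∈ S) (j : Fin m) {s : ℝ} (hs : s = 1 ∨ s = -1) :
    ∃ τ ∈ S, τ.center j = σ.center j + s * (2 * η) ∧ ∀ i ≠ j, τ.center i = σ.center i := by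
  have hss : s * s = 1 := by rcases hs with rfl | rfl <;> norm_num
  have habs : ∀ t : ℝ, |t| = |s * t| := fun t => by
    rcases hs with rfl | rfl <;> simp
  by_contra hno
  have hcov : ∀ t, 0 < t → t ≤ η → ∃ τ ∈ S, (∀ i ≠ j, |τ.center i - σ.center i| ≤ η) ∧
      0 < s * (τ.center j - σ.center j) - 2 * η ∧
      s * (τ.center j - σ.center j) - 2 * η ≤ t := by
    intro t ht htη
    -- the point at distance `t` beyond the middle of the facet
    have hx : (WithLp.toLp 2 fun i =>
        if i = j then σ.center i + s * (η + t) else σ.center i : E m) ∈ cellUnion η S := by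
      rw [hS.union_eq]; exact mem_univ _
    simp only [cellUnion, mem_iUnion] at hx
    obtain ⟨τ, hτ, hmem, -⟩ := hx
    have hτd := hS.dirs_eq hτ
    have hi : ∀ i ≠ j, |τ.center i - σ.center i| ≤ η := by
      intro i hij
      have := hmem i (by simp [hτd])
      simp only [if_neg hij] at this
      rwa [abs_sub_comm]
    have hj := hmem j (by simp [hτd])
    simp only [if_true] at hj
    rw [habs, abs_le] at hj
    have hexp : s * (σ.center j + s * (η + t) - τ.center j) =
        (η + t) - s * (τ.center j - σ.center j) := by
      linear_combination (η + t) * hss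
    rw [hexp] at hj
    refine ⟨τ, hτ, hi, ?_, by linarith⟩
    by_contra hle
    rw [not_lt] at hle
    have hmeet : ∀ i, |τ.center i - σ.center i| ≤ 2 * η := by
      intro i
      by_cases hij : i = j
      · subst hij
        rw [habs, abs_le]
        constructor <;> linarith
      · exact (hi i hij).trans (by linarith)
    refine hno ⟨τ, hτ, ?_, fun i hij => ?_⟩
    · have hpos : 0 < s * (τ.center j - σ.center j) := by linarith
      have hsj : τ.center j - σ.center j = s * (2 * η) := by
        rcases hS.center_sub hη hτ hσ hmeet j with h | h | h <;> rw [h] at hpos ⊢ <;>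
          rcases hs with rfl | rfl <;> linarith
      linarith
    · have h1 := abs_le.1 (hi i hij)
      rcases hS.center_sub hη hτ hσ hmeet i with h | h | h <;> linarith
  obtain ⟨τ₁, hτ₁, hi₁, hpos₁, hle₁⟩ := hcov η hη le_rfl
  obtain ⟨τ₂, hτ₂, hi₂, hpos₂, hle₂⟩ := hcov ((s * (τ₁.center j - σ.center j) - 2 * η) / 2)
    (by linarith) (by linarith)
  have hsplit : s * (τ₁.center j - τ₂.center j) =
      s * (τ₁.center j - σ.center j) - s * (τ₂.center j - σ.center j) := by ring
  have hmeet : ∀ i, |τ₁.center i - τ₂.center i| ≤ 2 * η := by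
    intro i
    by_cases hij : i = j
    · subst hij
      rw [habs, hsplit, abs_le]
      constructor <;> linarith
    · have h1 := abs_le.1 (hi₁ i hij)
      have h2 := abs_le.1 (hi₂ i hij)
      rw [abs_le]
      constructor <;> linarith
  have hpos : 0 < s * (τ₁.center j - τ₂.center j) := by rw [hsplit]; linarith
  have hlt : s * (τ₁.center j - τ₂.center j) < 2 * η := by rw [hsplit]; linarith
  rcases hS.center_sub hη hτ₁ hτ₂ hmeet j with h | h | h <;> rw [h] at hpos hlt <;>
    rcases hs with rfl | rfl <;> linarith

/-- The centers of the cubes of a cubication of the space form a lattice. -/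
theorem IsCubication.exists_origin (hη : 0 < η) (hS : IsCubication η S univ) :
    ∃ o : E m, ∀ σ ∈ S, ∃ n : Fin m → ℤ, ∀ j, σ.center j = o j + η * (2 * n j : ℤ) := by
  obtain ⟨σ₀, hσ₀⟩ : S.Nonempty := by
    have hx : (0 : E m) ∈ cellUnion η S := by rw [hS.union_eq]; exact mem_univ _
    simp only [cellUnion, mem_iUnion] at hx
    obtain ⟨τ, hτ, -⟩ := hx
    exact ⟨τ, hτ⟩
  set G : Set (Fin m → ℤ) :=
    {n | ∃ τ ∈ S, ∀ j, τ.center j = σ₀.center j + η * (2 * n j : ℤ)}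
  have hstep : ∀ n ∈ G, ∀ j, ∀ e : ℤ, e = 1 ∨ e = -1 → Function.update n j (n j + e) ∈ G := by
    rintro n ⟨τ, hτ, hn⟩ j e he
    have he' : (e : ℝ) = 1 ∨ (e : ℝ) = -1 := by
      rcases he with rfl | rfl <;> simp
    obtain ⟨ξ, hξ, hj, hi⟩ := hS.exists_neighbour hη hτ j he'
    refine ⟨ξ, hξ, fun i => ?_⟩
    by_cases hij : i = j
    · subst hij
      rw [hj, hn, Function.update_self]
      push_cast
      ring
    · rw [hi i hij, hn, Function.update_of_ne hij]
  have hshift : ∀ n ∈ G, ∀ j (c : ℤ), Function.update n j c ∈ G := by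
    intro n hn j c
    have hd : ∀ d : ℤ, Function.update n j (n j + d) ∈ G := by
      intro d
      induction d using Int.induction_on with
      | zero => simpa using hn
      | succ i ih =>
        have := hstep _ ih j 1 (Or.inl rfl)
        rwa [Function.update_idem, Function.update_self, add_assoc] at this
      | pred i ih =>
        have := hstep _ ih j (-1) (Or.inr rfl)
        rwa [Function.update_idem, Function.update_self, add_assoc] at this
    simpa using hd (c - n j)
  have hall : ∀ n : Fin m → ℤ, n ∈ G := by
    intro n
    have h : ∀ A : Finset (Fin m), (fun j => if j ∈ A then n j else 0) ∈ G := by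
      intro A
      induction A using Finset.induction_on with
      | empty => exact ⟨σ₀, hσ₀, fun j => by simp⟩
      | insert a A ha ih =>
        convert hshift _ ih a (n a) using 1
        funext j
        by_cases hj : j = a
        · subst hj; simp
        · simp [hj]
    simpa using h Finset.univ
  -- Every lattice point is a center. A further cube would meet, and thus coincide with, the cube
  -- at the lattice point closest to its center.
  refine ⟨σ₀.center, fun σ hσ => ?_⟩
  obtain ⟨τ, hτ, hτn⟩ := hall fun j => round ((σ.center j - σ₀.center j) / (2 * η))
  have hclose : ∀ j, |σ.center j - τ.center j| ≤ η := by
    intro j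
    have h1 := abs_sub_round ((σ.center j - σ₀.center j) / (2 * η))
    have h2 : σ.center j - τ.center j = 2 * η * ((σ.center j - σ₀.center j) / (2 * η) -
        round ((σ.center j - σ₀.center j) / (2 * η))) := by
      rw [hτn]; push_cast; field_simp; ring
    rw [h2, abs_mul, abs_of_pos (by linarith)]
    nlinarith
  refine ⟨fun j => round ((σ.center j - σ₀.center j) / (2 * η)),
    fun j => Eq.trans (?_ : σ.center j = τ.center j) (hτn j)⟩
  have h1 := abs_le.1 (hclose j)
  rcases hS.center_sub hη hσ hτ (fun j => (hclose j).trans (by linarith)) j with h | h | h <;>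
    linarith

/-! ### Cells as grid cells -/

/-- The cell `σ` of radius `η` corresponds to the cell `z` of the unit grid, when the origin of the
grid is put at `o`. -/
def Cell.IsGridCell (o : E m) (η : ℝ) (σ : Cell m) (z : Fin m → ℤ) : Prop :=
  σ.dirs = evenDirs z ∧ ∀ j, σ.center j = o j + η * z j

theorem Cell.IsGridCell.exists_face {o : E m} (hη : 0 < η) {σ τ : Cell m} {z : Fin m → ℤ}
    (hσ : σ.IsGridCell o η z) (hτ : τ.IsFace η σ) : ∃ w, IsGridFace w z ∧ τ.IsGridCell o η w := by
  obtain ⟨hsub, h1, h2⟩ := hτ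
  have h : ∀ j, ∃ c : ℤ, (c = z j ∨ Even (z j) ∧ |c - z j| = 1) ∧ (j ∈ τ.dirs ↔ Even c) ∧
      τ.center j = o j + η * c := by
    intro j
    have hjz : j ∈ σ.dirs ↔ Even (z j) := by rw [hσ.1, mem_evenDirs]
    by_cases hj : j ∈ σ.dirs \ τ.dirs
    · have hj' := Finset.mem_sdiff.1 hj
      have he := hjz.1 hj'.1
      have e := h1 j hj
      rw [abs_eq hη.le, hσ.2 j] at e
      rcases e with e | e
      · refine ⟨z j + 1, Or.inr ⟨he, by simp⟩, ⟨fun h => absurd h hj'.2, fun h => ?_⟩, ?_⟩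
        · exact absurd h (by simpa [parity_simps] using he)
        · push_cast; linarith
      · refine ⟨z j - 1, Or.inr ⟨he, by simp⟩, ⟨fun h => absurd h hj'.2, fun h => ?_⟩, ?_⟩
        · exact absurd h (by simpa [parity_simps] using he)
        · push_cast; linarith
    · refine ⟨z j, Or.inl rfl, ?_, by rw [h2 j hj, hσ.2 j]⟩
      rw [← hjz]
      refine ⟨fun h => hsub h, fun h => ?_⟩
      by_contra hn
      exact hj (Finset.mem_sdiff.2 ⟨h, hn⟩)
  choose w hw1 hw2 hw3 using h
  refine ⟨w, hw1, ?_, hw3⟩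
  ext j
  rw [hw2, mem_evenDirs]

theorem IsSubskeleton.exists_isGridCell (hη : 0 < η) {ℓ : ℕ} {U : Set (Cell m)}
    (hU : IsSubskeleton η ℓ U) :
    ∃ o : E m, ∀ σ ∈ U, ∃ z, σ.IsGridCell o η z ∧ gridDim z = ℓ := by
  obtain ⟨S, hS, hUS⟩ := hU
  obtain ⟨o, ho⟩ := hS.exists_origin hη
  refine ⟨o, fun σ hσ => ?_⟩
  obtain ⟨hdim, Q, hQ, hface⟩ := hUS hσ
  obtain ⟨n, hn⟩ := ho Q hQ
  have hQg : Q.IsGridCell o η fun j => 2 * n j :=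
    ⟨by rw [hS.dirs_eq hQ]; ext j; simp [mem_evenDirs], hn⟩
  obtain ⟨z, -, hz⟩ := hQg.exists_face hη hface
  exact ⟨z, hz, by rw [gridDim, ← hz.1]; exact hdim⟩

theorem IsGridFace.trans {x w z : Fin m → ℤ} (h1 : IsGridFace x w) (h2 : IsGridFace w z) :
    IsGridFace x z := by
  intro j
  rcases h2 j with h | ⟨he, h⟩
  · rw [← h]; exact h1 j
  · rcases h1 j with h' | ⟨he', -⟩
    · rw [h']; exact Or.inr ⟨he, h⟩
    · obtain ⟨a, ha⟩ := he
      obtain ⟨b, hb⟩ := he'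
      rw [abs_eq zero_le_one] at h
      omega

theorem IsGridFace.evenDirs_subset {w z : Fin m → ℤ} (h : IsGridFace w z) :
    evenDirs w ⊆ evenDirs z := by
  intro j hj
  rw [mem_evenDirs] at *
  rcases h j with h | ⟨he, -⟩
  · rwa [← h]
  · exact he

theorem IsGridFace.gridDim_le {w z : Fin m → ℤ} (h : IsGridFace w z) : gridDim w ≤ gridDim z :=
  Finset.card_le_card h.evenDirs_subset

theorem IsGridFace.gridNhd_subset {w z : Fin m → ℤ} (h : IsGridFace w z) (r : ℝ) :
    gridNhd r w ⊆ gridNhd r z := by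
  intro x hx j
  rcases h j with h | ⟨he, h⟩
  · rw [← h]; exact hx j
  · refine ⟨fun ho => absurd he (by simpa using ho), fun _ => ?_⟩
    have ho : Odd (w j) := by
      rw [abs_eq zero_le_one] at h
      obtain ⟨a, ha⟩ := he
      rcases h with h | h
      · exact ⟨a, by omega⟩
      · exact ⟨a - 1, by omega⟩
    have h1 := (hx j).1 ho
    have h2 : |(w j : ℝ) - z j| = 1 := by exact_mod_cast h
    have h3 := abs_sub_le (x j) (w j) (z j)
    linarith

theorem gridBox_subset_gridNhd {ρ : ℝ} (h0 : 0 < ρ) (hρ : ρ < 1 / 2) {z β : Fin m → ℤ}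
    (h : (gridBox ρ β ∩ gridNhd (2 * ρ) z).Nonempty) : gridBox ρ β ⊆ gridNhd (2 * ρ) z := by
  obtain ⟨x, hxβ, hxz⟩ := h
  intro y hy j
  rcases Int.even_or_odd (β j) with hβ | hβ
  · have h1 := (hxβ j).2 hβ
    have hy1 := (hy j).2 hβ
    refine ⟨fun ho => ?_, fun he => ?_⟩
    · have h2 := (hxz j).1 ho
      refine absurd ?_ (not_abs_sub_lt_one ho hβ)
      rw [abs_lt] at *
      rw [abs_le] at h1
      constructor <;> linarith
    · have h2 := (hxz j).2 he
      have h3 : |(β j : ℝ) - z j| < 2 := by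
        rw [abs_lt] at *
        rw [abs_le] at h1
        constructor <;> linarith
      have h4 : |β j - z j| < 2 := by exact_mod_cast h3
      have h5 : β j = z j := by
        rw [abs_lt] at h4
        obtain ⟨a, ha⟩ := he
        obtain ⟨b, hb⟩ := hβ
        omega
      rw [← h5]
      linarith
  · have h1 := (hxβ j).1 hβ
    have hy1 := (hy j).1 hβ
    refine ⟨fun ho => ?_, fun he => ?_⟩
    · have h2 := (hxz j).1 ho
      have : β j = z j := int_eq_of_abs_sub_lt_two hβ ho (by
        rw [abs_lt] at *
        constructor <;> linarith)
      rwa [← this]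
    · have h2 := (hxz j).2 he
      have h3 : |(β j : ℝ) - z j| < 3 := by
        rw [abs_lt] at *
        constructor <;> linarith
      have h4 : |β j - z j| < 3 := by exact_mod_cast h3
      have h5 : |β j - z j| = 1 := by
        rw [abs_lt] at h4
        obtain ⟨a, ha⟩ := he
        obtain ⟨b, hb⟩ := hβ
        rw [abs_eq zero_le_one]
        omega
      have h6 : |(β j : ℝ) - z j| = 1 := by exact_mod_cast h5
      have h7 := abs_sub_le (y j) (β j) (z j)
      linarith

theorem isOpen_gridNhd (r : ℝ) (z : Fin m → ℤ) : IsOpen (gridNhd r z) := by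
  have h : gridNhd r z = ⋂ j, {x : E m | (Odd (z j) → |x j - z j| < r) ∧
      (Even (z j) → |x j - z j| < 1 + r)} := by
    ext x; simp [gridNhd]
  rw [h]
  refine isOpen_iInter_of_finite fun j => ?_
  rcases Int.even_or_odd (z j) with h | h
  · have h' : ¬ Odd (z j) := by simpa using h
    simp only [h, h', false_imp_iff, true_imp_iff, true_and]
    exact isOpen_lt (by fun_prop) continuous_const
  · have h' : ¬ Even (z j) := by simpa using h
    simp only [h, h', false_imp_iff, true_imp_iff, and_true]
    exact isOpen_lt (by fun_prop) continuous_const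

/-- The change of coordinates which turns cells of radius `η` into cells of the unit grid. -/
noncomputable def toGrid (o : E m) (η : ℝ) (x : E m) : E m := η⁻¹ • (x - o)

/-- The inverse of `toGrid`. -/
def ofGrid (o : E m) (η : ℝ) (y : E m) : E m := o + η • y

theorem toGrid_ofGrid (o : E m) (hη : 0 < η) (y : E m) : toGrid o η (ofGrid o η y) = y := by
  simp [toGrid, ofGrid, smul_smul, inv_mul_cancel₀ hη.ne']

theorem ofGrid_toGrid (o : E m) (hη : 0 < η) (x : E m) : ofGrid o η (toGrid o η x) = x := by
  simp [toGrid, ofGrid, smul_smul, mul_inv_cancel₀ hη.ne']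

theorem continuous_toGrid (o : E m) (η : ℝ) : Continuous (toGrid o η) := by
  unfold toGrid; fun_prop

theorem abs_toGrid_sub {o : E m} (hη : 0 < η) (x : E m) (j : Fin m) (c : ℝ) :
    |toGrid o η x j - c| = |x j - (o j + η * c)| / η := by
  have h : toGrid o η x j - c = (x j - (o j + η * c)) / η := by
    simp only [toGrid, PiLp.smul_apply, PiLp.sub_apply, smul_eq_mul]
    field_simp
    ring
  rw [h, abs_div, abs_of_pos hη]

theorem Cell.IsGridCell.carrier_add_openCube {o : E m} (hη : 0 < η) {σ : Cell m}
    {z : Fin m → ℤ} (hσ : σ.IsGridCell o η z) {r : ℝ} (hr : 0 < r) :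
    σ.carrier η + openCube m (r * η) = toGrid o η ⁻¹' gridNhd r z := by
  have hdir : ∀ j, j ∈ σ.dirs ↔ Even (z j) := fun j => by rw [hσ.1, mem_evenDirs]
  have hrη : 0 < r * η := by positivity
  ext x
  have hmem : x ∈ toGrid o η ⁻¹' gridNhd r z ↔ ∀ j, (Odd (z j) → |x j - σ.center j| < r * η) ∧
      (Even (z j) → |x j - σ.center j| < η + r * η) := by
    refine forall_congr' fun j => ?_
    rw [abs_toGrid_sub hη, ← hσ.2 j, div_lt_iff₀ hη, div_lt_iff₀ hη, add_mul, one_mul]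
  rw [hmem, Set.mem_add]
  constructor
  · rintro ⟨p, ⟨hp1, hp2⟩, q, hq, rfl⟩ j
    have hqj := hq j
    refine ⟨fun ho => ?_, fun he => ?_⟩
    · rw [PiLp.add_apply, hp2 j (by rw [hdir]; simpa using ho), add_sub_cancel_left]
      exact hqj
    · have h1 := hp1 j ((hdir j).2 he)
      rw [PiLp.add_apply]
      rw [abs_lt] at *
      rw [abs_le] at h1
      constructor <;> linarith
  · intro hx
    let p : E m := WithLp.toLp 2 fun j => if j ∈ σ.dirs then
      max (σ.center j - η) (min (x j) (σ.center j + η)) else σ.center j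
    refine ⟨p, ⟨fun j hj => ?_, fun j hj => ?_⟩, x - p, fun j => ?_, by simp⟩
    · simp only [p, if_pos hj]
      rw [abs_le]
      constructor
      · linarith [le_max_left (σ.center j - η) (min (x j) (σ.center j + η))]
      · have : max (σ.center j - η) (min (x j) (σ.center j + η)) ≤ σ.center j + η :=
          max_le (by linarith) (min_le_right _ _)
        linarith
    · simp only [p, if_neg hj]
    · simp only [PiLp.sub_apply, p]
      by_cases hj : j ∈ σ.dirs
      · have h1 := (hx j).2 ((hdir j).1 hj)
        rw [abs_lt] at *
        simp only [if_pos hj]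
        rcases max_cases (σ.center j - η) (min (x j) (σ.center j + η)) with h | h <;>
          rcases min_cases (x j) (σ.center j + η) with h' | h' <;> constructor <;> linarith
      · simp only [if_neg hj]
        exact (hx j).1 (by rw [← Int.not_even_iff_odd, ← hdir]; exact hj)

end Cubication

end CubeOpening

namespace CubeOpening

section Rescaling

variable {m : ℕ}

/-! ### Opening maps of arbitrary scale -/

theorem norm_iteratedFDeriv_comp_homothety_le {G : Type*} [NormedAddCommGroup G] [NormedSpace ℝ G]
    (f : E m → G) (b : E m) {c : ℝ} (hc : c ≠ 0) (j : ℕ) (x : E m) :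
    ‖iteratedFDeriv ℝ j (fun y => f (b + c • y)) x‖ ≤
      |c| ^ j * ‖iteratedFDeriv ℝ j f (b + c • x)‖ := by
  let L : E m ≃L[ℝ] E m := ContinuousLinearEquiv.smulLeft (Units.mk0 c hc)
  have hL : ∀ y, L y = c • y := fun y => rfl
  have hcomp : (fun y => f (b + c • y)) = (fun y => f (b + y)) ∘ L := rfl
  rw [hcomp, ← iteratedFDerivWithin_univ, ← preimage_univ (f := L),
    L.iteratedFDerivWithin_comp_right _ uniqueDiffOn_univ (mem_univ _), iteratedFDerivWithin_univ,
    iteratedFDeriv_comp_add_left, hL]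
  refine (ContinuousMultilinearMap.norm_compContinuousLinearMap_le _ _).trans ?_
  rw [mul_comm, Finset.prod_const, Finset.card_univ, Fintype.card_fin]
  have hn : ‖(L : E m →L[ℝ] E m)‖ ≤ |c| :=
    ContinuousLinearMap.opNorm_le_bound _ (abs_nonneg c) fun y => by
      rw [ContinuousLinearEquiv.coe_coe, hL, norm_smul, Real.norm_eq_abs]
  gcongr

theorem continuous_ofGrid (o : E m) (η : ℝ) : Continuous (ofGrid o η) := by
  unfold ofGrid; fun_prop

theorem toGrid_eq (o : E m) (η : ℝ) (x : E m) : toGrid o η x = -(η⁻¹ • o) + η⁻¹ • x := by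
  rw [toGrid, smul_sub]; abel

theorem norm_iteratedFDeriv_comp_ofGrid_le {G : Type*} [NormedAddCommGroup G] [NormedSpace ℝ G]
    (f : E m → G) (o : E m) {η : ℝ} (hη : 0 < η) (j : ℕ) (y : E m) :
    ‖iteratedFDeriv ℝ j (f ∘ ofGrid o η) y‖ ≤
      η ^ j * ‖iteratedFDeriv ℝ j f (ofGrid o η y)‖ := by
  have h := norm_iteratedFDeriv_comp_homothety_le f o hη.ne' j y
  rwa [abs_of_pos hη] at h

theorem norm_iteratedFDeriv_comp_toGrid_le {G : Type*} [NormedAddCommGroup G] [NormedSpace ℝ G]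
    (f : E m → G) (o : E m) {η : ℝ} (hη : 0 < η) (j : ℕ) (x : E m) :
    η ^ j * ‖iteratedFDeriv ℝ j (f ∘ toGrid o η) x‖ ≤ ‖iteratedFDeriv ℝ j f (toGrid o η x)‖ := by
  have h := norm_iteratedFDeriv_comp_homothety_le f (-(η⁻¹ • o)) (inv_ne_zero hη.ne') j x
  simp only [← toGrid_eq] at h
  rw [abs_of_pos (inv_pos.2 hη), inv_pow] at h
  rwa [← le_inv_mul_iff₀ (pow_pos hη j)]

/-- The change of coordinates multiplies all integrals by the same constant. -/
theorem exists_setLIntegral_preimage_toGrid (o : E m) {η : ℝ} (hη : 0 < η) :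
    ∃ c : ℝ≥0∞, ∀ (f : E m → ℝ≥0∞), Measurable f → ∀ N : Set (E m), MeasurableSet N →
      ∫⁻ x in toGrid o η ⁻¹' N, f x = c * ∫⁻ y in N, f (ofGrid o η y) := by
  have hmap : (volume : Measure (E m)).map (toGrid o η) =
      ENNReal.ofReal |((η⁻¹) ^ Module.finrank ℝ (E m))⁻¹| • volume := by
    rw [← Measure.map_addHaar_smul volume (inv_ne_zero hη.ne')]
    conv_rhs => rw [← (measurePreserving_sub_right (volume : Measure (E m)) o).map_eq]
    rw [Measure.map_map (by fun_prop) (by fun_prop)]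
    rfl
  refine ⟨ENNReal.ofReal |((η⁻¹) ^ Module.finrank ℝ (E m))⁻¹|, fun f hf N hN => ?_⟩
  have h := setLIntegral_map (μ := (volume : Measure (E m))) hN
    (hf.comp (continuous_ofGrid o η).measurable) (continuous_toGrid o η).measurable
  simp only [Function.comp_apply, ofGrid_toGrid o hη] at h
  rw [← h, hmap, Measure.restrict_smul, lintegral_smul_measure, smul_eq_mul]

theorem closure_subset_of_subset_gridNhd {r r' : ℝ} (hr : r < r') {A : Set (E m)}
    {Z : Set (Fin m → ℤ)} (hA : ∀ x ∈ A, ∃ z ∈ Z, x ∈ gridNhd r z) :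
    closure A ⊆ ⋃ z ∈ Z, gridNhd r' z := by
  intro x hx
  obtain ⟨y, hy, hxy⟩ := Metric.mem_closure_iff.1 hx (r' - r) (by linarith)
  obtain ⟨z, hz, hyz⟩ := hA y hy
  refine mem_iUnion₂.2 ⟨z, hz, fun j => ?_⟩
  have h1 : |x j - y j| < r' - r := by
    refine lt_of_le_of_lt ?_ hxy
    rw [dist_eq_norm, ← Real.norm_eq_abs]
    exact PiLp.norm_apply_le (x - y) j
  have h2 := abs_sub_le (x j) (y j) (z j)
  exact ⟨fun ho => by linarith [(hyz j).1 ho], fun he => by linarith [(hyz j).2 he]⟩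

/-- The geometric part of the opening construction, for subskeletons of any radius: the opening map
is chosen in dependence on finitely many nonnegative functions in such a way that their integrals
over the relevant neighbourhoods do not increase by more than a constant factor under composition
with it. -/
theorem exists_openingMap_of_isSubskeleton (hm : 0 < m) {ρ : ℝ} (hρ0 : 0 < ρ) (hρ : ρ < 1 / 2)
    (k : ℕ) {ι : Type*} [Fintype ι] :
    ∃ (C : ℝ≥0∞) (A : ℝ), C ≠ ⊤ ∧ 0 < A ∧ ∀ ℓ < m, ∀ η > 0, ∀ U : Set (Cell m),
      IsSubskeleton η ℓ U → ∀ f : ι → E m → ℝ≥0∞, (∀ s, Measurable (f s)) →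
      ∃ Φ : E m → E m, ContDiff ℝ ∞ Φ ∧
        (∀ i ≤ ℓ, ∀ σ ∈ skeleton η i U, ∀ x ∈ σ.carrier η,
          ∀ y ∈ σ.normalCube (ρ * η) x, ∀ z ∈ σ.normalCube (ρ * η) x, Φ y = Φ z) ∧
        geomSupport Φ ⊆ cellUnion η U + openCube m (2 * ρ * η) ∧
        (∀ N : Set (E m), (N = cellUnion η U + openCube m (2 * ρ * η) ∨
            ∃ σ ∈ U, N = σ.carrier η + openCube m (2 * ρ * η)) →
          MapsTo Φ N N ∧ ∀ s, ∫⁻ x in N, f s (Φ x) ≤ C * ∫⁻ x in N, f s x) ∧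
        ∀ (ν : ℕ) (g : E m → E ν) (W : Set (E m)), IsOpen W → ContDiffOn ℝ ∞ g W →
          ∀ j ∈ Finset.Icc 1 k, ∀ x, Φ x ∈ W →
            η ^ j * ‖iteratedFDeriv ℝ j (g ∘ Φ) x‖ ≤
              A * ∑ i ∈ Finset.Icc 1 j, η ^ i * ‖iteratedFDeriv ℝ i g (Φ x)‖ := by
  obtain ⟨C, D, r, hC, hD, hr, hmain⟩ := exists_openingMap hm hρ0 hρ k (ι := ι)
  have hD0 : 0 ≤ D := by linarith
  refine ⟨C, k.factorial * D ^ k, hC, by positivity, fun ℓ hℓ η hη U hU f hf => ?_⟩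
  have hr0 : 0 < 2 * ρ := by linarith
  obtain ⟨o, ho⟩ := hU.exists_isGridCell hη
  set Z : Set (Fin m → ℤ) := {z | ∃ σ ∈ U, σ.IsGridCell o η z}
  have hfm : ∀ s, Measurable fun y => f s (ofGrid o η y) := fun s =>
    (hf s).comp (continuous_ofGrid o η).measurable
  obtain ⟨Φ, hΦ, hΦD, hΦn, hΦs, hΦo, hΦi⟩ := hmain {w | ∃ z ∈ Z, IsGridFace w z}
    (fun w ⟨z, hz, hwz⟩ x hx => ⟨z, hz, hx.trans hwz⟩) _ hfm
  have hcell : ∀ σ ∈ U, ∀ z, σ.IsGridCell o η z →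
      σ.carrier η + openCube m (2 * ρ * η) = toGrid o η ⁻¹' gridNhd (2 * ρ) z :=
    fun σ _ z hz => hz.carrier_add_openCube hη hr0
  have hΩ : cellUnion η U + openCube m (2 * ρ * η) =
      toGrid o η ⁻¹' ⋃ z ∈ Z, gridNhd (2 * ρ) z := by
    rw [cellUnion, iUnion₂_add, preimage_iUnion₂]
    ext x
    simp only [mem_iUnion, exists_prop]
    constructor
    · rintro ⟨σ, hσ, hx⟩
      obtain ⟨z, hz, -⟩ := ho σ hσ
      exact ⟨z, ⟨σ, hσ, hz⟩, hcell σ hσ z hz ▸ hx⟩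
    · rintro ⟨z, ⟨σ, hσ, hz⟩, hx⟩
      exact ⟨σ, hσ, (hcell σ hσ z hz).symm ▸ hx⟩
  -- The relevant neighbourhoods are unions of boxes of the grid.
  have hsat : ∀ N : Set (E m), (N = cellUnion η U + openCube m (2 * ρ * η) ∨
      ∃ σ ∈ U, N = σ.carrier η + openCube m (2 * ρ * η)) →
      ∃ N' : Set (E m), N = toGrid o η ⁻¹' N' ∧ IsOpen N' ∧
        ∀ z, (gridBox ρ z ∩ N').Nonempty → gridBox ρ z ⊆ N' := by
    rintro N (rfl | ⟨σ, hσ, rfl⟩)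
    · refine ⟨_, hΩ, isOpen_biUnion fun z _ => isOpen_gridNhd _ z, fun β ⟨x, hxβ, hx⟩ => ?_⟩
      obtain ⟨z, hz, hxz⟩ := mem_iUnion₂.1 hx
      exact (gridBox_subset_gridNhd hρ0 hρ ⟨x, hxβ, hxz⟩).trans
        (subset_biUnion_of_mem (u := fun z => gridNhd (2 * ρ) z) hz)
    · obtain ⟨z, hz, -⟩ := ho σ hσ
      exact ⟨_, hcell σ hσ z hz, isOpen_gridNhd _ z, fun β => gridBox_subset_gridNhd hρ0 hρ⟩
  have hofs : ContDiff ℝ ∞ (ofGrid o η) := by unfold ofGrid; fun_prop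
  have htos : ContDiff ℝ ∞ (toGrid o η) := by unfold toGrid; fun_prop
  refine ⟨ofGrid o η ∘ Φ ∘ toGrid o η, hofs.comp (hΦ.comp htos), ?_, ?_, ?_, ?_⟩
  · rintro i hi τ ⟨rfl, σ, hσ, hτσ⟩ x hx y hy y' hy'
    obtain ⟨z, hz, hzℓ⟩ := ho σ hσ
    obtain ⟨w, hwz, hw⟩ := hz.exists_face hη hτσ
    have hdir : ∀ j, j ∈ τ.dirs ↔ Even (w j) := fun j => by rw [hw.1, mem_evenDirs]
    simp only [Function.comp_apply]
    congr 1
    refine hΦo w ⟨z, ⟨σ, hσ, hz⟩, hwz⟩ (by have := hwz.gridDim_le; omega) _ _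
      (fun j hj => ?_) fun j hj => ?_
    · have hj' := (hdir j).2 hj
      refine ⟨?_, ?_⟩
      · simp only [toGrid, PiLp.smul_apply, PiLp.sub_apply, hy.1 j hj', hy'.1 j hj']
      · rw [abs_toGrid_sub hη, ← hw.2 j, div_le_one hη, hy.1 j hj']
        exact hx.1 j hj'
    · have hj' : j ∉ τ.dirs := by rw [hdir]; simpa using hj
      rw [abs_toGrid_sub hη, abs_toGrid_sub hη, ← hw.2 j, div_le_iff₀ hη, div_le_iff₀ hη,
        ← hx.2 j hj']
      exact ⟨hy.2 j hj', hy'.2 j hj'⟩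
  · rw [hΩ]
    have hsub : {x | (ofGrid o η ∘ Φ ∘ toGrid o η) x ≠ x} ⊆ toGrid o η ⁻¹' {y | Φ y ≠ y} := by
      intro x hx hfix
      refine hx ?_
      simp only [Function.comp_apply]
      rw [hfix, ofGrid_toGrid o hη]
    refine ((closure_mono hsub).trans
      ((continuous_toGrid o η).closure_preimage_subset _)).trans (preimage_mono ?_)
    refine closure_subset_of_subset_gridNhd hr fun y hy => ?_
    obtain ⟨w, ⟨z, hz, hwz⟩, hyw⟩ := hΦs y hy
    exact ⟨z, hz, hwz.gridNhd_subset r hyw⟩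
  · intro N hN
    obtain ⟨N', rfl, hN'o, hN'⟩ := hsat N hN
    refine ⟨fun x hx => ?_, fun s => ?_⟩
    · rw [mem_preimage, Function.comp_apply, toGrid_ofGrid o hη]
      obtain ⟨z, hz⟩ := exists_mem_gridBox (ρ := ρ) (toGrid o η x)
      exact hN' z ⟨_, hz, hx⟩ (hΦn.mem_gridBox le_rfl hρ hz)
    · obtain ⟨c, hc⟩ := exists_setLIntegral_preimage_toGrid o hη
      rw [hc (fun x => f s ((ofGrid o η ∘ Φ ∘ toGrid o η) x))
          ((hf s).comp (hofs.comp (hΦ.comp htos)).continuous.measurable) N' hN'o.measurableSet,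
        hc _ (hf s) N' hN'o.measurableSet]
      simp only [Function.comp_apply, toGrid_ofGrid o hη]
      rw [mul_left_comm]
      gcongr
      exact lintegral_le_of_gridBox hρ0 hρ (hΦi s) hN'
  · intro ν g W hW hg j hj x hx
    rw [Finset.mem_Icc] at hj
    have h1 := norm_iteratedFDeriv_comp_toGrid_le ((g ∘ ofGrid o η) ∘ Φ) o hη j x
    have h2 := norm_iteratedFDeriv_comp_le_sum (f := g ∘ ofGrid o η) (Φ := Φ)
      (hW.preimage (continuous_ofGrid o η)) (hg.comp hofs.contDiffOn (mapsTo_preimage _ _)) hΦ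
      (x := toGrid o η x) hx hj.1 (D := D) fun i hi hij =>
        (hΦD i hi (hij.trans hj.2) _).trans (le_self_pow_of_one_le hD hi)
    refine h1.trans (h2.trans ?_)
    have h3 : ∑ i ∈ Finset.Icc 1 j, ‖iteratedFDeriv ℝ i (g ∘ ofGrid o η) (Φ (toGrid o η x))‖ ≤
        ∑ i ∈ Finset.Icc 1 j,
          η ^ i * ‖iteratedFDeriv ℝ i g ((ofGrid o η ∘ Φ ∘ toGrid o η) x)‖ :=
      Finset.sum_le_sum fun i _ => norm_iteratedFDeriv_comp_ofGrid_le g o hη i _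
    have h4 : (j.factorial : ℝ) ≤ k.factorial := by exact_mod_cast Nat.factorial_le hj.2
    have h5 : D ^ j ≤ D ^ k := pow_le_pow_right₀ hD hj.2
    have h6 : 0 ≤ ∑ i ∈ Finset.Icc 1 j,
        ‖iteratedFDeriv ℝ i (g ∘ ofGrid o η) (Φ (toGrid o η x))‖ :=
      Finset.sum_nonneg fun _ _ => norm_nonneg _
    rw [mul_right_comm]
    gcongr

end Rescaling

end CubeOpening

namespace CubeOpening

section Composition

variable {m : ℕ}

/-! ### Limits of compositions -/

theorem eLpNorm_const_mul_real {α : Type*} [MeasurableSpace α] {μ : Measure α} {p : ℝ≥0∞}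
    {c : ℝ} (hc : 0 ≤ c) (g : α → ℝ) :
    eLpNorm (fun x => c * g x) p μ = ENNReal.ofReal c * eLpNorm g p μ := by
  have := eLpNorm_const_smul c g p μ
  rw [Real.enorm_eq_ofReal hc] at this
  exact this

/-- A pointwise linear estimate between norms of functions implies the same estimate between their
`L^p` norms. -/
theorem eLpNorm_le_of_le_sum {α : Type*} [MeasurableSpace α] {μ : Measure α} {p : ℝ≥0∞}
    (hp : 1 ≤ p) {Y : Type*} [NormedAddCommGroup Y] {X : ℕ → Type*}
    [∀ i, NormedAddCommGroup (X i)] {a A : ℝ} (ha : 0 ≤ a) (hA : 0 ≤ A) {s : Finset ℕ}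
    {b : ℕ → ℝ} (hb : ∀ i, 0 ≤ b i) {f : α → Y} {h : ∀ i, α → X i}
    (hm : ∀ i ∈ s, AEStronglyMeasurable (h i) μ)
    (hle : ∀ᵐ x ∂μ, a * ‖f x‖ ≤ A * ∑ i ∈ s, b i * ‖h i x‖) :
    ENNReal.ofReal a * eLpNorm f p μ ≤
      ENNReal.ofReal A * ∑ i ∈ s, ENNReal.ofReal (b i) * eLpNorm (h i) p μ := by
  rw [← eLpNorm_norm f, ← eLpNorm_const_mul_real ha]
  refine (eLpNorm_mono_ae_real (g := fun x => A * ∑ i ∈ s, b i * ‖h i x‖) ?_).trans ?_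
  · filter_upwards [hle] with x hx
    rwa [Real.norm_of_nonneg (by positivity)]
  · rw [eLpNorm_const_mul_real hA]
    gcongr
    have hfun : (fun x => ∑ i ∈ s, b i * ‖h i x‖) = ∑ i ∈ s, fun x => b i * ‖h i x‖ := by
      ext x; simp
    rw [hfun]
    have hbm : ∀ i ∈ s, AEStronglyMeasurable (fun x => b i * ‖h i x‖) μ := fun i hi =>
      (hm i hi).norm.const_mul (b i)
    refine (eLpNorm_sum_le hbm hp).trans ?_
    refine Finset.sum_le_sum fun i _ => ?_
    rw [eLpNorm_const_mul_real (hb i), eLpNorm_norm]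

/-- The derivatives of the compositions with `Φ` converge if the compositions of the derivatives
with `Φ` do, and the limit inherits the pointwise estimate of the chain rule as an estimate in
`L^p`, on every measurable subset of the domain. -/
theorem exists_tendsto_iteratedFDeriv_comp {F : Type*} [NormedAddCommGroup F] [NormedSpace ℝ F]
    [CompleteSpace F] {p : ℝ≥0∞} (hp : 1 ≤ p) {Ω : Set (E m)} (hΩ : IsOpen Ω)
    {Φ : E m → E m} (hΦ : ContDiff ℝ ∞ Φ) (hΦΩ : MapsTo Φ Ω Ω) {η A : ℝ} (hη : 0 < η)
    (hA : 0 ≤ A) {j : ℕ}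
    (hchain : ∀ g : E m → F, ContDiffOn ℝ ∞ g Ω → ∀ x ∈ Ω,
      η ^ j * ‖iteratedFDeriv ℝ j (g ∘ Φ) x‖ ≤
        A * ∑ i ∈ Finset.Icc 1 j, η ^ i * ‖iteratedFDeriv ℝ i g (Φ x)‖)
    {f : ℕ → E m → F} (hf : ∀ n, ContDiffOn ℝ ∞ (f n) Ω)
    {g : ∀ i, E m → ContinuousMultilinearMap ℝ (fun _ : Fin i => E m) F}
    (hg : ∀ i ∈ Finset.Icc 1 j, MemLp (g i ∘ Φ) p (volume.restrict Ω))
    {K : ℝ≥0∞} (hK : K ≠ ⊤)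
    (hfg : ∀ n, ∀ i ∈ Finset.Icc 1 j,
      eLpNorm ((iteratedFDeriv ℝ i (f n) - g i) ∘ Φ) p (volume.restrict Ω) ≤ K * 2⁻¹ ^ n) :
    ∃ G : E m → ContinuousMultilinearMap ℝ (fun _ : Fin j => E m) F,
      MemLp G p (volume.restrict Ω) ∧
      (∀ n, MemLp (iteratedFDeriv ℝ j (f n ∘ Φ)) p (volume.restrict Ω)) ∧
      Tendsto (fun n => eLpNorm (iteratedFDeriv ℝ j (f n ∘ Φ) - G) p (volume.restrict Ω))
        atTop (𝓝 0) ∧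
      ∀ N ⊆ Ω, MeasurableSet N → ENNReal.ofReal (η ^ j) * eLpNorm G p (volume.restrict N) ≤
        ENNReal.ofReal A * ∑ i ∈ Finset.Icc 1 j,
          ENNReal.ofReal (η ^ i) * eLpNorm (g i ∘ Φ) p (volume.restrict N) := by
  have hηi : ∀ i : ℕ, 0 ≤ η ^ i := fun i => by positivity
  have hηj : ENNReal.ofReal (η ^ j) ≠ 0 := by
    rw [ne_eq, ENNReal.ofReal_eq_zero, not_le]; positivity
  have hat : ∀ {g : E m → F}, ContDiffOn ℝ ∞ g Ω → ∀ x ∈ Ω, ∀ i : ℕ, ContDiffAt ℝ i g x :=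
    fun h x hx i => (h.contDiffAt (hΩ.mem_nhds hx)).of_le (by exact_mod_cast le_top)
  have hcomp : ∀ n, ContDiffOn ℝ ∞ (f n ∘ Φ) Ω := fun n => (hf n).comp hΦ.contDiffOn hΦΩ
  have hcm : ∀ n i, AEStronglyMeasurable (iteratedFDeriv ℝ i (f n) ∘ Φ) (volume.restrict Ω) :=
    fun n i => ((ContDiffOn.continuousOn_iteratedFDeriv hΩ (hf n) i).comp
      hΦ.continuous.continuousOn hΦΩ).aestronglyMeasurable hΩ.measurableSet
  have hdm : ∀ n i, AEStronglyMeasurable (iteratedFDeriv ℝ i (f n ∘ Φ)) (volume.restrict Ω) :=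
    fun n i => (ContDiffOn.continuousOn_iteratedFDeriv hΩ (hcomp n) i).aestronglyMeasurable
      hΩ.measurableSet
  have hfinK : ∀ n, K * 2⁻¹ ^ n ≠ ⊤ := fun n =>
    ENNReal.mul_ne_top hK (ENNReal.pow_ne_top (by simp))
  have hone : ∀ N ⊆ Ω, MeasurableSet N → ∀ n,
      ENNReal.ofReal (η ^ j) * eLpNorm (iteratedFDeriv ℝ j (f n ∘ Φ)) p (volume.restrict N) ≤
        ENNReal.ofReal A * ∑ i ∈ Finset.Icc 1 j, ENNReal.ofReal (η ^ i) *
          (eLpNorm (g i ∘ Φ) p (volume.restrict N) + K * 2⁻¹ ^ n) := by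
    intro N hN hNm n
    have hμ : (volume : Measure (E m)).restrict N ≤ volume.restrict Ω :=
      Measure.restrict_mono hN le_rfl
    refine (eLpNorm_le_of_le_sum hp (hηi j) hA hηi
      (h := fun i => iteratedFDeriv ℝ i (f n) ∘ Φ) (s := Finset.Icc 1 j)
      (fun i _ => (hcm n i).mono_measure hμ) ?_).trans ?_
    · filter_upwards [ae_restrict_mem hNm] with x hx
      exact hchain (f n) (hf n) x (hN hx)
    · gcongr with i hi
      have hsum : iteratedFDeriv ℝ i (f n) ∘ Φ =
          g i ∘ Φ + (iteratedFDeriv ℝ i (f n) - g i) ∘ Φ := by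
        ext x; simp
      rw [hsum]
      refine (eLpNorm_add_le ((hg i hi).1.mono_measure hμ)
        (((hcm n i).sub (hg i hi).1).mono_measure hμ) hp).trans ?_
      gcongr
      exact (eLpNorm_mono_measure _ hμ).trans (hfg n i hi)
  have hmem : ∀ n, MemLp (iteratedFDeriv ℝ j (f n ∘ Φ)) p (volume.restrict Ω) := by
    intro n
    refine ⟨hdm n j, lt_top_iff_ne_top.2 fun htop => ?_⟩
    have h := hone Ω subset_rfl hΩ.measurableSet n
    rw [htop, ENNReal.mul_top hηj, top_le_iff] at h
    refine ENNReal.mul_ne_top ENNReal.ofReal_ne_top (ENNReal.sum_ne_top.2 fun i hi => ?_) h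
    exact ENNReal.mul_ne_top ENNReal.ofReal_ne_top
      (ENNReal.add_ne_top.2 ⟨(hg i hi).2.ne, hfinK n⟩)
  -- The derivatives form a Cauchy sequence, by the chain rule for the differences.
  set M : ℝ≥0∞ := (ENNReal.ofReal (η ^ j))⁻¹ * (ENNReal.ofReal A *
    ∑ i ∈ Finset.Icc 1 j, ENNReal.ofReal (η ^ i) * (K + K)) with hM
  have hMtop : M ≠ ⊤ := by
    refine ENNReal.mul_ne_top (ENNReal.inv_ne_top.2 hηj) (ENNReal.mul_ne_top ENNReal.ofReal_ne_top
      (ENNReal.sum_ne_top.2 fun i hi => ENNReal.mul_ne_top ENNReal.ofReal_ne_top ?_))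
    exact ENNReal.add_ne_top.2 ⟨hK, hK⟩
  have hcau : ∀ N n l : ℕ, N ≤ n → N ≤ l → eLpNorm (iteratedFDeriv ℝ j (f n ∘ Φ) -
      iteratedFDeriv ℝ j (f l ∘ Φ)) p (volume.restrict Ω) < (M + 1) * 2⁻¹ ^ N := by
    intro N n l hn hl
    have hle : ENNReal.ofReal (η ^ j) * eLpNorm (iteratedFDeriv ℝ j (f n ∘ Φ) -
        iteratedFDeriv ℝ j (f l ∘ Φ)) p (volume.restrict Ω) ≤ ENNReal.ofReal A *
        ∑ i ∈ Finset.Icc 1 j, ENNReal.ofReal (η ^ i) * ((K + K) * 2⁻¹ ^ N) := by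
      refine (eLpNorm_le_of_le_sum hp (hηi j) hA hηi
        (h := fun i => (iteratedFDeriv ℝ i (f n) ∘ Φ) - (iteratedFDeriv ℝ i (f l) ∘ Φ))
        (s := Finset.Icc 1 j) (fun i _ => (hcm n i).sub (hcm l i)) ?_).trans ?_
      · filter_upwards [ae_restrict_mem hΩ.measurableSet] with x hx
        have h := hchain (fun y => f n y - f l y) ((hf n).sub (hf l)) x hx
        have e1 : iteratedFDeriv ℝ j (fun y => (f n ∘ Φ) y - (f l ∘ Φ) y) x =
            iteratedFDeriv ℝ j (f n ∘ Φ) x - iteratedFDeriv ℝ j (f l ∘ Φ) x :=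
          iteratedFDeriv_sub_apply (hat (hcomp n) x hx j) (hat (hcomp l) x hx j)
        have e2 : ∀ i : ℕ, iteratedFDeriv ℝ i (fun y => f n y - f l y) (Φ x) =
            iteratedFDeriv ℝ i (f n) (Φ x) - iteratedFDeriv ℝ i (f l) (Φ x) := fun i =>
          iteratedFDeriv_sub_apply (hat (hf n) _ (hΦΩ hx) i) (hat (hf l) _ (hΦΩ hx) i)
        simp only [e2] at h
        rw [Pi.sub_apply, ← e1]
        exact h
      · gcongr with i hi
        have hsub : iteratedFDeriv ℝ i (f n) ∘ Φ - iteratedFDeriv ℝ i (f l) ∘ Φ =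
            (iteratedFDeriv ℝ i (f n) - g i) ∘ Φ - (iteratedFDeriv ℝ i (f l) - g i) ∘ Φ := by
          ext x; simp
        rw [hsub, add_mul]
        refine (eLpNorm_sub_le ((hcm n i).sub (hg i hi).1) ((hcm l i).sub (hg i hi).1) hp).trans ?_
        have hhalf : (2⁻¹ : ℝ≥0∞) ≤ 1 := by simp
        gcongr
        · refine (hfg n i hi).trans ?_
          refine mul_le_mul_right ?_ K
          exact pow_le_pow_of_le_one zero_le hhalf hn
        · refine (hfg l i hi).trans ?_
          refine mul_le_mul_right ?_ K
          exact pow_le_pow_of_le_one zero_le hhalf hl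
    have hle2 : eLpNorm (iteratedFDeriv ℝ j (f n ∘ Φ) -
        iteratedFDeriv ℝ j (f l ∘ Φ)) p (volume.restrict Ω) ≤ M * 2⁻¹ ^ N := by
      rw [ENNReal.mul_le_iff_le_inv hηj ENNReal.ofReal_ne_top] at hle
      refine hle.trans_eq ?_
      rw [hM, mul_assoc, mul_assoc, Finset.sum_mul]
      simp only [mul_assoc]
    refine hle2.trans_lt ?_
    have h0 : (2⁻¹ : ℝ≥0∞) ^ N ≠ 0 := pow_ne_zero _ (by simp)
    have ht : (2⁻¹ : ℝ≥0∞) ^ N ≠ ⊤ := ENNReal.pow_ne_top (by simp)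
    exact (ENNReal.mul_lt_mul_iff_left h0 ht).2 (ENNReal.lt_add_right hMtop one_ne_zero)
  obtain ⟨G, hG, hGt⟩ := Lp.cauchy_complete_eLpNorm hp hmem (B := fun N => (M + 1) * 2⁻¹ ^ N) (by
    rw [ENNReal.tsum_mul_left, ENNReal.tsum_geometric]
    refine ENNReal.mul_ne_top (ENNReal.add_ne_top.2 ⟨hMtop, ENNReal.one_ne_top⟩) ?_
    simp) hcau
  refine ⟨G, hG, hmem, hGt, fun N hN hNm => ?_⟩
  have hμ : (volume : Measure (E m)).restrict N ≤ volume.restrict Ω :=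
    Measure.restrict_mono hN le_rfl
  have hpow : Tendsto (fun n : ℕ => (2⁻¹ : ℝ≥0∞) ^ n) atTop (𝓝 0) :=
    ENNReal.tendsto_pow_atTop_nhds_zero_of_lt_one (by simp)
  have hlim : Tendsto (fun n : ℕ => ENNReal.ofReal A * ∑ i ∈ Finset.Icc 1 j,
      ENNReal.ofReal (η ^ i) * (eLpNorm (g i ∘ Φ) p (volume.restrict N) + K * 2⁻¹ ^ n) +
      ENNReal.ofReal (η ^ j) *
        eLpNorm (iteratedFDeriv ℝ j (f n ∘ Φ) - G) p (volume.restrict Ω)) atTop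
      (𝓝 (ENNReal.ofReal A * ∑ i ∈ Finset.Icc 1 j,
      ENNReal.ofReal (η ^ i) * (eLpNorm (g i ∘ Φ) p (volume.restrict N) + K * 0) +
      ENNReal.ofReal (η ^ j) * 0)) := by
    refine (ENNReal.Tendsto.const_mul (tendsto_finsetSum _ fun i _ =>
      ENNReal.Tendsto.const_mul (tendsto_const_nhds.add (ENNReal.Tendsto.const_mul hpow
        (Or.inr hK))) (Or.inr ENNReal.ofReal_ne_top)) (Or.inr ENNReal.ofReal_ne_top)).add
      (ENNReal.Tendsto.const_mul hGt (Or.inr ENNReal.ofReal_ne_top))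
  simp only [mul_zero, add_zero] at hlim
  refine ge_of_tendsto' hlim fun n => ?_
  have hsum : G = iteratedFDeriv ℝ j (f n ∘ Φ) - (iteratedFDeriv ℝ j (f n ∘ Φ) - G) := by abel
  have htri : eLpNorm G p (volume.restrict N) ≤
      eLpNorm (iteratedFDeriv ℝ j (f n ∘ Φ)) p (volume.restrict N) +
        eLpNorm (iteratedFDeriv ℝ j (f n ∘ Φ) - G) p (volume.restrict Ω) := by
    conv_lhs => rw [hsum]
    refine (eLpNorm_sub_le ((hdm n j).mono_measure hμ)
      (((hdm n j).sub hG.1).mono_measure hμ) hp).trans ?_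
    gcongr
  calc ENNReal.ofReal (η ^ j) * eLpNorm G p (volume.restrict N)
      ≤ ENNReal.ofReal (η ^ j) * (eLpNorm (iteratedFDeriv ℝ j (f n ∘ Φ)) p (volume.restrict N) +
        eLpNorm (iteratedFDeriv ℝ j (f n ∘ Φ) - G) p (volume.restrict Ω)) := by gcongr
    _ ≤ _ := by
      rw [mul_add]
      exact add_le_add (hone N hN hNm n) le_rfl

end Composition

end CubeOpening

namespace CubeOpening

section EssentialRange

variable {m : ℕ} {F : Type*} [NormedAddCommGroup F]

/-! ### The essential range -/

theorem essRange_congr {Ω : Set (E m)} (hΩ : MeasurableSet Ω) {u v : E m → F}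
    (h : u =ᵐ[volume.restrict Ω] v) : essRange Ω u = essRange Ω v := by
  rw [Filter.EventuallyEq, ae_restrict_iff' hΩ] at h
  ext y
  refine forall₂_congr fun ε _ => ?_
  rw [measure_congr (t := {x | x ∈ Ω ∧ dist (v x) y < ε})]
  filter_upwards [h] with x hx
  exact propext (and_congr_right fun hxΩ => by rw [hx hxΩ])

theorem isClosed_essRange (Ω : Set (E m)) (u : E m → F) : IsClosed (essRange Ω u) := by
  rw [← isOpen_compl_iff, Metric.isOpen_iff]
  intro y hy
  simp only [essRange, mem_compl_iff, mem_ofPred_eq, not_forall, not_lt, nonpos_iff_eq_zero] at hy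
  obtain ⟨ε, hε, h0⟩ := hy
  refine ⟨ε / 2, by positivity, fun y' hy' hmem => ?_⟩
  refine (hmem (ε / 2) (by positivity)).ne' (measure_mono_null ?_ h0)
  intro x hx
  refine ⟨hx.1, ?_⟩
  have h1 : dist (u x) y' < ε / 2 := hx.2
  have h2 : dist y' y < ε / 2 := hy'
  linarith [dist_triangle (u x) y' y]

/-- The values outside of the essential range are covered by balls with null preimages; countably
many of these balls suffice. -/
theorem ae_mem_essRange [SecondCountableTopology F] [MeasurableSpace F] [BorelSpace F]
    {Ω : Set (E m)} (hΩ : MeasurableSet Ω) {u : E m → F} (hu : Measurable u) :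
    ∀ᵐ x ∂volume.restrict Ω, u x ∈ essRange Ω u := by
  have h : (volume.restrict Ω).map u (essRange Ω u)ᶜ = 0 := by
    refine measure_null_of_locally_null _ fun y hy => ?_
    simp only [essRange, mem_compl_iff, mem_ofPred_eq, not_forall, not_lt,
      nonpos_iff_eq_zero] at hy
    obtain ⟨ε, hε, h0⟩ := hy
    refine ⟨Metric.ball y ε, mem_nhdsWithin_of_mem_nhds (Metric.ball_mem_nhds y hε), ?_⟩
    rw [Measure.map_apply hu Metric.isOpen_ball.measurableSet, Measure.restrict_apply' hΩ]
    refine measure_mono_null ?_ h0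
    exact fun x hx => ⟨hx.2, hx.1⟩
  exact le_antisymm ((Measure.le_map_apply hu.aemeasurable _).trans h.le) zero_le

theorem essRange_subset_of_ae_mem {Ω : Set (E m)} (hΩ : MeasurableSet Ω) {v : E m → F}
    {R : Set F} (hR : IsClosed R) (h : ∀ᵐ x ∂volume.restrict Ω, v x ∈ R) : essRange Ω v ⊆ R := by
  intro y hy
  by_contra hyR
  obtain ⟨ε, hε, hball⟩ := Metric.isOpen_iff.1 hR.isOpen_compl y hyR
  rw [ae_restrict_iff' hΩ] at h
  refine (hy ε hε).ne' (measure_mono_null ?_ h)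
  exact fun x hx hn => hball hx.2 (hn hx.1)

end EssentialRange

section PowerIntegrals

/-! ### Integrals of powers -/

variable {α : Type*} [MeasurableSpace α] {μ : Measure α} {X : Type*} [NormedAddCommGroup X]
  {p : ℝ≥0∞}

theorem lintegral_mul_enorm_rpow (hp : p ≠ 0) (hp_top : p ≠ ⊤) {c : ℝ≥0∞} (hc : c ≠ ⊤)
    (h : α → X) :
    ∫⁻ x, (c * ‖h x‖ₑ) ^ p.toReal ∂μ = (c * eLpNorm h p μ) ^ p.toReal := by
  have hq : 0 < p.toReal := ENNReal.toReal_pos hp hp_top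
  simp only [ENNReal.mul_rpow_of_nonneg _ _ hq.le]
  rw [lintegral_const_mul' _ _ (ENNReal.rpow_ne_top_of_nonneg hq.le hc),
    eLpNorm_eq_lintegral_rpow_enorm_toReal hp hp_top, ← ENNReal.rpow_mul, one_div,
    inv_mul_cancel₀ hq.ne', ENNReal.rpow_one]

theorem mul_eLpNorm_le_of_lintegral_le (hp : p ≠ 0) (hp_top : p ≠ ⊤) {c B : ℝ≥0∞} (hc : c ≠ ⊤)
    {h : α → X} (hle : ∫⁻ x, (c * ‖h x‖ₑ) ^ p.toReal ∂μ ≤ B) :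
    c * eLpNorm h p μ ≤ B ^ (1 / p.toReal) := by
  rw [lintegral_mul_enorm_rpow hp hp_top hc] at hle
  rwa [one_div, ENNReal.le_rpow_inv_iff (ENNReal.toReal_pos hp hp_top)]

/-- If a sequence converges to zero fast in `L^p`, then a weighted sum of its `p`-th powers is
integrable. A single function thus controls the whole sequence. -/
theorem lintegral_tsum_rpow_le (hp : 1 ≤ p) (hp_top : p ≠ ⊤) {h : ℕ → α → X}
    (hm : ∀ n, AEStronglyMeasurable (h n) μ) (hle : ∀ n, eLpNorm (h n) p μ ≤ 4⁻¹ ^ n) :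
    ∫⁻ x, ∑' n, (2 ^ n * ‖h n x‖ₑ) ^ p.toReal ∂μ ≤ 2 := by
  have hp0 : p ≠ 0 := (one_pos.trans_le hp).ne'
  have hq : 1 ≤ p.toReal := by
    rw [← ENNReal.toReal_one]
    exact ENNReal.toReal_mono hp_top hp
  rw [lintegral_tsum fun n => ((hm n).enorm.const_mul _).pow_const _]
  calc ∑' n, ∫⁻ x, (2 ^ n * ‖h n x‖ₑ) ^ p.toReal ∂μ ≤ ∑' n, (2⁻¹ : ℝ≥0∞) ^ n := by
        refine ENNReal.tsum_le_tsum fun n => ?_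
        rw [lintegral_mul_enorm_rpow hp0 hp_top (ENNReal.pow_ne_top (by simp))]
        have h24 : (2 : ℝ≥0∞) * 4⁻¹ = 2⁻¹ := by
          rw [show (4 : ℝ≥0∞) = 2 * 2 by norm_num,
            ENNReal.mul_inv (Or.inl two_ne_zero) (Or.inl ENNReal.ofNat_ne_top), ← mul_assoc,
            ENNReal.mul_inv_cancel two_ne_zero ENNReal.ofNat_ne_top, one_mul]
        have hle1 : 2 ^ n * eLpNorm (h n) p μ ≤ 2⁻¹ ^ n := by
          refine (mul_le_mul_right (hle n) _).trans_eq ?_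
          rw [← mul_pow, h24]
        have hone : (2⁻¹ : ℝ≥0∞) ^ n ≤ 1 := pow_le_one₀ zero_le (by simp)
        calc _ ≤ (2 ^ n * eLpNorm (h n) p μ) ^ (1 : ℝ) :=
              ENNReal.rpow_le_rpow_of_exponent_ge (hle1.trans hone) hq
          _ ≤ _ := by rwa [ENNReal.rpow_one]
    _ = 2 := by rw [ENNReal.tsum_geometric]; simp

end PowerIntegrals

section Tower

variable {m : ℕ} {F : Type*} [NormedAddCommGroup F] [NormedSpace ℝ F]

/-- The sequence of the weak derivatives of `u` of all orders, beginning with `u` itself. -/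
noncomputable def weakJet (Ω : Set (E m)) (u : E m → F) :
    ∀ j, E m → ContinuousMultilinearMap ℝ (fun _ : Fin j => E m) F
  | 0 => fun x => ContinuousMultilinearMap.uncurry0 ℝ (E m) (u x)
  | j + 1 => weakDeriv (j + 1) Ω u

theorem weakJet_of_pos {Ω : Set (E m)} {u : E m → F} {j : ℕ} (hj : 1 ≤ j) :
    weakJet Ω u j = weakDeriv j Ω u := by
  obtain ⟨i, rfl⟩ := Nat.exists_eq_add_of_le' hj
  rfl

theorem MemSobolev.isWeakDeriv_weakJet {k : ℕ} {p : ℝ≥0∞} (hp : 1 ≤ p) {Ω : Set (E m)}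
    {u : E m → F} (hu : MemSobolev k p Ω u) {j : ℕ} (hj : j ≤ k) :
    IsWeakDeriv j Ω u (weakJet Ω u j) := by
  rcases j.eq_zero_or_pos with rfl | h
  · exact isWeakDeriv_zero (locallyIntegrableOn_of_memLp hp hu.memLp)
  · rw [weakJet_of_pos h]
    exact isWeakDeriv_weakDeriv (hu.hasWeakDeriv j (Finset.mem_Icc.2 ⟨h, hj⟩))

theorem MemSobolev.memLp_weakJet {k : ℕ} {p : ℝ≥0∞} {Ω : Set (E m)}
    {u : E m → F} (hu : MemSobolev k p Ω u) {j : ℕ} (hj : j ≤ k) :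
    MemLp (weakJet Ω u j) p (volume.restrict Ω) := by
  rcases j.eq_zero_or_pos with rfl | h
  · let L := (continuousMultilinearCurryFin0 ℝ (E m) F).symm.toContinuousLinearEquiv
    exact L.toContinuousLinearMap.comp_memLp' hu.memLp
  · rw [weakJet_of_pos h]
    exact hu.memLp_weakDeriv j (Finset.mem_Icc.2 ⟨h, hj⟩)

/-- A function which is continuous on an open set may be extended to a measurable function. -/
theorem exists_stronglyMeasurable_eqOn {X : Type*} [NormedAddCommGroup X] {Ω : Set (E m)}
    (hΩ : IsOpen Ω) {f : E m → X} (hf : ContinuousOn f Ω) :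
    ∃ T : E m → X, StronglyMeasurable T ∧ EqOn T f Ω := by
  obtain ⟨T, hT, hTf⟩ :=
    (MeasurableEmbedding.subtype_coe hΩ.measurableSet).exists_stronglyMeasurable_extend
    (continuousOn_iff_continuous_domRestrict.1 hf).stronglyMeasurable fun _ => ⟨0⟩
  exact ⟨T, hT, fun x hx => congrFun hTf ⟨x, hx⟩⟩

end Tower

end CubeOpening

namespace CubeOpening

section Main

variable {m : ℕ} {F : Type*} [NormedAddCommGroup F] [NormedSpace ℝ F] [CompleteSpace F]
  [SecondCountableTopology F] [MeasurableSpace F] [BorelSpace F]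

/-! ### Composition of Sobolev maps with opening maps -/

/-- With a Sobolev map `u`, finitely many nonnegative functions are associated such that `u` may be
composed with every smooth map `Φ` under which the integrals of these functions do not increase by
more than a constant factor. The functions are the powers of the weak derivatives of `u`, the
functions which control the convergence of a sequence of smooth maps to `u` along with its
derivatives, and the indicator function of the set where `u` takes values outside of its essential
range. -/
theorem exists_controlling_functions {k : ℕ} {p : ℝ≥0∞} (hp : 1 ≤ p) (hp_top : p ≠ ⊤)
    {Ω : Set (E m)} (hΩ : IsOpen Ω) {u : E m → F} (hu : MemSobolev k p Ω u) :
    ∃ w : Fin (k + 1) ⊕ Fin (k + 1) ⊕ Unit → E m → ℝ≥0∞, (∀ s, Measurable (w s)) ∧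
      ∀ (C : ℝ≥0∞) (A η : ℝ) (Φ : E m → E m), C ≠ ⊤ → 0 ≤ A → 0 < η → ContDiff ℝ ∞ Φ →
        MapsTo Φ Ω Ω →
        (∀ g : E m → F, ContDiffOn ℝ ∞ g Ω → ∀ j ∈ Finset.Icc 1 k, ∀ x ∈ Ω,
          η ^ j * ‖iteratedFDeriv ℝ j (g ∘ Φ) x‖ ≤
            A * ∑ i ∈ Finset.Icc 1 j, η ^ i * ‖iteratedFDeriv ℝ i g (Φ x)‖) →
        (∀ s, ∫⁻ x in Ω, w s (Φ x) ≤ C * ∫⁻ x in Ω, w s x) →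
        ∃ v : E m → F, IsSobolevComp k p Ω u Φ v ∧ essRange Ω v ⊆ essRange Ω u ∧
          ∀ N ⊆ Ω, MeasurableSet N → (∀ s, ∫⁻ x in N, w s (Φ x) ≤ C * ∫⁻ x in N, w s x) →
            ∀ j ∈ Finset.Icc 1 k,
              ENNReal.ofReal (η ^ j) * eLpNorm (weakDeriv j Ω v) p (volume.restrict N) ≤
                ENNReal.ofReal A * C ^ (1 / p.toReal) * ∑ i ∈ Finset.Icc 1 j,
                  ENNReal.ofReal (η ^ i) *
                    eLpNorm (weakDeriv i Ω u) p (volume.restrict N) := by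
  have hp0 : p ≠ 0 := (one_pos.trans_le hp).ne'
  have hq : 0 < p.toReal := ENNReal.toReal_pos hp0 hp_top
  have hΩm := hΩ.measurableSet
  choose f hf hfg using fun n : ℕ => exists_smooth_eLpNorm_sub_le hp hp_top hΩ hu.memLp
    (fun j hj => hu.isWeakDeriv_weakJet hp hj) (fun j hj => hu.memLp_weakJet hj)
    (ε := 4⁻¹ ^ n) (pow_ne_zero n (by simp))
  -- Compositions with `Φ` are sensitive to null sets, so that representatives have to be fixed.
  have hrep : ∀ i, ∃ g : E m → ContinuousMultilinearMap ℝ (fun _ : Fin i => E m) F,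
      StronglyMeasurable g ∧ (i ≤ k → weakJet Ω u i =ᵐ[volume.restrict Ω] g) := by
    intro i
    by_cases hi : i ≤ k
    · have h := (hu.memLp_weakJet hi).1
      exact ⟨h.mk _, h.stronglyMeasurable_mk, fun _ => h.ae_eq_mk⟩
    · exact ⟨0, stronglyMeasurable_zero, fun h => absurd h hi⟩
  choose g hgm hge using hrep
  -- `T n i` extends the `i`-th derivative of `f n` measurably from `Ω` to the whole space.
  choose T hTm hTe using fun n i => exists_stronglyMeasurable_eqOn hΩ
    (ContDiffOn.continuousOn_iteratedFDeriv hΩ (hf n) i)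
  have hgL : ∀ i ≤ k, MemLp (g i) p (volume.restrict Ω) := fun i hi =>
    (memLp_congr_ae (hge i hi)).1 (hu.memLp_weakJet hi)
  have hfg' : ∀ n, ∀ i ≤ k,
      eLpNorm (iteratedFDeriv ℝ i (f n) - g i) p (volume.restrict Ω) ≤ 4⁻¹ ^ n := by
    intro n i hi
    refine le_of_eq_of_le (eLpNorm_congr_ae ?_) (hfg n i hi)
    filter_upwards [hge i hi] with x hx
    rw [Pi.sub_apply, Pi.sub_apply, hx]
  have hTg : ∀ n, ∀ i ≤ k, eLpNorm (T n i - g i) p (volume.restrict Ω) ≤ 4⁻¹ ^ n := by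
    intro n i hi
    refine le_of_eq_of_le (eLpNorm_congr_ae ?_) (hfg' n i hi)
    filter_upwards [ae_restrict_mem hΩm] with x hx
    rw [Pi.sub_apply, Pi.sub_apply, hTe n i hx]
  set u' : E m → F := fun x => g 0 x 0 with hu'
  have hu'm : StronglyMeasurable u' :=
    (ContinuousMultilinearMap.apply ℝ (fun _ : Fin 0 => E m) F 0).continuous.comp_stronglyMeasurable
      (hgm 0)
  have hu'e : u' =ᵐ[volume.restrict Ω] u := by
    filter_upwards [hge 0 (Nat.zero_le k)] with x hx
    simp only [hu', ← hx]
    rfl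
  have hfu : ∀ n x, ‖f n x - u' x‖ = ‖(iteratedFDeriv ℝ 0 (f n) - g 0) x‖ := fun n x => by
    rw [← ContinuousMultilinearMap.fin0_apply_norm _ (x := 0)]
    rfl
  have hRc := isClosed_essRange Ω u'
  refine ⟨Sum.elim (fun i x => (1 * ‖g i x‖ₑ) ^ p.toReal) (Sum.elim
    (fun i x => ∑' n, (2 ^ n * ‖(T n i - g i) x‖ₑ) ^ p.toReal)
    (fun _ => {x | u' x ∉ essRange Ω u'}.indicator 1)), ?_, ?_⟩
  · rintro (i | i | i)
    · exact ((hgm i).enorm.const_mul _).pow_const _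
    · exact Measurable.tsum fun n =>
        ((((hTm n i).sub (hgm i)).enorm).const_mul _).pow_const _
    · exact measurable_one.indicator (hu'm.measurable hRc.measurableSet.compl)
  intro C A η Φ hC hA hη hΦ hΦΩ hchain hwΩ
  have hΦm := hΦ.continuous.measurable
  have hCq : C ^ (1 / p.toReal) ≠ ⊤ := ENNReal.rpow_ne_top_of_nonneg (by positivity) hC
  set K : ℝ≥0∞ := (C * 2) ^ (1 / p.toReal)
  have hKtop : K ≠ ⊤ :=
    ENNReal.rpow_ne_top_of_nonneg (by positivity) (ENNReal.mul_ne_top hC (by simp))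
  -- The composition with `Φ` is bounded on the weak derivatives of `u`.
  have hbound : ∀ N : Set (E m), (∀ i : Fin (k + 1), ∫⁻ x in N, (1 * ‖g i (Φ x)‖ₑ) ^ p.toReal ≤
      C * ∫⁻ x in N, (1 * ‖g i x‖ₑ) ^ p.toReal) → ∀ i ≤ k,
      eLpNorm (g i ∘ Φ) p (volume.restrict N) ≤
        C ^ (1 / p.toReal) * eLpNorm (g i) p (volume.restrict N) := by
    intro N hN i hi
    have h := hN ⟨i, by omega⟩
    have h2 := mul_eLpNorm_le_of_lintegral_le hp0 hp_top ENNReal.one_ne_top (h := g i ∘ Φ) h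
    simp only at h2
    rw [lintegral_mul_enorm_rpow hp0 hp_top ENNReal.one_ne_top,
      ENNReal.mul_rpow_of_nonneg _ _ (by positivity), ← ENNReal.rpow_mul, mul_one_div_cancel hq.ne',
      ENNReal.rpow_one, one_mul, one_mul] at h2
    exact h2
  have hgΦL : ∀ i ≤ k, MemLp (g i ∘ Φ) p (volume.restrict Ω) := fun i hi =>
    ⟨((hgm i).comp_measurable hΦm).aestronglyMeasurable,
      (hbound Ω (fun i => hwΩ (Sum.inl i)) i hi).trans_lt
        (ENNReal.mul_lt_top hCq.lt_top (hgL i hi).2)⟩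
  -- The compositions of the derivatives of the smooth maps with `Φ` converge.
  have hconv : ∀ n, ∀ i ≤ k,
      eLpNorm ((iteratedFDeriv ℝ i (f n) - g i) ∘ Φ) p (volume.restrict Ω) ≤ K * 2⁻¹ ^ n := by
    intro n i hi
    have hT : eLpNorm ((iteratedFDeriv ℝ i (f n) - g i) ∘ Φ) p (volume.restrict Ω) =
        eLpNorm ((T n i - g i) ∘ Φ) p (volume.restrict Ω) := by
      refine eLpNorm_congr_ae ?_
      filter_upwards [ae_restrict_mem hΩm] with x hx
      simp only [Function.comp_apply, Pi.sub_apply, hTe n i (hΦΩ hx)]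
    have h := hwΩ (Sum.inr (Sum.inl ⟨i, by omega⟩))
    simp only [Sum.elim_inr, Sum.elim_inl] at h
    have h2 := lintegral_tsum_rpow_le hp hp_top (μ := volume.restrict Ω)
      (h := fun n => T n i - g i)
      (fun n => ((hTm n i).sub (hgm i)).aestronglyMeasurable) fun n => hTg n i hi
    have h3 : ∫⁻ x in Ω, (2 ^ n * ‖((T n i - g i) ∘ Φ) x‖ₑ) ^ p.toReal ≤ C * 2 := by
      refine (lintegral_mono fun x => ?_).trans (h.trans (mul_le_mul_right h2 C))
      exact ENNReal.le_tsum (f := fun n => (2 ^ n * ‖(T n i - g i) (Φ x)‖ₑ) ^ p.toReal) n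
    have h4 := mul_eLpNorm_le_of_lintegral_le hp0 hp_top (ENNReal.pow_ne_top (by simp)) h3
    rw [ENNReal.mul_le_iff_le_inv (pow_ne_zero _ two_ne_zero) (ENNReal.pow_ne_top (by simp))] at h4
    rw [hT, mul_comm, ← ENNReal.inv_pow]
    exact h4
  have hG : ∀ j, ∃ G : E m → ContinuousMultilinearMap ℝ (fun _ : Fin j => E m) F,
      j ∈ Finset.Icc 1 k → MemLp G p (volume.restrict Ω) ∧
      (∀ n, MemLp (iteratedFDeriv ℝ j (f n ∘ Φ)) p (volume.restrict Ω)) ∧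
      Tendsto (fun n => eLpNorm (iteratedFDeriv ℝ j (f n ∘ Φ) - G) p (volume.restrict Ω))
        atTop (𝓝 0) ∧
      ∀ N ⊆ Ω, MeasurableSet N → ENNReal.ofReal (η ^ j) * eLpNorm G p (volume.restrict N) ≤
        ENNReal.ofReal A * ∑ i ∈ Finset.Icc 1 j,
          ENNReal.ofReal (η ^ i) * eLpNorm (g i ∘ Φ) p (volume.restrict N) := by
    intro j
    by_cases hj : j ∈ Finset.Icc 1 k
    · have hik : ∀ i ∈ Finset.Icc 1 j, i ≤ k := fun i hi =>
        (Finset.mem_Icc.1 hi).2.trans (Finset.mem_Icc.1 hj).2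
      obtain ⟨G, hG⟩ := exists_tendsto_iteratedFDeriv_comp hp hΩ hΦ hΦΩ hη hA
        (fun g hg x hx => hchain g hg j hj x hx) hf (fun i hi => hgΦL i (hik i hi)) hKtop
        fun n i hi => hconv n i (hik i hi)
      exact ⟨G, fun _ => hG⟩
    · exact ⟨0, fun h => absurd h hj⟩
  choose G hG using hG
  have hpow : ∀ {c r : ℝ≥0∞}, c ≠ ⊤ → r < 1 → Tendsto (fun n : ℕ => c * r ^ n) atTop (𝓝 0) := by
    intro c r hc hr
    have := ENNReal.Tendsto.const_mul (ENNReal.tendsto_pow_atTop_nhds_zero_of_lt_one hr)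
      (Or.inr hc : (0 : ℝ≥0∞) ≠ 0 ∨ c ≠ ⊤)
    rwa [mul_zero] at this
  have hfuL : ∀ n, eLpNorm (f n - u) p (volume.restrict Ω) ≤ 4⁻¹ ^ n := by
    intro n
    refine le_of_eq_of_le (eLpNorm_congr_norm_ae ?_) (hfg' n 0 (Nat.zero_le k))
    filter_upwards [hu'e] with x hx
    rw [Pi.sub_apply, ← hx, hfu]
  have hfm : ∀ n, MemLp (f n) p (volume.restrict Ω) := by
    intro n
    have h : MemLp (f n - u) p (volume.restrict Ω) :=
      ⟨((hf n).continuousOn.aestronglyMeasurable hΩm).sub hu.memLp.1,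
        (hfuL n).trans_lt (ENNReal.pow_lt_top (by simp))⟩
    simpa using h.add hu.memLp
  have hfdm : ∀ n, ∀ j ∈ Finset.Icc 1 k,
      MemLp (iteratedFDeriv ℝ j (f n)) p (volume.restrict Ω) := by
    intro n j hj
    have hj := (Finset.mem_Icc.1 hj).2
    have h : MemLp (iteratedFDeriv ℝ j (f n) - g j) p (volume.restrict Ω) :=
      ⟨((ContDiffOn.continuousOn_iteratedFDeriv hΩ (hf n) j).aestronglyMeasurable hΩm).sub
        (hgL j hj).1, (hfg' n j hj).trans_lt (ENNReal.pow_lt_top (by simp))⟩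
    simpa using h.add (hgL j hj)
  set v : E m → F := u' ∘ Φ
  have hvL : MemLp v p (volume.restrict Ω) := by
    refine (hgΦL 0 (Nat.zero_le k)).congr_norm
      (hu'm.comp_measurable hΦm).aestronglyMeasurable (ae_of_all _ fun x => ?_)
    exact (ContinuousMultilinearMap.fin0_apply_norm _).symm
  have hfvL : ∀ n, eLpNorm (f n ∘ Φ - v) p (volume.restrict Ω) ≤ K * 2⁻¹ ^ n := by
    intro n
    refine le_of_eq_of_le (eLpNorm_congr_norm_ae (ae_of_all _ fun x => ?_))
      (hconv n 0 (Nat.zero_le k))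
    exact hfu n (Φ x)
  have hfΦ : ∀ n, ContDiffOn ℝ ∞ (f n ∘ Φ) Ω := fun n => (hf n).comp hΦ.contDiffOn hΦΩ
  have hfvm : ∀ n, MemLp (f n ∘ Φ) p (volume.restrict Ω) := by
    intro n
    have h : MemLp (f n ∘ Φ - v) p (volume.restrict Ω) :=
      ⟨((hfΦ n).continuousOn.aestronglyMeasurable hΩm).sub hvL.1,
        (hfvL n).trans_lt (ENNReal.mul_lt_top hKtop.lt_top (ENNReal.pow_lt_top (by simp)))⟩
    simpa using h.add hvL
  have hfv : Tendsto (fun n => eLpNorm (f n ∘ Φ - v) p (volume.restrict Ω)) atTop (𝓝 0) :=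
    tendsto_of_tendsto_of_tendsto_of_le_of_le tendsto_const_nhds
      (hpow hKtop (by simp)) (fun _ => zero_le) hfvL
  have hGw : ∀ j ∈ Finset.Icc 1 k, IsWeakDeriv j Ω v (G j) := fun j hj =>
    IsWeakDeriv.of_tendsto hp (fun n => isWeakDeriv_of_contDiffOn hΩ (hfΦ n) j) hfvm hvL hfv
      (hG j hj).2.1 (hG j hj).1 (hG j hj).2.2.1
  have hsmall : ∀ {X : ℕ → ℝ≥0∞}, (∀ n, X n ≤ 4⁻¹ ^ n) → Tendsto X atTop (𝓝 0) := fun hX =>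
    tendsto_of_tendsto_of_tendsto_of_le_of_le tendsto_const_nhds
      (hpow ENNReal.one_ne_top (r := 4⁻¹) (by simp)) (fun _ => zero_le) fun n => by
        rw [one_mul]; exact hX n
  refine ⟨v, ⟨f, hf, ?_, ?_⟩, ?_, ?_⟩
  · refine tendstoSobolev_of_isWeakDeriv hΩ (gn := fun n j => iteratedFDeriv ℝ j (f n))
      (g := weakJet Ω u) hfm hu.memLp (fun n j _ => isWeakDeriv_of_contDiffOn hΩ (hf n) j)
      (fun j hj => hu.isWeakDeriv_weakJet hp (Finset.mem_Icc.1 hj).2) hfdm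
      (fun j hj => hu.memLp_weakJet (Finset.mem_Icc.1 hj).2) (hsmall hfuL) fun j hj =>
        hsmall fun n => hfg n j (Finset.mem_Icc.1 hj).2
  · exact tendstoSobolev_of_isWeakDeriv hΩ (gn := fun n j => iteratedFDeriv ℝ j (f n ∘ Φ))
      (g := G) hfvm hvL (fun n j _ => isWeakDeriv_of_contDiffOn hΩ (hfΦ n) j) hGw
      (fun n j hj => (hG j hj).2.1 n) (fun j hj => (hG j hj).1) hfv
      fun j hj => (hG j hj).2.2.1
  · rw [← essRange_congr hΩm hu'e]
    -- The preimage under `Φ` of the null set where `u'` leaves its essential range is a null set.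
    refine essRange_subset_of_ae_mem hΩm hRc ?_
    have h := hwΩ (Sum.inr (Sum.inr ()))
    simp only [Sum.elim_inr] at h
    have hB : MeasurableSet {x | u' x ∉ essRange Ω u'} :=
      hu'm.measurable hRc.measurableSet.compl
    have h0 : ∫⁻ x in Ω, {x | u' x ∉ essRange Ω u'}.indicator (1 : E m → ℝ≥0∞) x = 0 := by
      rw [lintegral_indicator_one hB]
      exact ae_mem_essRange hΩm hu'm.measurable
    have hm : Measurable fun x =>
        {x | u' x ∉ essRange Ω u'}.indicator (1 : E m → ℝ≥0∞) (Φ x) :=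
      (measurable_one.indicator hB).comp hΦm
    rw [h0, mul_zero, nonpos_iff_eq_zero, lintegral_eq_zero_iff hm] at h
    filter_upwards [h] with x hx
    by_contra hn
    simp [show Φ x ∈ {x | u' x ∉ essRange Ω u'} from hn] at hx
  · intro N hN hNm hw j hj
    have hμ : (volume : Measure (E m)).restrict N ≤ volume.restrict Ω :=
      Measure.restrict_mono hN le_rfl
    have hvG : eLpNorm (weakDeriv j Ω v) p (volume.restrict N) =
        eLpNorm (G j) p (volume.restrict N) :=
      eLpNorm_congr_ae (ae_mono hμ ((hGw j hj).weakDeriv_ae_eq hΩ))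
    rw [hvG, mul_assoc, Finset.mul_sum _ _ (C ^ (1 / p.toReal))]
    refine ((hG j hj).2.2.2 N hN hNm).trans ?_
    refine mul_le_mul_right (Finset.sum_le_sum fun i hi => ?_) _
    rw [Finset.mem_Icc] at hi hj
    rw [mul_left_comm]
    have hug : eLpNorm (weakDeriv i Ω u) p (volume.restrict N) =
        eLpNorm (g i) p (volume.restrict N) := by
      rw [← weakJet_of_pos hi.1]
      exact eLpNorm_congr_ae (ae_mono hμ (hge i (hi.2.trans hj.2)))
    rw [hug]
    gcongr
    exact hbound N (fun i => hw (Sum.inl i)) i (hi.2.trans hj.2)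

end Main

end CubeOpening

theorem mainTheorem4 (m k : ℕ) (hk : 1 ≤ k) (p : ℝ≥0∞) (hp : 1 ≤ p) (hp_top : p ≠ ⊤)
    (ρ : ℝ) (hρ_pos : 0 < ρ) (hρ_lt : ρ < 1 / 2) :
    ∃ C C' : ℝ, 0 < C ∧ 0 < C' ∧
      ∀ (ν ℓ : ℕ) (_ : ℓ < m) (η : ℝ) (_ : 0 < η)
        (U : Set (CubeOpening.Cell m)) (_ : CubeOpening.IsSubskeleton η ℓ U)
        (Ω : Set (CubeOpening.E m))
        (_ : Ω = CubeOpening.cellUnion η U + CubeOpening.openCube m (2 * ρ * η))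
        (u : CubeOpening.E m → CubeOpening.E ν) (_ : CubeOpening.MemSobolev k p Ω u),
        ∃ Φ : CubeOpening.E m → CubeOpening.E m, ContDiff ℝ ∞ Φ ∧
          (∀ i ≤ ℓ, ∀ σ ∈ CubeOpening.skeleton η i U, ∀ x ∈ σ.carrier η,
            ∀ y ∈ σ.normalCube (ρ * η) x, ∀ z ∈ σ.normalCube (ρ * η) x, Φ y = Φ z) ∧
          CubeOpening.geomSupport Φ ⊆ Ω ∧
          Φ '' Ω ⊆ Ω ∧
          ∃ v : CubeOpening.E m → CubeOpening.E ν,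
            CubeOpening.IsSobolevComp k p Ω u Φ v ∧
            CubeOpening.MemSobolev k p Ω v ∧
            (∀ j ∈ Finset.Icc 1 k,
              ENNReal.ofReal (η ^ j) *
                  eLpNorm (CubeOpening.weakDeriv j Ω v) p (volume.restrict Ω) ≤
                ENNReal.ofReal C * ∑ i ∈ Finset.Icc 1 j, ENNReal.ofReal (η ^ i) *
                  eLpNorm (CubeOpening.weakDeriv i Ω u) p (volume.restrict Ω)) ∧
            (∀ σ ∈ U, ∀ j ∈ Finset.Icc 1 k,
              ENNReal.ofReal (η ^ j) *
                  eLpNorm (CubeOpening.weakDeriv j Ω v) p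
                    (volume.restrict (σ.carrier η + CubeOpening.openCube m (2 * ρ * η))) ≤
                ENNReal.ofReal C' * ∑ i ∈ Finset.Icc 1 j, ENNReal.ofReal (η ^ i) *
                  eLpNorm (CubeOpening.weakDeriv i Ω u) p
                    (volume.restrict (σ.carrier η + CubeOpening.openCube m (2 * ρ * η)))) ∧
            CubeOpening.essRange Ω v ⊆ CubeOpening.essRange Ω u := by
  open CubeOpening in
  rcases m.eq_zero_or_pos with rfl | hm
  · -- there is no `ℓ < 0`
    exact ⟨1, 1, one_pos, one_pos, fun ν ℓ hℓ => absurd hℓ (Nat.not_lt_zero ℓ)⟩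
  obtain ⟨B, A, hB, hA, hgeom⟩ := exists_openingMap_of_isSubskeleton hm hρ_pos hρ_lt k
    (ι := Fin (k + 1) ⊕ Fin (k + 1) ⊕ Unit)
  -- The summand `1` only serves to make the constant positive.
  set c : ℝ := A * (B ^ (1 / p.toReal)).toReal + 1 with hc
  have hc0 : 0 < c := by positivity
  have hcle : ENNReal.ofReal A * B ^ (1 / p.toReal) ≤ ENNReal.ofReal c := by
    have hfin : B ^ (1 / p.toReal) ≠ ⊤ := ENNReal.rpow_ne_top_of_nonneg (by positivity) hB
    rw [← ENNReal.ofReal_toReal hfin, ← ENNReal.ofReal_mul hA.le]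
    exact ENNReal.ofReal_le_ofReal (by rw [hc]; linarith)
  refine ⟨c, c, hc0, hc0, fun ν ℓ hℓ η hη U hU Ω hΩ u hu => ?_⟩
  have hopen : ∀ N : Set (E m), IsOpen (N + openCube m (2 * ρ * η)) := fun N =>
    (isOpen_openCube m _).add_left
  have hΩo : IsOpen Ω := hΩ ▸ hopen _
  obtain ⟨w, hwm, hw⟩ := exists_controlling_functions hp hp_top hΩo hu
  obtain ⟨Φ, hΦ, hconst, hsupp, hN, hchain⟩ := hgeom ℓ hℓ η hη U hU w hwm
  obtain ⟨hmaps, hint⟩ := hN Ω (Or.inl hΩ)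
  obtain ⟨v, hv, hess, hest⟩ := hw B A η Φ hB hA.le hη hΦ hmaps
    (fun g hg j hj x hx => hchain ν g Ω hΩo hg j hj x (hmaps hx)) hint
  refine ⟨Φ, hΦ, hconst, hΩ ▸ hsupp, hmaps.image_subset, v, hv, ?_, fun j hj => ?_,
    fun σ hσ j hj => ?_, hess⟩
  · obtain ⟨un, -, -, h⟩ := hv
    exact h.mem_lim
  · exact (hest Ω subset_rfl hΩo.measurableSet hint j hj).trans (mul_le_mul_left hcle _)
  · have hσΩ : σ.carrier η + openCube m (2 * ρ * η) ⊆ Ω := by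
      rw [hΩ]
      exact add_subset_add_right (subset_biUnion_of_mem (u := fun τ : Cell m => τ.carrier η) hσ)
    exact (hest _ hσΩ (hopen _).measurableSet (hN _ (Or.inr ⟨σ, hσ, rfl⟩)).2 j hj).trans
      (mul_le_mul_left hcle _)
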